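/- **Setting.** Let $\Theta=\{x\in\mathbb R^2:|x|<1\}$, let $J_0$ be the Bessel function of order zero, $0<z_1<z_2<\cdots$ its positive zeros, and $e_n(x)=\|J_0(z_n|\cdot|)\|_{L^2(\Theta)}^{-1}J_0(z_n|x|)$, $n\ge 1$, the $L^2$-normalised radial Dirichlet eigenfunctions. For $\sigma\ge 0$ let $H^\sigma_{rad}(\Theta)$ be the space of $u=\sum_n a_ne_n$, $a_n\in\mathbb C$, with $\|u\|_{H^\sigma_{rad}}^2=\sum_n z_n^{2\sigma}|a_n|^2<\infty$, and let $E_N$ be the complex span of $e_1,\dots,e_N$. Let $V\in C^\infty(\mathbb C;\mathbb R)$ be of the form $V(z)=G(|z|^2)$ with $G\in C^\infty(\mathbb R;\mathbb R)$, and suppose that there are $\alpha\in(0,4)$ and $\beta\in[2,4)$ such that for all integers $k_1,k_2\ge0$ there is $C>0$ with $|\partial^{k_1}\bar\partial^{k_2}V(z)|\le C(1+|z|)^{2+\alpha-k_1-k_2}$ for all $z\in\mathbb C$, and there is $C>0$ with $V(z)\ge -C(1+|z|)^{\beta}$ for all $z\in\mathbb C$. Fix $s$ with $\max\big(\tfrac13,1-\tfrac2\alpha,1-\tfrac2\beta\big)<s<\tfrac12$,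 and let $\chi:\mathbb R\to[0,\infty)$ be continuous with compact support. Let $(g_n)_{n\ge1}$ be i.i.d. complex Gaussians $g_n=\frac1{\sqrt2}(h_n+il_n)$ with $h_n,l_n$ independent standard real Gaussians. Let $\mu$ be the distribution on $H^s_{rad}(\Theta)$ (with its Borel $\sigma$-algebra) of $\varphi=\sum_{n\ge1}\frac{g_n}{z_n}e_n$, and $\mu_N$ the distribution on $E_N$ of $\varphi_N=\sum_{n=1}^N\frac{g_n}{z_n}e_n$. Define $$d\rho(u)=\chi(\|u\|_{L^2(\Theta)})\,e^{-\int_\Theta V(u)}\,d\mu(u),\qquad d\rho_N(u)=\chi(\|u\|_{L^2(\Theta)})\,e^{-\int_\Theta V(u)}\,d\mu_N(u).$$ **Theorem.** The integral $\int_\Theta V(u)$ is well defined and finite for $\mu$-almost every $u$, and for every $p\in[1,\infty)$, $$\chi(\|u\|_{L^2(\Theta)})\exp\Big(-\int_\Theta V(u)\Big)\in L^p(d\mu(u)).$$ Moreover, let $\sigma\in[s,\tfrac12)$. Every open set $U$ and every closed set $F$ of $H^\sigma_{rad}(\Theta)$ is a Borel subset of $H^s_{rad}(\Theta)$, and $$\rho(U)\le\liminf_{N\to\infty}\rho_N(U\cap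 E_N),\qquad \rho(F)\ge\limsup_{N\to\infty}\rho_N(F\cap E_N).$$ -/

import Mathlib

open MeasureTheory ProbabilityTheory Filter Topology
open scoped ContDiff ENNReal

noncomputable section

namespace GibbsDisc

/-! ### The Bessel function `J₀` and its positive zeros -/

/-- The Bessel function of order zero, through Bessel's integral
`J₀(x) = (1/π) ∫₀^π cos (x sin θ) dθ`. -/
def J0 (x : ℝ) : ℝ :=
  Real.pi⁻¹ * ∫ θ in (0 : ℝ)..Real.pi, Real.cos (x * Real.sin θ)

theorem continuous_J0 : Continuous J0 := by
  unfold J0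
  refine continuous_const.mul ?_
  exact intervalIntegral.continuous_parametric_intervalIntegral_of_continuous'
    (by unfold Function.uncurry; fun_prop) _ _

theorem abs_J0_le (x : ℝ) : |J0 x| ≤ 1 := by
  unfold J0
  have h : ‖∫ θ in (0 : ℝ)..Real.pi, Real.cos (x * Real.sin θ)‖ ≤ 1 * |Real.pi - 0| :=
    intervalIntegral.norm_integral_le_of_norm_le_const
      (fun θ _ => by simpa using Real.abs_cos_le_one _)
  rw [sub_zero, one_mul, abs_of_pos Real.pi_pos, Real.norm_eq_abs] at h
  rw [abs_mul, abs_of_pos (inv_pos.2 Real.pi_pos)]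
  calc Real.pi⁻¹ * _ ≤ Real.pi⁻¹ * Real.pi :=
        mul_le_mul_of_nonneg_left h (inv_pos.2 Real.pi_pos).le
    _ = 1 := inv_mul_cancel₀ Real.pi_pos.ne'

/-- The positive zeros of `J₀` in increasing order, counted from `0`: `z n` is the
`(n + 1)`-st positive zero. -/
def z : ℕ → ℝ
  | 0 => sInf {x : ℝ | 0 < x ∧ J0 x = 0}
  | n + 1 => sInf {x : ℝ | z n < x ∧ J0 x = 0}

/-! ### The unit disc and the radial Dirichlet eigenfunctions -/

/-- The open unit disc of `ℝ²`. -/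
def disc : Set (EuclideanSpace ℝ (Fin 2)) := Metric.ball 0 1

/-- Lebesgue measure on the unit disc. -/
def vol : Measure (EuclideanSpace ℝ (Fin 2)) := volume.restrict disc

instance : IsFiniteMeasure vol :=
  ⟨by unfold vol disc; simp⟩

/-- The complex Hilbert space `L²` of the disc. -/
abbrev L2 : Type := Lp ℂ 2 vol

theorem memLp_bessel (n : ℕ) :
    MemLp (fun x : EuclideanSpace ℝ (Fin 2) => ((J0 (z n * ‖x‖) : ℝ) : ℂ)) 2 vol := by
  refine MemLp.of_bound (C := 1) ?_ (Eventually.of_forall fun x => ?_)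
  · have := continuous_J0
    exact (by fun_prop : Continuous fun x : EuclideanSpace ℝ (Fin 2) =>
      ((J0 (z n * ‖x‖) : ℝ) : ℂ)).aestronglyMeasurable
  · simpa using abs_J0_le (z n * ‖x‖)

/-- The function `x ↦ J₀(zₙ |x|)` as an element of `L²` of the disc. -/
def besselFun (n : ℕ) : L2 := (memLp_bessel n).toLp _

/-- The `L²`-normalised radial eigenfunctions `eₙ = J₀(zₙ |x|) / ‖J₀(zₙ |·|)‖` of the
Dirichlet Laplacian. -/
def e (n : ℕ) : L2 := ((‖besselFun n‖⁻¹ : ℝ) : ℂ) • besselFun n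

/-! ### Radial Sobolev spaces -/

/-- The functions `u = ∑ aₙ eₙ` with `∑ zₙ^{2σ} |aₙ|² < ∞`, as a subspace of `L²` (`σ ≥ 0`);
the coefficients are `aₙ = ⟨u, eₙ⟩`. -/
def hRad (σ : ℝ) : Submodule ℂ L2 where
  carrier := {u | HasSum (fun n => inner ℂ (e n) u • e n) u ∧
    Memℓp (fun n => ((z n ^ σ : ℝ) : ℂ) * inner ℂ (e n) u) 2}
  add_mem' := by
    rintro u v ⟨hu, hu'⟩ ⟨hv, hv'⟩
    refine ⟨?_, ?_⟩
    · simpa only [inner_add_right, add_smul] using hu.add hv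
    · have := hu'.add hv'
      simp only [inner_add_right, mul_add]
      exact this
  zero_mem' := by
    refine ⟨?_, ?_⟩
    · simp [hasSum_zero]
    · simp only [inner_zero_right, mul_zero]
      exact zero_memℓp
  smul_mem' := by
    rintro c u ⟨hu, hu'⟩
    refine ⟨?_, ?_⟩
    · simpa only [inner_smul_right, mul_smul] using hu.const_smul c
    · have := hu'.const_smul c
      simp only [inner_smul_right, mul_left_comm _ c]
      exact this

/-- The radial Sobolev space `H^σ_rad`. A type of its own, because its norm is not the
`L²` norm. -/
def HRad (σ : ℝ) : Type := ↥(hRad σ)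

instance (σ : ℝ) : AddCommGroup (HRad σ) := inferInstanceAs (AddCommGroup ↥(hRad σ))

instance (σ : ℝ) : Module ℂ (HRad σ) := inferInstanceAs (Module ℂ ↥(hRad σ))

/-- The underlying `L²` function. -/
def HRad.toL2 {σ : ℝ} (u : HRad σ) : L2 := u.1

/-- The weighted coefficients `(zₙ^σ ⟨u, eₙ⟩)ₙ` in `ℓ²`. -/
def weightedCoeff (σ : ℝ) : HRad σ →ₗ[ℂ] lp (fun _ : ℕ => ℂ) 2 where
  toFun u := ⟨fun n => ((z n ^ σ : ℝ) : ℂ) * inner ℂ (e n) u.toL2, u.2.2⟩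
  map_add' u v := by
    ext n
    change _ * inner ℂ (e n) (u.toL2 + v.toL2) =
      _ * inner ℂ (e n) u.toL2 + _ * inner ℂ (e n) v.toL2
    rw [inner_add_right, mul_add]
  map_smul' c u := by
    ext n
    change _ * inner ℂ (e n) (c • u.toL2) = c * (_ * inner ℂ (e n) u.toL2)
    rw [inner_smul_right, mul_left_comm]

/-- The norm `‖u‖_{H^σ} = (∑ zₙ^{2σ} |⟨u, eₙ⟩|²)^{1/2}`. It is definite because all `zₙ` are
positive and `u` is the sum of its expansion; only the topology matters below. -/
instance (σ : ℝ) : SeminormedAddCommGroup (HRad σ) :=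
  SeminormedAddCommGroup.induced (HRad σ) (lp (fun _ : ℕ => ℂ) 2) (weightedCoeff σ)

instance (σ : ℝ) : NormedSpace ℂ (HRad σ) :=
  NormedSpace.induced ℂ (HRad σ) (lp (fun _ : ℕ => ℂ) 2) (weightedCoeff σ)

/-- `H^σ_rad` carries its Borel sigma algebra. -/
instance (σ : ℝ) : MeasurableSpace (HRad σ) := borel (HRad σ)

instance (σ : ℝ) : BorelSpace (HRad σ) := ⟨rfl⟩

/-- The space `E_N` spanned by the first `N` eigenfunctions. -/
def EN (N : ℕ) : Submodule ℂ L2 := Submodule.span ℂ (e '' {n | n < N})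

instance (N : ℕ) : MeasurableSpace (EN N) := borel (EN N)

instance (N : ℕ) : BorelSpace (EN N) := ⟨rfl⟩

/-! ### The free measure and its finite dimensional approximations -/

/-- The law of a normalised complex Gaussian `(h + i l) / √2`, where `h` and `l` are
independent standard real Gaussians. -/
def complexGaussian : Measure ℂ :=
  ((gaussianReal 0 1).prod (gaussianReal 0 1)).map
    (fun p : ℝ × ℝ => ((p.1 : ℂ) + Complex.I * (p.2 : ℂ)) / ((√2 : ℝ) : ℂ))

instance : IsProbabilityMeasure complexGaussian :=
  Measure.isProbabilityMeasure_map (by fun_prop)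

/-- The canonical probability space on which the coordinates `gₙ` are independent normalised
complex Gaussians. -/
def gaussianSeq : Measure (ℕ → ℂ) := Measure.infinitePi (fun _ : ℕ => complexGaussian)

open Classical in
/-- The random series `φ = ∑ (gₙ / zₙ) eₙ` as an element of `H^s_rad` (set to `0` on the null
set of those `g` for which the sum does not exist or does not lie in `H^s_rad`). -/
def phi (s : ℝ) (g : ℕ → ℂ) : HRad s :=
  if h : Summable (fun n => (g n / (z n : ℂ)) • e n) ∧
      ∑' n, (g n / (z n : ℂ)) • e n ∈ hRad s then
    ⟨∑' n, (g n / (z n : ℂ)) • e n, h.2⟩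
  else 0

/-- The partial sum `φ_N` of the random series, as an element of `E_N`. -/
def phiN (N : ℕ) (g : ℕ → ℂ) : EN N :=
  ⟨∑ n ∈ Finset.range N, (g n / (z n : ℂ)) • e n,
    Submodule.sum_mem _ fun n hn => Submodule.smul_mem _ _
      (Submodule.subset_span ⟨n, Finset.mem_range.1 hn, rfl⟩)⟩

/-- The free measure `μ` on `H^s_rad`: the distribution of `φ`. -/
def mu (s : ℝ) : Measure (HRad s) := gaussianSeq.map (phi s)

/-- The measure `μ_N` on `E_N`: the distribution of `φ_N`. -/
def muN (N : ℕ) : Measure (EN N) := gaussianSeq.map (phiN N)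

/-! ### The Gibbs measures -/

/-- The Gibbs density `χ(‖u‖_{L²}) exp(-∫ V(u))`. -/
def gibbsDensity (V : ℂ → ℝ) (χ : ℝ → ℝ) (u : L2) : ℝ :=
  χ ‖u‖ * Real.exp (-∫ x, V (u x) ∂vol)

/-- The measure `ρ` on `H^s_rad`. -/
def rho (V : ℂ → ℝ) (χ : ℝ → ℝ) (s : ℝ) : Measure (HRad s) :=
  (mu s).withDensity fun u => ENNReal.ofReal (gibbsDensity V χ u.toL2)

/-- The measure `ρ_N` on `E_N`. -/
def rhoN (V : ℂ → ℝ) (χ : ℝ → ℝ) (N : ℕ) : Measure (EN N) :=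
  (muN N).withDensity fun u => ENNReal.ofReal (gibbsDensity V χ (u : L2))

/-- A set `A ⊆ H^σ_rad`, seen as a subset of `H^s_rad` (both are spaces of `L²` functions, and
`H^σ_rad ⊆ H^s_rad` for `s ≤ σ`). -/
def inHs (s : ℝ) {σ : ℝ} (A : Set (HRad σ)) : Set (HRad s) :=
  {u | ∃ v ∈ A, v.toL2 = u.toL2}

/-- The set `A ∩ E_N`, for `A ⊆ H^σ_rad`. -/
def interEN (N : ℕ) {σ : ℝ} (A : Set (HRad σ)) : Set (EN N) :=
  {u | ∃ v ∈ A, v.toL2 = (u : L2)}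

/-! ### Wirtinger derivatives -/

/-- `∂f = (∂ₓ f - i ∂ᵧ f) / 2`. -/
def dZ (f : ℂ → ℂ) (w : ℂ) : ℂ := (fderiv ℝ f w 1 - Complex.I * fderiv ℝ f w Complex.I) / 2

/-- `∂̄f = (∂ₓ f + i ∂ᵧ f) / 2`. -/
def dZbar (f : ℂ → ℂ) (w : ℂ) : ℂ := (fderiv ℝ f w 1 + Complex.I * fderiv ℝ f w Complex.I) / 2

end GibbsDisc

end

noncomputable section

namespace GibbsDisc

/-! ### The Bessel equation -/

/-! The difficulty is the exponential integrability of `-∫ V(u)`, bounded by a multiple of `1 + ∫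
|u|^β`, on a ball of `L²`. The crux is the estimate of `exists_moment_le`, for `2 ≤ b < 4` and with
`K` independent of `N` and `m`: E[(∫ |φ_N|^b)^m ; ‖φ_N‖ < R] ≤ (K m^{b/4})^m. Since `m!` is at least
`(m/e)^m` and `b < 4`, the exponential series of `A ∫ |φ_N|^b` then has a finite expectation for
every finite `A`, with the cutoff in place.

The estimate comes from splitting the frequencies at `√m`, a level that moves with the moment. About
`√m` eigenfunctions lie below it, each with `eₙ² ≤ C √m`, so Cauchy–Schwarz and the `L²` bound give
a sup norm `O(√m)` for the low part; interpolation with `L²` gives `∫ |low|^b = O(m^{(b-2)/2})`,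
which is `O(m^{b/4})` because `b ≤ 4`. Above the level no cutoff is needed: at `x` the series is
Gaussian with variance `O(m^{-1/2} |x|⁻¹)`, so its moment of order `bm` is at most `2 (C √m /
|x|)^{bm/2}`, and Hölder's inequality with the weight `|x|^{-b/2}`, integrable on the disc as `b <
4`, handles the origin.

The facts used about the eigenfunctions are: gaps between zeros bounded below, `x J₀(x)²` bounded,
and `‖J₀(zₙ|·|)‖² ≥ c / zₙ`. All follow from the equation `w'' + (1 + 1/(4x²)) w = 0` for `w = √x
J₀`, whose energy `w'² + w²` stays between two positive constants on `[1, ∞)`.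

The moment bounds pass from `φ_N` to `φ` by Fatou's lemma, because the functionals are lower
semicontinuous on `L²`. Next, the Gibbs densities at `φ_N` converge in `L¹` of the Gaussian space to
the density at `φ` (`tendsto_lintegral_gibbsDensity_sub`): truncating `V` at `± L` costs `O(1/L)`
uniformly in `N`, and the truncated density is bounded and continuous on `L²`. Finally `φ_N → φ`
almost surely in `H^σ` for `σ < 1/2`. Fatou's lemma on open sets and its reverse on closed sets,
with the densities replaced by their `L¹` limit, give the two inequalities. -/

/-- The derivative of `J₀`. -/
def J0' (x : ℝ) : ℝ :=
  -(Real.pi⁻¹ * ∫ θ in (0 : ℝ)..Real.pi, Real.sin θ * Real.sin (x * Real.sin θ))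

/-- The second derivative of `J₀`. -/
def J0'' (x : ℝ) : ℝ :=
  -(Real.pi⁻¹ * ∫ θ in (0 : ℝ)..Real.pi, Real.sin θ ^ 2 * Real.cos (x * Real.sin θ))

theorem hasDerivAt_J0 (x : ℝ) : HasDerivAt J0 (J0' x) x := by
  have h := (intervalIntegral.hasDerivAt_integral_of_dominated_loc_of_deriv_le
    (μ := volume) (a := 0) (b := Real.pi) (x₀ := x) (s := Set.univ) (bound := fun _ => 1)
    (F := fun x θ => Real.cos (x * Real.sin θ))
    (F' := fun x θ => -(Real.sin θ * Real.sin (x * Real.sin θ)))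
    univ_mem (Eventually.of_forall fun y => (by fun_prop : Continuous _).aestronglyMeasurable)
    ((by fun_prop : Continuous _).intervalIntegrable _ _)
    ((by fun_prop : Continuous _).aestronglyMeasurable)
    (Eventually.of_forall fun θ _ y _ => by
      rw [norm_neg, norm_mul]
      exact mul_le_one₀ (Real.abs_sin_le_one _) (norm_nonneg _) (Real.abs_sin_le_one _))
    (by simp)
    (Eventually.of_forall fun θ _ y _ => by
      have := ((hasDerivAt_id y).mul_const (Real.sin θ)).cos
      exact this.congr_deriv (by simp; ring))).2
  have h2 := h.const_mul Real.pi⁻¹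
  simp only [intervalIntegral.integral_neg, mul_neg] at h2
  exact h2

theorem hasDerivAt_J0' (x : ℝ) : HasDerivAt J0' (J0'' x) x := by
  have h := (intervalIntegral.hasDerivAt_integral_of_dominated_loc_of_deriv_le
    (μ := volume) (a := 0) (b := Real.pi) (x₀ := x) (s := Set.univ) (bound := fun _ => 1)
    (F := fun x θ => Real.sin θ * Real.sin (x * Real.sin θ))
    (F' := fun x θ => Real.sin θ ^ 2 * Real.cos (x * Real.sin θ))
    univ_mem (Eventually.of_forall fun y => (by fun_prop : Continuous _).aestronglyMeasurable)
    ((by fun_prop : Continuous _).intervalIntegrable _ _)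
    ((by fun_prop : Continuous _).aestronglyMeasurable)
    (Eventually.of_forall fun θ _ y _ => by
      rw [norm_mul, norm_pow]
      exact mul_le_one₀ (pow_le_one₀ (norm_nonneg _) (Real.abs_sin_le_one _)) (norm_nonneg _)
        (Real.abs_cos_le_one _))
    (by simp)
    (Eventually.of_forall fun θ _ y _ => by
      have := (((hasDerivAt_id y).mul_const (Real.sin θ)).sin).const_mul (Real.sin θ)
      exact this.congr_deriv (by simp; ring))).2
  exact (h.const_mul Real.pi⁻¹).neg

/-- The function `cos θ · sin (x sin θ)` vanishes at both ends of `[0, π]`; the integral of its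
derivative is the equation. -/
theorem bessel_equation (x : ℝ) : x * J0'' x + J0' x + x * J0 x = 0 := by
  have h1 : ∫ θ in (0 : ℝ)..Real.pi, (-Real.sin θ * Real.sin (x * Real.sin θ) +
      Real.cos θ * (Real.cos (x * Real.sin θ) * (x * Real.cos θ))) = 0 := by
    rw [intervalIntegral.integral_eq_sub_of_hasDerivAt
      (f := fun θ => Real.cos θ * Real.sin (x * Real.sin θ))]
    · simp
    · intro θ _
      exact (Real.hasDerivAt_cos θ).mul (((Real.hasDerivAt_sin θ).const_mul x).sin)
    · exact (by fun_prop : Continuous _).intervalIntegrable _ _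
  have h2 : ∀ θ, (-Real.sin θ * Real.sin (x * Real.sin θ) +
      Real.cos θ * (Real.cos (x * Real.sin θ) * (x * Real.cos θ))) =
      -(Real.sin θ * Real.sin (x * Real.sin θ)) + (x * Real.cos (x * Real.sin θ) -
        x * (Real.sin θ ^ 2 * Real.cos (x * Real.sin θ))) := by
    intro θ
    linear_combination (x * Real.cos (x * Real.sin θ)) * Real.cos_sq' θ
  simp only [h2] at h1
  rw [intervalIntegral.integral_add ((by fun_prop : Continuous _).intervalIntegrable _ _)
    ((by fun_prop : Continuous _).intervalIntegrable _ _),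
    intervalIntegral.integral_sub ((by fun_prop : Continuous _).intervalIntegrable _ _)
    ((by fun_prop : Continuous _).intervalIntegrable _ _), intervalIntegral.integral_neg,
    intervalIntegral.integral_const_mul, intervalIntegral.integral_const_mul] at h1
  unfold J0'' J0' J0
  linear_combination Real.pi⁻¹ * h1

/-- For `x ≤ 1` the argument `x sin θ` stays below `π / 2`, so the integrand is positive. This keeps
all positive zeros above `1`, in the range of the energy bounds. -/
theorem J0_pos_of_le_one {x : ℝ} (h0 : 0 ≤ x) (h1 : x ≤ 1) : 0 < J0 x := by
  unfold J0
  refine mul_pos (inv_pos.2 Real.pi_pos) ?_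
  refine intervalIntegral.intervalIntegral_pos_of_pos_on
    ((by fun_prop : Continuous _).intervalIntegrable _ _) (fun θ hθ => ?_) Real.pi_pos
  have hs := Real.sin_pos_of_pos_of_lt_pi hθ.1 hθ.2
  have hs1 := Real.sin_le_one θ
  have hp := Real.pi_gt_three
  refine Real.cos_pos_of_mem_Ioo ⟨?_, ?_⟩ <;> nlinarith

/-! ### The Liouville normal form -/

/-- `√x J₀(x)`, a solution of `w'' + (1 + 1 / (4 x²)) w = 0`. -/
def wJ (x : ℝ) : ℝ := √x * J0 x

/-- The derivative of `wJ`. -/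
def wJ' (x : ℝ) : ℝ := √x * J0' x + J0 x / (2 * √x)

theorem hasDerivAt_wJ {x : ℝ} (hx : 0 < x) : HasDerivAt wJ (wJ' x) x := by
  refine ((Real.hasDerivAt_sqrt hx.ne').mul (hasDerivAt_J0 x)).congr_deriv ?_
  unfold wJ'
  ring

theorem hasDerivAt_wJ' {x : ℝ} (hx : 0 < x) :
    HasDerivAt wJ' (-((1 + 1 / (4 * x ^ 2)) * wJ x)) x := by
  have hs : 0 < √x := Real.sqrt_pos.2 hx
  have hsq := Real.sq_sqrt hx.le
  have h := ((Real.hasDerivAt_sqrt hx.ne').mul (hasDerivAt_J0' x)).add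
    ((hasDerivAt_J0 x).div ((Real.hasDerivAt_sqrt hx.ne').const_mul 2) (by positivity))
  refine h.congr_deriv ?_
  have hb := bessel_equation x
  unfold wJ
  have e1 : J0'' x = -(J0' x + x * J0 x) / x := by
    field_simp; linarith
  rw [e1]
  have : x = √x ^ 2 := hsq.symm
  generalize √x = r at *
  subst this
  field_simp
  ring

/-- The energy `w'² + w²`. -/
def energy (x : ℝ) : ℝ := wJ' x ^ 2 + wJ x ^ 2

/-- The derivative is `O(x⁻²)` times the energy itself, hence integrable at infinity; this is why
the energy neither decays nor grows. -/
theorem hasDerivAt_energy {x : ℝ} (hx : 0 < x) :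
    HasDerivAt energy (-(wJ x * wJ' x) / (2 * x ^ 2)) x := by
  refine (((hasDerivAt_wJ' hx).pow 2).add ((hasDerivAt_wJ hx).pow 2)).congr_deriv ?_
  field_simp
  ring

/-- As `2 |w w'| ≤ energy`, the logarithmic derivative of the energy is at least `-1/(4x²)`; the
factor `exp (-1/(4x))` compensates exactly this loss and leaves a perfect square. -/
theorem exists_energy_lower : ∃ c > 0, ∀ x : ℝ, 1 ≤ x → c ≤ energy x := by
  have h1 : 0 < energy 1 := by
    have := J0_pos_of_le_one zero_le_one le_rfl
    have h : 0 < wJ 1 := by unfold wJ; simpa using this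
    unfold energy; positivity
  have hmono : MonotoneOn (fun x => energy x * Real.exp (-(1 / (4 * x)))) (Set.Ici 1) := by
    have hd : ∀ x : ℝ, 1 ≤ x → HasDerivAt (fun x => energy x * Real.exp (-(1 / (4 * x))))
        ((-(wJ x * wJ' x) / (2 * x ^ 2)) * Real.exp (-(1 / (4 * x))) +
          energy x * (Real.exp (-(1 / (4 * x))) * (1 / (4 * x ^ 2)))) x := by
      intro x hx
      have hx0 : 0 < x := by linarith
      refine (hasDerivAt_energy hx0).mul ?_
      refine HasDerivAt.exp ?_
      have := ((hasDerivAt_inv hx0.ne').const_mul (1 / 4 : ℝ)).neg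
      have hfun : (fun x : ℝ => -(1 / (4 * x))) = -fun y : ℝ => 1 / 4 * y⁻¹ := by
        ext y; simp [mul_comm]
      rw [hfun]
      exact this.congr_deriv (by field_simp)
    refine monotoneOn_of_deriv_nonneg (convex_Ici 1)
      (fun x hx => (hd x hx).continuousAt.continuousWithinAt)
      (fun x hx => (hd x (interior_subset hx)).differentiableAt.differentiableWithinAt) ?_
    intro x hx
    have hx1 : (1 : ℝ) ≤ x := interior_subset hx
    rw [(hd x hx1).deriv]
    have : (-(wJ x * wJ' x) / (2 * x ^ 2)) * Real.exp (-(1 / (4 * x))) +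
          energy x * (Real.exp (-(1 / (4 * x))) * (1 / (4 * x ^ 2))) =
        Real.exp (-(1 / (4 * x))) * ((wJ x - wJ' x) ^ 2 / (4 * x ^ 2)) := by
      unfold energy; field_simp; ring
    rw [this]
    positivity
  refine ⟨energy 1 * Real.exp (-(1 / (4 * 1))), by positivity, fun x hx => ?_⟩
  refine (hmono (Set.mem_Ici.2 le_rfl) (Set.mem_Ici.2 hx) hx).trans ?_
  have : Real.exp (-(1 / (4 * x))) ≤ 1 := Real.exp_le_one_iff.2 (by
    have : 0 < x := by linarith
    have : 0 ≤ 1 / (4 * x) := by positivity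
    linarith)
  have h0 : 0 ≤ energy x := by unfold energy; positivity
  exact mul_le_of_le_one_right h0 this

/-- The corrected energy is `w'² + (1 + 1/(4x²)) w²`. Along the equation only the coefficient
contributes to its derivative, and the coefficient decreases. -/
theorem exists_energy_upper : ∃ C > 0, ∀ x : ℝ, 1 ≤ x → energy x ≤ C := by
  have hanti : AntitoneOn (fun x => energy x + wJ x ^ 2 / (4 * x ^ 2)) (Set.Ici 1) := by
    have hd : ∀ x : ℝ, 1 ≤ x → HasDerivAt (fun x => energy x + wJ x ^ 2 / (4 * x ^ 2))
        (-(wJ x ^ 2 / (2 * x ^ 3))) x := by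
      intro x hx
      have hx0 : 0 < x := by linarith
      have := (hasDerivAt_energy hx0).add (((hasDerivAt_wJ hx0).pow 2).div
        (((hasDerivAt_id x).pow 2).const_mul 4) (by simp; positivity))
      refine this.congr_deriv ?_
      simp
      field_simp
      ring
    refine antitoneOn_of_deriv_nonpos (convex_Ici 1)
      (fun x hx => (hd x hx).continuousAt.continuousWithinAt)
      (fun x hx => (hd x (interior_subset hx)).differentiableAt.differentiableWithinAt) ?_
    intro x hx
    have hx1 : (1 : ℝ) ≤ x := interior_subset hx
    rw [(hd x hx1).deriv]
    have : 0 < x := by linarith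
    have : 0 ≤ wJ x ^ 2 / (2 * x ^ 3) := by positivity
    linarith
  refine ⟨energy 1 + wJ 1 ^ 2 / (4 * 1 ^ 2) + 1, ?_, fun x hx => ?_⟩
  · unfold energy; positivity
  · have h := hanti (Set.mem_Ici.2 le_rfl) (Set.mem_Ici.2 hx) hx
    have : 0 ≤ wJ x ^ 2 / (4 * x ^ 2) := by positivity
    simp only at h
    linarith

theorem exists_J0_sq_le : ∃ C > 0, ∀ x : ℝ, 0 < x → x * J0 x ^ 2 ≤ C := by
  obtain ⟨C, hC, h⟩ := exists_energy_upper
  refine ⟨C + 1, by linarith, fun x hx => ?_⟩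
  by_cases hx1 : 1 ≤ x
  · have := h x hx1
    have h2 : wJ x ^ 2 = x * J0 x ^ 2 := by unfold wJ; rw [mul_pow, Real.sq_sqrt hx.le]
    have : wJ x ^ 2 ≤ energy x := by unfold energy; nlinarith [sq_nonneg (wJ' x)]
    linarith
  · have := abs_J0_le x
    have : J0 x ^ 2 ≤ 1 := by rw [sq_le_one_iff_abs_le_one]; exact this
    nlinarith

theorem wJ_eq_zero_iff {x : ℝ} (hx : 0 < x) : wJ x = 0 ↔ J0 x = 0 := by
  unfold wJ
  simp [(Real.sqrt_pos.2 hx).ne']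

theorem one_lt_of_zero {x : ℝ} (hx : 0 < x) (h : J0 x = 0) : 1 < x := by
  by_contra! hle
  exact (J0_pos_of_le_one hx.le hle).ne' h

/-- Positive zeros of `J₀` are separated. -/
theorem exists_zero_separation : ∃ d > 0, ∀ a b : ℝ, 0 < a → a < b → J0 a = 0 → J0 b = 0 →
    a + d ≤ b := by
  obtain ⟨c, hc, hE⟩ := exists_energy_lower
  obtain ⟨C, hC, hE'⟩ := exists_energy_upper
  have hsC : 0 < √C := Real.sqrt_pos.2 hC
  have hsc : 0 < √c := Real.sqrt_pos.2 hc
  refine ⟨√c / (2 * √C), by positivity, fun a b ha hab h0a h0b => ?_⟩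
  have ha1 := one_lt_of_zero ha h0a
  have hb : 0 < b := ha.trans hab
  obtain ⟨ξ, hξ, hξ0⟩ := exists_hasDerivAt_eq_zero hab
    (fun x hx => (hasDerivAt_wJ (ha.trans_le hx.1)).continuousAt.continuousWithinAt)
    (by rw [(wJ_eq_zero_iff ha).2 h0a, (wJ_eq_zero_iff hb).2 h0b])
    (fun x hx => hasDerivAt_wJ (ha.trans hx.1))
  -- Between two zeros `w'` vanishes at some `ξ`, whereas at the zero `a` the whole energy sits in
  -- `w'`, so `|w' a| ≥ √c`. Since `|w''| ≤ 2 √C`, reaching `ξ` takes a distance of at least `√c /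
  -- (2 √C)`.
  have hbound : |wJ' ξ - wJ' a| ≤ 2 * √C * |ξ - a| := by
    have := Convex.norm_image_sub_le_of_norm_hasDerivWithin_le (f := wJ') (C := 2 * √C)
      (s := Set.Ici a)
      (fun x hx => (hasDerivAt_wJ' (ha.trans_le hx)).hasDerivWithinAt) (fun x hx => ?_)
      (convex_Ici a) (Set.mem_Ici.2 le_rfl) (Set.mem_Ici.2 hξ.1.le)
    · simpa using this
    · have hx1 : 1 ≤ x := ha1.le.trans hx
      have h1 : |wJ x| ≤ √C := by
        refine Real.abs_le_sqrt ((?_ : _ ≤ energy x).trans (hE' x hx1))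
        unfold energy; nlinarith [sq_nonneg (wJ' x)]
      have h2 : 1 / (4 * x ^ 2) ≤ 1 := by
        rw [div_le_one (by positivity)]; nlinarith
      rw [norm_neg, norm_mul, Real.norm_eq_abs, Real.norm_eq_abs, abs_of_nonneg (by positivity)]
      refine mul_le_mul (by linarith) h1 (abs_nonneg _) (by norm_num)
  have hwa : √c ≤ |wJ' a| := by
    refine Real.sqrt_le_iff.2 ⟨abs_nonneg _, ?_⟩
    have := hE a ha1.le
    unfold energy at this
    rw [(wJ_eq_zero_iff ha).2 h0a] at this
    rw [sq_abs]; linarith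
  rw [hξ0, zero_sub, abs_neg, abs_of_pos (sub_pos.2 hξ.1)] at hbound
  have : √c / (2 * √C) ≤ ξ - a := by
    rw [div_le_iff₀ (by positivity)]; linarith
  linarith [hξ.2]

/-- Sturm comparison with `sin (x - b)`, a solution of `w'' + w = 0`, on an interval of length `π`.
-/
theorem exists_zero_gt (a : ℝ) (ha : 0 < a) : ∃ x, a < x ∧ J0 x = 0 := by
  by_contra! hne
  have hc : ContinuousOn wJ (Set.Icc (a + 1) (a + 1 + Real.pi)) := fun x hx =>
    (hasDerivAt_wJ (by linarith [hx.1])).continuousAt.continuousWithinAt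
  have hpi := Real.pi_pos
  have hw : ∀ x, a < x → wJ x ≠ 0 := fun x hx h =>
    hne x hx ((wJ_eq_zero_iff (ha.trans hx)).1 h)
  set b := a + 1 with hb
  -- The Wronskian of `w` and `sin (x - b)`, times `w b`. If `w` kept its sign, `W` would increase
  -- from `w(b)² > 0` to `-w(b) w(b + π) < 0`.
  let W : ℝ → ℝ := fun x => wJ b * (wJ x * Real.cos (x - b) - wJ' x * Real.sin (x - b))
  have hWd : ∀ x, 0 < x → HasDerivAt W (wJ b * (1 / (4 * x ^ 2) * wJ x * Real.sin (x - b))) x := by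
    intro x hx
    have hs := ((hasDerivAt_id x).sub_const b).sin
    have hcs := ((hasDerivAt_id x).sub_const b).cos
    have := ((((hasDerivAt_wJ hx).mul hcs).sub ((hasDerivAt_wJ' hx).mul hs))).const_mul (wJ b)
    refine this.congr_deriv ?_
    simp only [id]
    ring
  have hsame : ∀ x ∈ Set.Icc b (b + Real.pi), 0 < wJ b * wJ x := by
    intro x hx
    by_contra! hle
    have hcx : ContinuousOn (fun y => wJ b * wJ y) (Set.Icc b x) :=
      (hc.mono (Set.Icc_subset_Icc le_rfl hx.2)).const_mul _ 
    have := intermediate_value_Icc' hx.1 hcx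
    obtain ⟨y, hy, hy0⟩ := this (Set.mem_Icc.2 ⟨hle, mul_self_nonneg _⟩)
    rcases mul_eq_zero.1 hy0 with h | h
    · exact hw b (by linarith) h
    · exact hw y (by linarith [hy.1]) h
  have hmono : MonotoneOn W (Set.Icc b (b + Real.pi)) := by
    refine monotoneOn_of_deriv_nonneg (convex_Icc _ _)
      (fun x hx => (hWd x (by linarith [hx.1])).continuousAt.continuousWithinAt)
      (fun x hx => (hWd x (by linarith [(interior_subset hx).1])).differentiableAt
        |>.differentiableWithinAt) ?_
    intro x hx
    have hx' := interior_subset hx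
    have hx0 : 0 < x := by linarith [hx'.1]
    rw [(hWd x hx0).deriv]
    have h1 := hsame x hx'
    have h2 := Real.sin_nonneg_of_nonneg_of_le_pi (x := x - b) (by linarith [hx'.1])
      (by linarith [hx'.2])
    have : wJ b * (1 / (4 * x ^ 2) * wJ x * Real.sin (x - b)) =
      (wJ b * wJ x) * (1 / (4 * x ^ 2)) * Real.sin (x - b) := by ring
    rw [this]
    positivity
  have := hmono (Set.left_mem_Icc.2 (by linarith)) (Set.right_mem_Icc.2 (by linarith))
    (by linarith)
  simp [W] at this
  have h1 := hsame b (Set.left_mem_Icc.2 (by linarith))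
  have h2 := hsame (b + Real.pi) (Set.right_mem_Icc.2 (by linarith))
  linarith

/-! ### The zeros -/

theorem zero_sInf_spec {a : ℝ} (ha : 0 ≤ a) (h : a = 0 ∨ (0 < a ∧ J0 a = 0)) :
    a < sInf {x : ℝ | a < x ∧ J0 x = 0} ∧ J0 (sInf {x : ℝ | a < x ∧ J0 x = 0}) = 0 := by
  obtain ⟨d, hd, hsep⟩ := exists_zero_separation
  set S := {x : ℝ | a < x ∧ J0 x = 0} with hS
  -- The gap after `a` makes the set closed despite the strict inequality `a < x`, so that its
  -- infimum is attained and exceeds `a`. For `a = 0` the gap is `1`.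
  obtain ⟨d', hd', hS'⟩ : ∃ d' > 0, S = Set.Ici (a + d') ∩ J0 ⁻¹' {0} := by
    rcases h with rfl | ⟨ha, h0⟩
    · refine ⟨1, one_pos, ?_⟩
      ext x
      simp only [hS, Set.mem_ofPred_eq, Set.mem_inter_iff, Set.mem_Ici, Set.mem_preimage,
        Set.mem_singleton_iff]
      refine ⟨fun hx => ⟨by linarith [one_lt_of_zero hx.1 hx.2], hx.2⟩,
        fun hx => ⟨by linarith [hx.1], hx.2⟩⟩
    · refine ⟨d, hd, ?_⟩
      ext x
      simp only [hS, Set.mem_ofPred_eq, Set.mem_inter_iff, Set.mem_Ici, Set.mem_preimage,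
        Set.mem_singleton_iff]
      exact ⟨fun hx => ⟨hsep a x ha hx.1 h0 hx.2, hx.2⟩, fun hx => ⟨by linarith [hx.1], hx.2⟩⟩
  have hne : S.Nonempty := by
    obtain ⟨x, hx, hx0⟩ := exists_zero_gt (a + 1) (by linarith)
    exact ⟨x, by linarith, hx0⟩
  have hcl : IsClosed S := by
    rw [hS']
    exact isClosed_Ici.inter (isClosed_singleton.preimage continuous_J0)
  exact hcl.csInf_mem hne ⟨a, fun x hx => hx.1.le⟩

theorem z_spec (n : ℕ) : 0 < z n ∧ J0 (z n) = 0 := by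
  induction n with
  | zero => exact zero_sInf_spec le_rfl (Or.inl rfl)
  | succ n ih =>
    have := zero_sInf_spec ih.1.le (Or.inr ih)
    exact ⟨ih.1.trans this.1, this.2⟩

theorem z_pos (n : ℕ) : 0 < z n := (z_spec n).1

theorem J0_z (n : ℕ) : J0 (z n) = 0 := (z_spec n).2

theorem one_lt_z (n : ℕ) : 1 < z n := one_lt_of_zero (z_pos n) (J0_z n)

theorem z_lt_succ (n : ℕ) : z n < z (n + 1) := (zero_sInf_spec (z_pos n).le (Or.inr (z_spec n))).1

theorem z_strictMono : StrictMono z := strictMono_nat_of_lt_succ z_lt_succ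

theorem exists_le_z : ∃ c > 0, ∀ n : ℕ, c * (n + 1) ≤ z n := by
  obtain ⟨d, hd, hsep⟩ := exists_zero_separation
  refine ⟨min d 1, lt_min hd one_pos, fun n => ?_⟩
  induction n with
  | zero => simpa using Or.inr (one_lt_z 0).le
  | succ n ih =>
    have := hsep _ _ (z_pos n) (z_lt_succ n) (J0_z n) (J0_z (n + 1))
    have := min_le_left d 1
    push_cast
    linarith

theorem summable_z_rpow {p : ℝ} (hp : p < -1) : Summable fun n => z n ^ p := by
  obtain ⟨c, hc, h⟩ := exists_le_z
  have h1 : Summable fun n : ℕ => c ^ p * ((n + 1 : ℕ) : ℝ) ^ p :=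
    ((summable_nat_add_iff 1).2 (Real.summable_nat_rpow.2 hp)).mul_left _
  refine Summable.of_nonneg_of_le (fun n => Real.rpow_nonneg (z_pos n).le _) (fun n => ?_) h1
  rw [← Real.mul_rpow hc.le (by positivity)]
  exact Real.rpow_le_rpow_of_nonpos (by positivity) (by push_cast; exact h n) (by linarith)

/-- The number of zeros up to `Λ` is at most linear in `Λ`. -/
theorem exists_card_z_le : ∃ C > 0, ∀ (N : ℕ) (Λ : ℝ), 0 ≤ Λ →
    (((Finset.range N).filter fun n => z n ≤ Λ).card : ℝ) ≤ C * Λ := by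
  obtain ⟨c, hc, h⟩ := exists_le_z
  refine ⟨c⁻¹, inv_pos.2 hc, fun N Λ hΛ => ?_⟩
  have hsub : ((Finset.range N).filter fun n => z n ≤ Λ) ⊆ Finset.range ⌊c⁻¹ * Λ⌋₊ := by
    intro n hn
    rw [Finset.mem_filter] at hn
    rw [Finset.mem_range, ← Nat.succ_le_iff, Nat.le_floor_iff (by positivity)]
    rw [inv_mul_eq_div, le_div_iff₀ hc]
    push_cast
    linarith [h n]
  calc _ ≤ ((Finset.range ⌊c⁻¹ * Λ⌋₊).card : ℝ) := by exact_mod_cast Finset.card_le_card hsub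
    _ ≤ _ := by rw [Finset.card_range]; exact Nat.floor_le (by positivity)

/-- The tail `∑_{zₙ > Λ} zₙ⁻²` decays like `Λ⁻¹`. -/
theorem exists_sum_tail_le : ∃ C > 0, ∀ (N : ℕ) (Λ : ℝ), 0 < Λ →
    ∑ n ∈ (Finset.range N).filter (fun n => ¬ z n ≤ Λ), (z n ^ 2)⁻¹ ≤ C / Λ := by
  obtain ⟨d, hd, hsep⟩ := exists_zero_separation
  -- the telescoping bound starts at the first zero above `Λ`
  have key : ∀ (N : ℕ) (Λ : ℝ), 0 < Λ →
      ∑ n ∈ (Finset.range N).filter (fun n => ¬ z n ≤ Λ), (z n ^ 2)⁻¹ ≤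
        (Λ ^ 2)⁻¹ + d⁻¹ * (Λ⁻¹ - (max Λ (z (N - 1)))⁻¹) := by
    intro N Λ hΛ
    have hΛ2 : 0 < (Λ ^ 2)⁻¹ := by positivity
    induction N with
    | zero =>
      simp only [Finset.range_zero, Finset.filter_empty, Finset.sum_empty]
      have : (max Λ (z (0 - 1)))⁻¹ ≤ Λ⁻¹ := inv_anti₀ hΛ (le_max_left _ _)
      have : 0 ≤ d⁻¹ * (Λ⁻¹ - (max Λ (z (0 - 1)))⁻¹) :=
        mul_nonneg (inv_pos.2 hd).le (by linarith)
      linarith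
    | succ N ih =>
      rw [Finset.range_add_one, Finset.filter_insert]
      have hm : max Λ (z (N - 1)) ≤ max Λ (z (N + 1 - 1)) :=
        max_le_max le_rfl (z_strictMono.monotone (by omega))
      rcases lt_or_ge Λ (z N) with hz | hz
      · rw [if_pos (not_le.2 hz), Finset.sum_insert (by simp)]
        have hzN := z_pos N
        simp only [add_tsub_cancel_right] at hm ⊢
        rw [max_eq_right hz.le] at hm ⊢
        rcases Nat.eq_zero_or_pos N with rfl | hN
        · simp only [Finset.range_zero, Finset.filter_empty, Finset.sum_empty, add_zero]
          have h1 : (z 0 ^ 2)⁻¹ ≤ (Λ ^ 2)⁻¹ := inv_anti₀ (by positivity) (by gcongr)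
          have h2 : (z 0)⁻¹ ≤ Λ⁻¹ := inv_anti₀ hΛ hz.le
          have : 0 ≤ d⁻¹ * (Λ⁻¹ - (z 0)⁻¹) := mul_nonneg (inv_pos.2 hd).le (by linarith)
          linarith
        · obtain ⟨M, rfl⟩ : ∃ M, N = M + 1 := ⟨N - 1, by omega⟩
          simp only [add_tsub_cancel_right] at ih hm
          by_cases hM : z M ≤ Λ
          · have hempty : (Finset.range (M + 1)).filter (fun n => ¬ z n ≤ Λ) = ∅ := by
              rw [Finset.filter_eq_empty_iff]
              intro n hn
              rw [Finset.mem_range] at hn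
              push Not
              exact (z_strictMono.monotone (by omega : n ≤ M)).trans hM
            rw [hempty, Finset.sum_empty, add_zero]
            have h1 : (z (M + 1) ^ 2)⁻¹ ≤ (Λ ^ 2)⁻¹ := inv_anti₀ (by positivity) (by gcongr)
            have h2 : (z (M + 1))⁻¹ ≤ Λ⁻¹ := inv_anti₀ hΛ hz.le
            have : 0 ≤ d⁻¹ * (Λ⁻¹ - (z (M + 1))⁻¹) := mul_nonneg (inv_pos.2 hd).le (by linarith)
            linarith
          · push Not at hM
            rw [max_eq_right hM.le] at ih
            have hs := hsep _ _ (z_pos M) (z_lt_succ M) (J0_z M) (J0_z (M + 1))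
            have hzM := z_pos M
            -- With a gap of at least `d`, each inverse square is dominated by a telescoping
            -- difference of inverses.
            have : (z (M + 1) ^ 2)⁻¹ ≤ d⁻¹ * ((z M)⁻¹ - (z (M + 1))⁻¹) := by
              rw [inv_sub_inv hzM.ne' hzN.ne', ← div_eq_inv_mul, div_div, inv_eq_one_div,
                div_le_div_iff₀ (by positivity) (by positivity)]
              have h1 : z M * z (M + 1) ≤ z (M + 1) ^ 2 := by nlinarith
              have h2 := mul_le_mul h1 (by linarith : d ≤ z (M + 1) - z M) hd.le (by positivity)
              linarith
            linarith
      · rw [if_neg (not_not.2 hz)]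
        refine ih.trans ?_
        have : (max Λ (z (N + 1 - 1)))⁻¹ ≤ (max Λ (z (N - 1)))⁻¹ :=
          inv_anti₀ (lt_max_of_lt_left hΛ) hm
        have := mul_le_mul_of_nonneg_left
          (by linarith : Λ⁻¹ - (max Λ (z (N - 1)))⁻¹ ≤ Λ⁻¹ - (max Λ (z (N + 1 - 1)))⁻¹)
          (inv_pos.2 hd).le
        linarith
  -- For `Λ < 1` the term `Λ⁻²` of `key` is too large; the full sum `B` bounds the tail there and `B
  -- ≤ B / Λ`.
  obtain ⟨B, hB⟩ : ∃ B, ∑' n, z n ^ (-2 : ℝ) = B := ⟨_, rfl⟩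
  have hsum := summable_z_rpow (p := -2) (by norm_num)
  have hB0 : 0 ≤ B := hB ▸ tsum_nonneg fun n => Real.rpow_nonneg (z_pos n).le _
  refine ⟨1 + d⁻¹ + B, by positivity, fun N Λ hΛ => ?_⟩
  by_cases h1 : 1 ≤ Λ
  · refine (key N Λ hΛ).trans ?_
    have h2 : (Λ ^ 2)⁻¹ ≤ 1 / Λ := by
      rw [inv_eq_one_div]
      exact one_div_le_one_div_of_le hΛ (by nlinarith)
    have h3 : 0 ≤ d⁻¹ * (max Λ (z (N - 1)))⁻¹ := by
      have : 0 < max Λ (z (N - 1)) := lt_max_of_lt_left hΛ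
      positivity
    have h4 : 0 ≤ B / Λ := by positivity
    rw [mul_sub, add_div, add_div]
    have : d⁻¹ * Λ⁻¹ = d⁻¹ / Λ := rfl
    linarith
  · push Not at h1
    calc _ ≤ ∑ n ∈ (Finset.range N).filter (fun n => ¬ z n ≤ Λ), z n ^ (-2 : ℝ) := by
          refine Finset.sum_le_sum fun n _ => le_of_eq ?_
          rw [Real.rpow_neg (z_pos n).le]
          norm_cast
      _ ≤ B := hB ▸ hsum.sum_le_tsum _ fun n _ => Real.rpow_nonneg (z_pos n).le _
      _ ≤ B / Λ := by rw [le_div_iff₀ hΛ]; nlinarith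
      _ ≤ _ := by gcongr; linarith [inv_pos.2 hd]

/-! ### Integrals of Bessel functions over the disc -/

/-- Green's identity: both functions solve `(r f')' = -c² r f`, with `c = a` and `c = b`, and the
boundary terms vanish at `r = 0` and, by the zeros, at `r = 1`. -/
theorem integral_r_J0_mul (a b : ℝ) (hab : a ^ 2 ≠ b ^ 2) (ha : J0 a = 0) (hb : J0 b = 0) :
    ∫ r in (0 : ℝ)..1, r * (J0 (a * r) * J0 (b * r)) = 0 := by
  have hd : ∀ c r : ℝ, HasDerivAt (fun r => J0 (c * r)) (c * J0' (c * r)) r := fun c r => by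
    have := (hasDerivAt_J0 (c * r)).comp r ((hasDerivAt_id r).const_mul c)
    exact this.congr_deriv (by simp; ring)
  have hd' : ∀ c r : ℝ, HasDerivAt (fun r => r * (c * J0' (c * r))) (-(r * c ^ 2 * J0 (c * r))) r :=
    fun c r => by
    have := (hasDerivAt_id r).mul
      (((hasDerivAt_J0' (c * r)).comp r ((hasDerivAt_id r).const_mul c)).const_mul c)
    refine this.congr_deriv ?_
    have hB := bessel_equation (c * r)
    simp
    linear_combination c * hB
  have h : ∫ r in (0 : ℝ)..1, (b ^ 2 - a ^ 2) * (r * (J0 (a * r) * J0 (b * r))) = 0 := by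
    rw [intervalIntegral.integral_eq_sub_of_hasDerivAt
      (f := fun r => J0 (b * r) * (r * (a * J0' (a * r))) - J0 (a * r) * (r * (b * J0' (b * r))))]
    · simp [ha, hb]
    · intro r _
      refine (((hd b r).mul (hd' a r)).sub ((hd a r).mul (hd' b r))).congr_deriv ?_
      ring
    · have := continuous_J0
      exact (by fun_prop : Continuous _).intervalIntegrable _ _
  rw [intervalIntegral.integral_const_mul] at h
  rcases mul_eq_zero.1 h with h | h
  · exact absurd (by linarith) hab
  · exact h

/-- The Bessel equation makes `r² (J₀(ar)² + J₀'(ar)²) / 2` a primitive of the integrand. -/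
theorem integral_r_J0_sq {a : ℝ} (ha : J0 a = 0) :
    ∫ r in (0 : ℝ)..1, r * (J0 (a * r) * J0 (a * r)) = J0' a ^ 2 / 2 := by
  have hd : ∀ r : ℝ, HasDerivAt (fun r => J0 (a * r)) (a * J0' (a * r)) r := fun r => by
    have := (hasDerivAt_J0 (a * r)).comp r ((hasDerivAt_id r).const_mul a)
    exact this.congr_deriv (by simp; ring)
  have hd' : ∀ r : ℝ, HasDerivAt (fun r => J0' (a * r)) (a * J0'' (a * r)) r := fun r => by
    have := (hasDerivAt_J0' (a * r)).comp r ((hasDerivAt_id r).const_mul a)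
    exact this.congr_deriv (by simp; ring)
  rw [intervalIntegral.integral_eq_sub_of_hasDerivAt
      (f := fun r => r ^ 2 * (J0 (a * r) ^ 2 + J0' (a * r) ^ 2) / 2)]
  · simp [ha]
  · intro r _
    refine ((((hasDerivAt_id r).pow 2).mul (((hd r).pow 2).add ((hd' r).pow 2))).div_const 2
      ).congr_deriv ?_
    have hB := bessel_equation (a * r)
    simp
    linear_combination (r * J0' (a * r)) * hB
  · have := continuous_J0
    exact (by fun_prop : Continuous _).intervalIntegrable _ _

theorem exists_le_integral_r_J0_sq : ∃ c > 0, ∀ n,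
    c / z n ≤ ∫ r in (0 : ℝ)..1, r * (J0 (z n * r) * J0 (z n * r)) := by
  obtain ⟨c, hc, h⟩ := exists_energy_lower
  refine ⟨c / 2, by positivity, fun n => ?_⟩
  rw [integral_r_J0_sq (J0_z n)]
  -- At a zero the energy reduces to `zₙ J₀'(zₙ)²`.
  have h1 := h (z n) (one_lt_z n).le
  unfold energy wJ' wJ at h1
  rw [J0_z] at h1
  simp only [zero_div, add_zero, mul_zero, mul_pow, Real.sq_sqrt (z_pos n).le, ne_eq,
    OfNat.ofNat_ne_zero, not_false_eq_true, zero_pow] at h1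
  rw [div_le_iff₀ (z_pos n)]
  linarith

theorem integral_disc (f : ℝ → ℝ) :
    ∫ x, f ‖x‖ ∂vol = 2 * (volume : Measure (EuclideanSpace ℝ (Fin 2))).real (Metric.ball 0 1) *
      ∫ r in (0 : ℝ)..1, r * f r := by
  unfold vol disc
  have h : ∀ x : EuclideanSpace ℝ (Fin 2), (Metric.ball 0 1).indicator (fun x => f ‖x‖) x =
      (Set.Iio 1).indicator f ‖x‖ := fun x => by simp [Set.indicator]
  rw [← integral_indicator measurableSet_ball]
  simp only [h]
  rw [integral_fun_norm_addHaar volume ((Set.Iio 1).indicator f)]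
  simp only [finrank_euclideanSpace, Fintype.card_fin, nsmul_eq_mul, smul_eq_mul, mul_assoc]
  congr 2
  have h2 : ∀ y : ℝ, y ^ (2 - 1) * (Set.Iio 1).indicator f y =
      (Set.Iio 1).indicator (fun r => r * f r) y := fun y => by
    by_cases hy : y < 1 <;> simp [Set.indicator, hy]
  simp only [h2]
  rw [setIntegral_indicator measurableSet_Iio, intervalIntegral.integral_of_le zero_le_one,
    integral_Ioc_eq_integral_Ioo]
  rfl

/-- Negative powers of the radius above `-2` are integrable on the disc. -/
theorem integrable_norm_rpow {p : ℝ} (hp : -2 < p) :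
    Integrable (fun x : EuclideanSpace ℝ (Fin 2) => ‖x‖ ^ p) vol := by
  unfold vol disc
  have := (integrableOn_fun_norm_addHaar (E := EuclideanSpace ℝ (Fin 2)) volume
    (f := fun y : ℝ => y ^ p) (r := 1)).2
  refine this ?_
  have h : IntegrableOn (fun y : ℝ => y ^ (p + 1)) (Set.Ioo 0 1) :=
    (intervalIntegral.integrableOn_Ioo_rpow_iff one_pos).2 (by linarith)
  refine h.congr_fun (fun y hy => ?_) measurableSet_Ioo
  simp only [finrank_euclideanSpace, Fintype.card_fin, smul_eq_mul]
  rw [Real.rpow_add hy.1]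
  simp [mul_comm]

/-! ### The eigenfunctions -/

theorem besselFun_coe (n : ℕ) :
    besselFun n =ᵐ[vol] fun x => ((J0 (z n * ‖x‖) : ℝ) : ℂ) := MemLp.coeFn_toLp _

theorem inner_besselFun (m n : ℕ) : inner ℂ (besselFun m) (besselFun n) =
    ((2 * (volume : Measure (EuclideanSpace ℝ (Fin 2))).real (Metric.ball 0 1) *
      ∫ r in (0 : ℝ)..1, r * (J0 (z m * r) * J0 (z n * r)) : ℝ) : ℂ) := by
  rw [L2.inner_def, ← integral_disc (fun r => J0 (z m * r) * J0 (z n * r)), ← integral_complex_ofReal]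
  refine integral_congr_ae ?_
  filter_upwards [besselFun_coe m, besselFun_coe n] with x hm hn
  rw [hm, hn]
  simp [mul_comm]

theorem volume_real_unit_ball_pos :
    0 < (volume : Measure (EuclideanSpace ℝ (Fin 2))).real (Metric.ball 0 1) :=
  ENNReal.toReal_pos (Metric.measure_ball_pos volume _ one_pos).ne' measure_ball_lt_top.ne

theorem exists_le_norm_besselFun : ∃ c > 0, ∀ n, c / z n ≤ ‖besselFun n‖ ^ 2 := by
  obtain ⟨c, hc, h⟩ := exists_le_integral_r_J0_sq
  have hB := volume_real_unit_ball_pos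
  refine ⟨2 * volume.real (Metric.ball (0 : EuclideanSpace ℝ (Fin 2)) 1) * c, by positivity,
    fun n => ?_⟩
  have h1 : (‖besselFun n‖ ^ 2 : ℝ) = RCLike.re (inner ℂ (besselFun n) (besselFun n)) :=
    norm_sq_eq_re_inner _
  rw [h1, inner_besselFun]
  simp only [RCLike.re_to_complex, Complex.ofReal_re]
  rw [mul_div_assoc]
  exact mul_le_mul_of_nonneg_left (h n) (by positivity)

theorem norm_besselFun_pos (n : ℕ) : 0 < ‖besselFun n‖ := by
  obtain ⟨c, hc, h⟩ := exists_le_norm_besselFun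
  have := (div_pos hc (z_pos n)).trans_le (h n)
  by_contra! h0
  have : ‖besselFun n‖ = 0 := le_antisymm h0 (norm_nonneg _)
  simp [this] at *

theorem orthonormal_e : Orthonormal ℂ e := by
  refine ⟨fun n => ?_, fun m n hmn => ?_⟩
  · unfold e
    rw [norm_smul, Complex.norm_real, norm_inv, norm_norm]
    exact inv_mul_cancel₀ (norm_besselFun_pos n).ne'
  · change inner ℂ (e m) (e n) = 0
    unfold e
    rw [inner_smul_left, inner_smul_right, inner_besselFun, integral_r_J0_mul _ _ ?_ (J0_z m)
      (J0_z n)]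
    · simp
    · intro h
      exact hmn (z_strictMono.injective ((sq_eq_sq₀ (z_pos m).le (z_pos n).le).1 h))

/-- The pointwise representative of the eigenfunction `e n`. -/
def eFun (n : ℕ) (x : EuclideanSpace ℝ (Fin 2)) : ℝ := ‖besselFun n‖⁻¹ * J0 (z n * ‖x‖)

theorem continuous_eFun (n : ℕ) : Continuous (eFun n) := by
  have := continuous_J0
  unfold eFun
  fun_prop

theorem e_coe (n : ℕ) : e n =ᵐ[vol] fun x => (eFun n x : ℂ) := by
  filter_upwards [Lp.coeFn_smul ((‖besselFun n‖⁻¹ : ℝ) : ℂ) (besselFun n), besselFun_coe n]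
    with x h1 h2
  unfold e eFun
  rw [h1, Pi.smul_apply, h2]
  simp

/-- The normalisation costs a factor `zₙ`, and `J₀(y)²` is interpolated between the bounds `1` and
`C / y`. Taking `κ = 1` gives decay uniform in `n` at the price of the singularity `|x|⁻¹`; a
smaller `κ` weakens the singularity. -/
theorem exists_eFun_sq_le : ∃ C ≥ 1, ∀ n x, eFun n x ^ 2 ≤ C * z n ∧
    ∀ κ : ℝ, 0 ≤ κ → κ ≤ 1 → x ≠ 0 → eFun n x ^ 2 ≤ C * (z n ^ (1 - κ) * ‖x‖ ^ (-κ)) := by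
  obtain ⟨c, hc, h⟩ := exists_le_norm_besselFun
  obtain ⟨C, hC, hJ⟩ := exists_J0_sq_le
  have hJ1 : ∀ y, J0 y ^ 2 ≤ 1 := fun y => by
    rw [sq_le_one_iff_abs_le_one]; exact abs_J0_le y
  have hn : ∀ n, (‖besselFun n‖ ^ 2)⁻¹ ≤ c⁻¹ * z n := fun n => by
    have hz := z_pos n
    have := inv_anti₀ (div_pos hc hz) (h n)
    rwa [inv_div, div_eq_inv_mul] at this
  have hbase : ∀ n x, eFun n x ^ 2 ≤ c⁻¹ * z n * J0 (z n * ‖x‖) ^ 2 := fun n x => by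
    unfold eFun
    rw [mul_pow, inv_pow]
    exact mul_le_mul_of_nonneg_right (hn n) (sq_nonneg _)
  have hK : c⁻¹ * max 1 C ≤ max 1 (c⁻¹ * max 1 C) := le_max_right _ _
  refine ⟨max 1 (c⁻¹ * max 1 C), le_max_left _ _, fun n x => ⟨?_, fun κ h0 h1 hx => ?_⟩⟩
  · have hz := z_pos n
    refine (hbase n x).trans ?_
    calc c⁻¹ * z n * J0 (z n * ‖x‖) ^ 2 ≤ c⁻¹ * z n * max 1 C :=
          mul_le_mul_of_nonneg_left ((hJ1 _).trans (le_max_left _ _)) (by positivity)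
      _ = c⁻¹ * max 1 C * z n := by ring
      _ ≤ _ := mul_le_mul_of_nonneg_right hK hz.le
  · have hz := z_pos n
    have hr : 0 < ‖x‖ := norm_pos_iff.2 hx
    have ht : J0 (z n * ‖x‖) ^ 2 ≤ max 1 C * (z n * ‖x‖) ^ (-κ) := by
      calc J0 (z n * ‖x‖) ^ 2 ≤ (J0 (z n * ‖x‖) ^ 2) ^ κ := by
            have := Real.rpow_le_rpow_of_exponent_ge' (sq_nonneg _) (hJ1 (z n * ‖x‖)) h0 h1
            rwa [Real.rpow_one] at this
        _ ≤ (C * (z n * ‖x‖)⁻¹) ^ κ := by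
            refine Real.rpow_le_rpow (sq_nonneg _) ?_ h0
            rw [← div_eq_mul_inv, le_div_iff₀ (by positivity), mul_comm]
            exact hJ _ (by positivity)
        _ = C ^ κ * (z n * ‖x‖) ^ (-κ) := by
            rw [Real.mul_rpow hC.le (by positivity), Real.rpow_neg (by positivity),
              Real.inv_rpow (by positivity)]
        _ ≤ _ := by
            refine mul_le_mul_of_nonneg_right ?_ (by positivity)
            calc C ^ κ ≤ (max 1 C) ^ κ := Real.rpow_le_rpow hC.le (le_max_right _ _) h0
              _ ≤ (max 1 C) ^ (1 : ℝ) := Real.rpow_le_rpow_of_exponent_le (le_max_left _ _) h1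
              _ = _ := Real.rpow_one _
    refine (hbase n x).trans ?_
    calc c⁻¹ * z n * J0 (z n * ‖x‖) ^ 2 ≤ c⁻¹ * z n * (max 1 C * (z n * ‖x‖) ^ (-κ)) :=
          mul_le_mul_of_nonneg_left ht (by positivity)
      _ = c⁻¹ * max 1 C * (z n ^ (1 - κ) * ‖x‖ ^ (-κ)) := by
          rw [Real.mul_rpow hz.le hr.le, sub_eq_add_neg, Real.rpow_add hz, Real.rpow_one]
          ring
      _ ≤ _ := mul_le_mul_of_nonneg_right hK (by positivity)

/-! ### Finite expansions -/

/-- The finite sum `∑_{n ∈ S} aₙ eₙ` as a function on the plane. -/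
def expansion (S : Finset ℕ) (a : ℕ → ℂ) (x : EuclideanSpace ℝ (Fin 2)) : ℂ :=
  ∑ n ∈ S, a n * (eFun n x : ℂ)

theorem continuous_expansion (S : Finset ℕ) (a : ℕ → ℂ) : Continuous (expansion S a) := by
  unfold expansion
  exact continuous_finsetSum _ fun n _ =>
    continuous_const.mul (Complex.continuous_ofReal.comp (continuous_eFun n))

theorem sum_smul_e_coe (S : Finset ℕ) (a : ℕ → ℂ) :
    (∑ n ∈ S, a n • e n : L2) =ᵐ[vol] expansion S a := by
  classical
  induction S using Finset.induction_on with
  | empty =>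
    simp only [Finset.sum_empty]
    filter_upwards [Lp.coeFn_zero ℂ 2 vol] with x hx
    rw [hx]; simp [expansion]
  | insert n S hn ih =>
    rw [Finset.sum_insert hn]
    filter_upwards [Lp.coeFn_add (a n • e n) (∑ n ∈ S, a n • e n), Lp.coeFn_smul (a n) (e n),
      e_coe n, ih] with x h1 h2 h3 h4
    rw [h1, Pi.add_apply, h2, Pi.smul_apply, h3, h4]
    simp [expansion, Finset.sum_insert hn]

theorem norm_sq_sum_smul_e (S : Finset ℕ) (a : ℕ → ℂ) :
    ‖(∑ n ∈ S, a n • e n : L2)‖ ^ 2 = ∑ n ∈ S, ‖a n‖ ^ 2 := by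
  have h : (‖(∑ n ∈ S, a n • e n : L2)‖ ^ 2 : ℝ) = RCLike.re (inner ℂ
    (∑ n ∈ S, a n • e n : L2) (∑ n ∈ S, a n • e n : L2)) := norm_sq_eq_re_inner _
  rw [h, orthonormal_e.inner_sum]
  simp [← Complex.normSq_eq_conj_mul_self, Complex.normSq_eq_norm_sq]
  norm_cast

theorem lintegral_enorm_sq (u : L2) : ∫⁻ x, ‖u x‖ₑ ^ (2 : ℝ) ∂vol = ‖u‖ₑ ^ (2 : ℝ) := by
  rw [Lp.enorm_def, eLpNorm_eq_lintegral_rpow_enorm_toReal (by simp) (by simp)]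
  simp only [ENNReal.toReal_ofNat]
  rw [← ENNReal.rpow_mul]
  norm_num

theorem lintegral_expansion_sq (S : Finset ℕ) (a : ℕ → ℂ) :
    ∫⁻ x, ‖expansion S a x‖ₑ ^ (2 : ℝ) ∂vol = ENNReal.ofReal (∑ n ∈ S, ‖a n‖ ^ 2) := by
  rw [← norm_sq_sum_smul_e, ENNReal.ofReal_pow (norm_nonneg _), ofReal_norm,
    ← ENNReal.rpow_natCast, Nat.cast_ofNat, ← lintegral_enorm_sq]
  refine lintegral_congr_ae ?_
  filter_upwards [sum_smul_e_coe S a] with x hx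
  rw [hx]

/-! ### Gaussian moments -/

instance : IsProbabilityMeasure gaussianSeq := by
  unfold gaussianSeq; infer_instance

theorem mgf_re_complexGaussian (t : ℝ) :
    mgf Complex.re complexGaussian t = Real.exp (t ^ 2 / 4) := by
  unfold complexGaussian
  rw [mgf_map (by fun_prop) (by fun_prop)]
  have h : (((gaussianReal 0 1).prod (gaussianReal 0 1)).map Prod.fst) = gaussianReal 0 1 :=
    Measure.fst_prod
  have h2 := mgf_gaussianReal h (t / √2)
  rw [div_pow, Real.sq_sqrt zero_le_two] at h2
  unfold mgf at h2 ⊢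
  refine Eq.trans ?_ (h2.trans ?_)
  · congr 1
    ext p
    simp
    ring
  · simp
    ring

theorem mgf_im_complexGaussian (t : ℝ) :
    mgf Complex.im complexGaussian t = Real.exp (t ^ 2 / 4) := by
  unfold complexGaussian
  rw [mgf_map (by fun_prop) (by fun_prop)]
  have h : (((gaussianReal 0 1).prod (gaussianReal 0 1)).map Prod.snd) = gaussianReal 0 1 :=
    Measure.snd_prod
  have h2 := mgf_gaussianReal h (t / √2)
  rw [div_pow, Real.sq_sqrt zero_le_two] at h2
  unfold mgf at h2 ⊢
  refine Eq.trans ?_ (h2.trans ?_)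
  · congr 1
    ext p
    simp
    ring
  · simp
    ring

theorem mgf_sum_gaussianSeq {L : ℂ → ℝ} (hL : Measurable L)
    (hm : ∀ t, mgf L complexGaussian t = Real.exp (t ^ 2 / 4)) (S : Finset ℕ) (c : ℕ → ℝ) (t : ℝ) :
    mgf (∑ n ∈ S, fun g : ℕ → ℂ => c n * L (g n)) gaussianSeq t =
      Real.exp (t ^ 2 * (∑ n ∈ S, c n ^ 2) / 4) := by
  have hind : iIndepFun (fun (n : ℕ) (g : ℕ → ℂ) => c n * L (g n)) gaussianSeq :=
    iIndepFun_infinitePi (P := fun _ : ℕ => complexGaussian) (X := fun n w => c n * L w)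
      (fun n => by fun_prop)
  rw [hind.mgf_sum (fun n => by fun_prop), Finset.mul_sum, Finset.sum_div, Real.exp_sum]
  refine Finset.prod_congr rfl fun n _ => ?_
  have h1 : mgf (fun g : ℕ → ℂ => c n * L (g n)) gaussianSeq t =
      mgf L complexGaussian (c n * t) := by
    have := Measure.infinitePi_map_eval (fun _ : ℕ => complexGaussian) n
    rw [← this, mgf_map (Y := fun g : ℕ → ℂ => g n) (X := L) (measurable_pi_apply n).aemeasurable
      (by fun_prop)]
    unfold mgf
    congr 1
    ext g
    simp
    ring
  rw [h1, hm]
  congr 1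
  ring

theorem lintegral_exp_gaussian_aux {L : ℂ → ℝ} (hL : Measurable L)
    (hm : ∀ t, mgf L complexGaussian t = Real.exp (t ^ 2 / 4)) (S : Finset ℕ) (c : ℕ → ℝ) (t : ℝ) :
    ∫⁻ g, ENNReal.ofReal (Real.exp (t * ∑ n ∈ S, c n * L (g n))) ∂gaussianSeq =
      ENNReal.ofReal (Real.exp (t ^ 2 * (∑ n ∈ S, c n ^ 2) / 4)) := by
  have h := mgf_sum_gaussianSeq hL hm S c t
  unfold mgf at h
  simp only [Finset.sum_apply] at h
  rw [← h, ofReal_integral_eq_lintegral_ofReal _ (Eventually.of_forall fun g => (Real.exp_pos _).le)]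
  refine Integrable.of_integral_ne_zero ?_
  rw [h]
  exact (Real.exp_pos _).ne'

/-- The real-linear combinations `∑ cₙ gₙ` of the Gaussian variables. -/
theorem lintegral_exp_norm_gaussian (S : Finset ℕ) (c : ℕ → ℝ) {t : ℝ} (ht : 0 ≤ t) :
    ∫⁻ g, ENNReal.ofReal (Real.exp (t * ‖∑ n ∈ S, (c n : ℂ) * g n‖)) ∂gaussianSeq ≤
      ENNReal.ofReal (2 * Real.exp (t ^ 2 * ∑ n ∈ S, c n ^ 2)) := by
  let A : (ℂ → ℝ) → ℝ → (ℕ → ℂ) → ℝ≥0∞ := fun L t g =>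
    ENNReal.ofReal (Real.exp (t * ∑ n ∈ S, c n * L (g n)))
  have hA : ∀ L, Measurable L → ∀ t, Measurable (A L t) := fun L hL t => by
    simp only [A]; fun_prop
  have hpt : ∀ g : ℕ → ℂ, ENNReal.ofReal (Real.exp (t * ‖∑ n ∈ S, (c n : ℂ) * g n‖)) ≤
      2⁻¹ * ((A Complex.re (2 * t) g + A Complex.re (-(2 * t)) g) +
        (A Complex.im (2 * t) g + A Complex.im (-(2 * t)) g)) := by
    intro g
    have hre : (∑ n ∈ S, (c n : ℂ) * g n).re = ∑ n ∈ S, c n * (g n).re := by simp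
    have him : (∑ n ∈ S, (c n : ℂ) * g n).im = ∑ n ∈ S, c n * (g n).im := by simp
    simp only [A]
    rw [← ENNReal.ofReal_add (Real.exp_pos _).le (Real.exp_pos _).le,
      ← ENNReal.ofReal_add (Real.exp_pos _).le (Real.exp_pos _).le,
      ← ENNReal.ofReal_add (by positivity) (by positivity), ← hre, ← him]
    have h2 : (2⁻¹ : ℝ≥0∞) = ENNReal.ofReal 2⁻¹ := by
      rw [ENNReal.ofReal_inv_of_pos two_pos]; simp
    rw [h2, ← ENNReal.ofReal_mul (by norm_num)]
    refine ENNReal.ofReal_le_ofReal ?_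
    generalize (∑ n ∈ S, (c n : ℂ) * g n) = w
    have habs : ∀ y : ℝ, Real.exp (2 * t * |y|) ≤ Real.exp (2 * t * y) + Real.exp (-(2 * t) * y) := by
      intro y
      rcases abs_cases y with ⟨h, _⟩ | ⟨h, _⟩ <;> rw [h]
      · linarith [Real.exp_pos (-(2 * t) * y)]
      · have : 2 * t * -y = -(2 * t) * y := by ring
        rw [this]; linarith [Real.exp_pos (2 * t * y)]
    -- The product of the exponentials of the two parts is at most half the sum of their squares,
    -- which doubles `t`. As each part has variance `1/2`, the moment generating function at `2t`
    -- gives `exp (t² ∑ cₙ²)`.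
    have h1 : Real.exp (t * ‖w‖) ≤ Real.exp (t * |w.re|) * Real.exp (t * |w.im|) := by
      rw [← Real.exp_add, ← mul_add]
      exact Real.exp_le_exp.2 (mul_le_mul_of_nonneg_left (Complex.norm_le_abs_re_add_abs_im w) ht)
    have hsq : ∀ y : ℝ, Real.exp (t * |y|) ^ 2 = Real.exp (2 * t * |y|) := fun y => by
      rw [← Real.exp_nat_mul]; congr 1; push_cast; ring
    have := habs w.re
    have := habs w.im
    have := hsq w.re
    have := hsq w.im
    nlinarith [sq_nonneg (Real.exp (t * |w.re|) - Real.exp (t * |w.im|))]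
  refine (lintegral_mono hpt).trans (le_of_eq ?_)
  have hre := hA _ Complex.measurable_re
  have him := hA _ Complex.measurable_im
  have hre2 : Measurable fun g => A Complex.re (2 * t) g + A Complex.re (-(2 * t)) g :=
    (hre _).add (hre _)
  rw [lintegral_const_mul' _ _ (by simp), lintegral_add_left hre2, lintegral_add_left (hre _),
    lintegral_add_left (him _)]
  simp only [A]
  rw [lintegral_exp_gaussian_aux Complex.measurable_re mgf_re_complexGaussian,
    lintegral_exp_gaussian_aux Complex.measurable_re mgf_re_complexGaussian,
    lintegral_exp_gaussian_aux Complex.measurable_im mgf_im_complexGaussian,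
    lintegral_exp_gaussian_aux Complex.measurable_im mgf_im_complexGaussian]
  have e1 : (2 * t) ^ 2 * (∑ n ∈ S, c n ^ 2) / 4 = t ^ 2 * ∑ n ∈ S, c n ^ 2 := by ring
  have e2 : (-(2 * t)) ^ 2 * (∑ n ∈ S, c n ^ 2) / 4 = t ^ 2 * ∑ n ∈ S, c n ^ 2 := by ring
  rw [e1, e2, ← two_mul, ← two_mul, ← mul_assoc, ENNReal.inv_mul_cancel two_ne_zero (by simp),
    one_mul, ENNReal.ofReal_mul zero_le_two]
  simp

/-- From `y ≤ exp y` one gets `|w|^q ≤ (q/t)^q exp (t |w|)`, and `t = √(q/v)` balances the two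
factors. The growth `(q v)^{q/2}` in `q` is what the exponential integrability rests on. -/
theorem lintegral_norm_rpow_gaussian (S : Finset ℕ) (c : ℕ → ℝ) {q v : ℝ} (hq : 0 < q)
    (hv : 0 < v) (hcv : ∑ n ∈ S, c n ^ 2 ≤ v) :
    ∫⁻ g, ‖∑ n ∈ S, (c n : ℂ) * g n‖ₑ ^ q ∂gaussianSeq ≤
      ENNReal.ofReal (2 * Real.exp q * (q * v) ^ (q / 2)) := by
  set t := √(q / v) with ht
  have ht0 : 0 < t := Real.sqrt_pos.2 (by positivity)
  have ht2 : t ^ 2 = q / v := Real.sq_sqrt (by positivity)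
  have hqt : (q / t) ^ q = (q * v) ^ (q / 2) := by
    have : q / t = √(q * v) := by
      rw [eq_comm, Real.sqrt_eq_iff_mul_self_eq (by positivity) (by positivity)]
      have : q / t * (q / t) = q ^ 2 / t ^ 2 := by ring
      rw [this, ht2]; field_simp
    rw [this, Real.sqrt_eq_rpow, ← Real.rpow_mul (by positivity)]
    congr 1; ring
  have hpt : ∀ w : ℂ, ‖w‖ₑ ^ q ≤ ENNReal.ofReal ((q / t) ^ q) * ENNReal.ofReal (Real.exp (t * ‖w‖)) := by
    intro w
    rw [← ofReal_norm, ENNReal.ofReal_rpow_of_nonneg (norm_nonneg _) hq.le,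
      ← ENNReal.ofReal_mul (by positivity)]
    refine ENNReal.ofReal_le_ofReal ?_
    have h1 : t * ‖w‖ / q ≤ Real.exp (t * ‖w‖ / q) := by
      linarith [Real.add_one_le_exp (t * ‖w‖ / q)]
    have h2 := Real.rpow_le_rpow (by positivity) h1 hq.le
    rw [← Real.exp_mul, div_mul_cancel₀ _ hq.ne'] at h2
    calc ‖w‖ ^ q = (q / t * (t * ‖w‖ / q)) ^ q := by congr 1; field_simp
      _ = (q / t) ^ q * (t * ‖w‖ / q) ^ q := Real.mul_rpow (by positivity) (by positivity)
      _ ≤ _ := mul_le_mul_of_nonneg_left h2 (by positivity)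
  refine (lintegral_mono fun g => hpt _).trans ?_
  rw [lintegral_const_mul' _ _ ENNReal.ofReal_ne_top]
  refine (mul_le_mul_right (lintegral_exp_norm_gaussian S c ht0.le) _).trans ?_
  rw [← ENNReal.ofReal_mul (by positivity)]
  refine ENNReal.ofReal_le_ofReal ?_
  rw [hqt]
  have : Real.exp (t ^ 2 * ∑ n ∈ S, c n ^ 2) ≤ Real.exp q := by
    refine Real.exp_le_exp.2 ?_
    rw [ht2, div_mul_eq_mul_div, div_le_iff₀ hv]
    exact mul_le_mul_of_nonneg_left hcv hq.le
  have h0 : 0 ≤ (q * v) ^ (q / 2) := by positivity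
  nlinarith

/-- The coefficients `gₙ / zₙ` of the random series. -/
def coeff (g : ℕ → ℂ) (n : ℕ) : ℂ := g n / (z n : ℂ)

theorem expansion_coeff (S : Finset ℕ) (g : ℕ → ℂ) (x : EuclideanSpace ℝ (Fin 2)) :
    expansion S (coeff g) x = ∑ n ∈ S, ((eFun n x / z n : ℝ) : ℂ) * g n := by
  unfold expansion coeff
  refine Finset.sum_congr rfl fun n _ => ?_
  push_cast
  ring

theorem measurable_expansion_coeff (S : Finset ℕ) :
    Measurable fun p : (ℕ → ℂ) × EuclideanSpace ℝ (Fin 2) => expansion S (coeff p.1) p.2 := by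
  have h : ∀ n, Measurable (eFun n) := fun n => (continuous_eFun n).measurable
  unfold expansion coeff
  fun_prop

/-- Moments of the random series at a point, in terms of a bound `v` of its variance. -/
theorem lintegral_expansion_rpow_le (S : Finset ℕ) (x : EuclideanSpace ℝ (Fin 2)) {q v : ℝ}
    (hq : 0 < q) (hv : 0 < v) (h : ∑ n ∈ S, eFun n x ^ 2 / z n ^ 2 ≤ v) :
    ∫⁻ g, ‖expansion S (coeff g) x‖ₑ ^ q ∂gaussianSeq ≤
      ENNReal.ofReal (2 * Real.exp q * (q * v) ^ (q / 2)) := by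
  simp only [expansion_coeff]
  refine lintegral_norm_rpow_gaussian S _ hq hv ?_
  simpa only [div_pow] using h

/-! ### Moment bounds for the random series -/

theorem ae_ne_zero : ∀ᵐ x ∂vol, x ≠ 0 := by
  unfold vol
  exact Measure.ae_ne _ 0

theorem lintegral_norm_rpow_lt_top {p : ℝ} (hp : -2 < p) :
    ∫⁻ x : EuclideanSpace ℝ (Fin 2), ENNReal.ofReal (‖x‖ ^ p) ∂vol < ⊤ :=
  (integrable_norm_rpow hp).lintegral_lt_top

/-- The choice `κ = 1/q` leaves the convergent sum `∑ zₙ^{-1-1/q}` in the variance, while its power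
`q/2` has only the integrable singularity `|x|^{-1/2}`. -/
theorem exists_lintegral_expansion_rpow_le {q : ℝ} (hq : 1 ≤ q) : ∃ B : ℝ≥0∞, B ≠ ⊤ ∧ ∀ N,
    ∫⁻ g, ∫⁻ x, ‖expansion (Finset.range N) (coeff g) x‖ₑ ^ q ∂vol ∂gaussianSeq ≤ B := by
  obtain ⟨C, hC, hE⟩ := exists_eFun_sq_le
  have hq0 : 0 < q := by linarith
  have hκ1 : q⁻¹ ≤ 1 := inv_le_one_of_one_le₀ hq
  have hκ0 : 0 < q⁻¹ := inv_pos.2 hq0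
  have hsum := summable_z_rpow (p := -1 - q⁻¹) (by linarith)
  set A := ∑' n, z n ^ (-1 - q⁻¹) with hA
  have hA0 : 0 ≤ A := tsum_nonneg fun n => Real.rpow_nonneg (z_pos n).le _
  have hvar : ∀ N (x : EuclideanSpace ℝ (Fin 2)), x ≠ 0 →
      ∑ n ∈ Finset.range N, eFun n x ^ 2 / z n ^ 2 ≤ C * (A + 1) * ‖x‖ ^ (-q⁻¹) := by
    intro N x hx
    calc ∑ n ∈ Finset.range N, eFun n x ^ 2 / z n ^ 2 ≤
          ∑ n ∈ Finset.range N, C * ‖x‖ ^ (-q⁻¹) * z n ^ (-1 - q⁻¹) := by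
          refine Finset.sum_le_sum fun n _ => ?_
          have hz := z_pos n
          rw [div_le_iff₀ (by positivity)]
          refine ((hE n x).2 q⁻¹ hκ0.le hκ1 hx).trans (le_of_eq ?_)
          have : z n ^ (1 - q⁻¹) = z n ^ (-1 - q⁻¹) * z n ^ 2 := by
            rw [← Real.rpow_natCast (z n) 2, ← Real.rpow_add hz]
            congr 1; push_cast; ring
          rw [this]; ring
      _ = C * ‖x‖ ^ (-q⁻¹) * ∑ n ∈ Finset.range N, z n ^ (-1 - q⁻¹) := by rw [Finset.mul_sum]
      _ ≤ C * ‖x‖ ^ (-q⁻¹) * (A + 1) := by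
          refine mul_le_mul_of_nonneg_left ?_ (by positivity)
          have := hsum.sum_le_tsum (Finset.range N) fun n _ => Real.rpow_nonneg (z_pos n).le _
          linarith
      _ = _ := by ring
  set D := 2 * Real.exp q * (q * (C * (A + 1))) ^ (q / 2) with hD
  have hD0 : 0 ≤ D := by positivity
  refine ⟨ENNReal.ofReal D * ∫⁻ x : EuclideanSpace ℝ (Fin 2), ENNReal.ofReal (‖x‖ ^ (-(1/2) : ℝ)) ∂vol,
    ENNReal.mul_ne_top ENNReal.ofReal_ne_top (lintegral_norm_rpow_lt_top (by norm_num)).ne,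
    fun N => ?_⟩
  rw [lintegral_lintegral_swap
    ((measurable_expansion_coeff _).enorm.pow_const _).aemeasurable,
    ← lintegral_const_mul' _ _ ENNReal.ofReal_ne_top]
  refine lintegral_mono_ae ?_
  filter_upwards [ae_ne_zero] with x hx
  have hr : 0 < ‖x‖ := norm_pos_iff.2 hx
  refine (lintegral_expansion_rpow_le _ x hq0 (by positivity) (hvar N x hx)).trans (le_of_eq ?_)
  rw [← ENNReal.ofReal_mul hD0, hD, ← mul_assoc q, Real.mul_rpow (by positivity) (by positivity),
    ← Real.rpow_mul hr.le, mul_assoc (2 * Real.exp q)]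
  congr 5
  field_simp

/-- Jensen's inequality for the measure with density `W`, in the form of Hölder's inequality with
exponents `m` and `m/(m-1)`. -/
theorem lintegral_mul_pow_le {α : Type*} [MeasurableSpace α] (ν : Measure α) {h W : α → ℝ≥0∞}
    (hh : AEMeasurable h ν) (hW : AEMeasurable W ν) {m : ℕ} (hm : 1 ≤ m) :
    (∫⁻ x, h x * W x ∂ν) ^ m ≤ (∫⁻ x, W x ∂ν) ^ (m - 1) * ∫⁻ x, h x ^ m * W x ∂ν := by
  have hm0 : (0 : ℝ) < m := by exact_mod_cast hm
  have hm1 : (1 : ℝ) ≤ m := by exact_mod_cast hm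
  have hinv : (m : ℝ)⁻¹ ≤ 1 := inv_le_one_of_one_le₀ hm1
  have hq : 0 ≤ 1 - (m : ℝ)⁻¹ := by linarith
  have key := ENNReal.lintegral_mul_norm_pow_le (μ := ν) (f := fun x => h x ^ m * W x) (g := W)
    ((hh.pow_const m).mul hW) hW (inv_nonneg.2 hm0.le) hq (by ring)
  have hpt : ∀ x, (h x ^ m * W x) ^ (m : ℝ)⁻¹ * W x ^ (1 - (m : ℝ)⁻¹) = h x * W x := by
    intro x
    rw [ENNReal.mul_rpow_of_nonneg _ _ (inv_nonneg.2 hm0.le), ← ENNReal.rpow_natCast,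
      ← ENNReal.rpow_mul, mul_inv_cancel₀ hm0.ne', ENNReal.rpow_one, mul_assoc,
      ← ENNReal.rpow_add_of_nonneg _ _ (inv_nonneg.2 hm0.le) hq]
    simp
  simp only [hpt] at key
  refine (pow_le_pow_left' key m).trans (le_of_eq ?_)
  rw [mul_pow, ← ENNReal.rpow_natCast, ← ENNReal.rpow_mul, inv_mul_cancel₀ hm0.ne',
    ENNReal.rpow_one, mul_comm, ← ENNReal.rpow_natCast, ← ENNReal.rpow_mul, sub_mul, one_mul,
    inv_mul_cancel₀ hm0.ne', ← ENNReal.rpow_natCast]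
  congr 2
  rw [Nat.cast_sub hm, Nat.cast_one]

/-- The part of the random series of frequencies above `√m`. -/
theorem exists_high_moment_le {b : ℝ} (hb2 : 2 ≤ b) (hb4 : b < 4) : ∃ K : ℝ≥0∞, K ≠ ⊤ ∧
    ∀ N m : ℕ, 1 ≤ m → ∫⁻ g, (∫⁻ x, ‖expansion ((Finset.range N).filter (fun n => ¬ z n ≤ √m))
      (coeff g) x‖ₑ ^ b ∂vol) ^ m ∂gaussianSeq ≤ (K * (m : ℝ≥0∞) ^ (b / 4)) ^ m := by
  obtain ⟨C, hC, hE⟩ := exists_eFun_sq_le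
  obtain ⟨C', hC', hT⟩ := exists_sum_tail_le
  have hb0 : 0 < b := by linarith
  set M := ∫⁻ x : EuclideanSpace ℝ (Fin 2), ENNReal.ofReal (‖x‖ ^ (-(b / 2))) ∂vol with hM
  have hMtop : M ≠ ⊤ := (lintegral_norm_rpow_lt_top (by linarith)).ne
  set c := Real.exp b * (b * (C * C')) ^ (b / 2) with hc
  have hc0 : 0 ≤ c := by positivity
  refine ⟨M * ENNReal.ofReal (2 * c), ENNReal.mul_ne_top hMtop ENNReal.ofReal_ne_top,
    fun N m hm => ?_⟩
  have hm0 : (0 : ℝ) < m := by exact_mod_cast hm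
  have hΛ : 0 < √(m : ℝ) := Real.sqrt_pos.2 hm0
  set S := (Finset.range N).filter (fun n => ¬ z n ≤ √m) with hS
  have hvar : ∀ x : EuclideanSpace ℝ (Fin 2), x ≠ 0 →
      ∑ n ∈ S, eFun n x ^ 2 / z n ^ 2 ≤ C * C' * (√m)⁻¹ * ‖x‖⁻¹ := by
    intro x hx
    calc ∑ n ∈ S, eFun n x ^ 2 / z n ^ 2 ≤ ∑ n ∈ S, C * ‖x‖⁻¹ * (z n ^ 2)⁻¹ := by
          refine Finset.sum_le_sum fun n _ => ?_
          have hz := z_pos n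
          rw [div_eq_mul_inv]
          refine mul_le_mul_of_nonneg_right ?_ (by positivity)
          have := (hE n x).2 1 zero_le_one le_rfl hx
          simpa [Real.rpow_neg_one] using this
      _ = C * ‖x‖⁻¹ * ∑ n ∈ S, (z n ^ 2)⁻¹ := by rw [Finset.mul_sum]
      _ ≤ C * ‖x‖⁻¹ * (C' / √m) := mul_le_mul_of_nonneg_left (hT N _ hΛ) (by positivity)
      _ = _ := by rw [div_eq_mul_inv]; ring
  have hmom : ∀ x : EuclideanSpace ℝ (Fin 2), x ≠ 0 →
      ∫⁻ g, ‖expansion S (coeff g) x‖ₑ ^ (b * m) ∂gaussianSeq ≤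
        ENNReal.ofReal (2 * (c * (m : ℝ) ^ (b / 4)) ^ m * ‖x‖ ^ (-(b / 2) * m)) := by
    intro x hx
    have hr : 0 < ‖x‖ := norm_pos_iff.2 hx
    refine (lintegral_expansion_rpow_le S x (by positivity) (by positivity) (hvar x hx)).trans
      (le_of_eq ?_)
    congr 1
    -- The moment order `b m` times the variance factor `1/√m` is of size `√m`; raised to the power
    -- `b m / 2` it gives `(m^{b/4})^m`.
    have e1 : b * m * (C * C' * (√m)⁻¹ * ‖x‖⁻¹) = (b * (C * C')) * √m * ‖x‖⁻¹ := by
      have : (m : ℝ) = √m * √m := (Real.mul_self_sqrt hm0.le).symm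
      calc _ = b * (C * C') * (m * (√m)⁻¹) * ‖x‖⁻¹ := by ring
        _ = _ := by
          congr 2
          nth_rewrite 1 [this]
          field_simp
    rw [e1, Real.mul_rpow (by positivity) (by positivity),
      Real.mul_rpow (by positivity) (by positivity), Real.sqrt_eq_rpow, ← Real.rpow_mul hm0.le,
      Real.inv_rpow hr.le, ← Real.rpow_neg hr.le, hc, mul_pow, mul_pow, ← Real.exp_nat_mul,
      ← Real.rpow_mul_natCast (by positivity), ← Real.rpow_mul_natCast hm0.le]
    have e2 : b * (m : ℝ) / 2 = b / 2 * m := by ring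
    have e3 : 1 / 2 * (b / 2 * (m : ℝ)) = b / 4 * m := by ring
    have e4 : -(b / 2 * (m : ℝ)) = -(b / 2) * m := by ring
    have e5 : b * (m : ℝ) = m * b := by ring
    rw [e2, e3, e4, e5]
    ring
  have hmeas := measurable_expansion_coeff S
  -- The weight `|x|^{-b/2}` is chosen so that the factor `|x|^{bm/2}` produced by the `m`-th power
  -- cancels the singularity of the moment of order `bm`. What remains is the weight itself, of mass
  -- `M` independent of `m`.
  have hhold : ∀ g : ℕ → ℂ, (∫⁻ x, ‖expansion S (coeff g) x‖ₑ ^ b ∂vol) ^ m ≤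
      M ^ (m - 1) * ∫⁻ x, ‖expansion S (coeff g) x‖ₑ ^ (b * m) *
        ENNReal.ofReal (‖x‖ ^ (b / 2 * m - b / 2)) ∂vol := by
    intro g
    have hcont := continuous_expansion S (coeff g)
    have h1 := lintegral_mul_pow_le vol
      (h := fun x => ‖expansion S (coeff g) x‖ₑ ^ b * ENNReal.ofReal (‖x‖ ^ (b / 2)))
      (W := fun x => ENNReal.ofReal (‖x‖ ^ (-(b / 2))))
      (((hcont.measurable.enorm.pow_const _).mul (by fun_prop)).aemeasurable) (by fun_prop) hm
    have e1 : ∫⁻ x, ‖expansion S (coeff g) x‖ₑ ^ b ∂vol =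
        ∫⁻ x, ‖expansion S (coeff g) x‖ₑ ^ b * ENNReal.ofReal (‖x‖ ^ (b / 2)) *
          ENNReal.ofReal (‖x‖ ^ (-(b / 2))) ∂vol := by
      refine lintegral_congr_ae ?_
      filter_upwards [ae_ne_zero] with x hx
      have hr : 0 < ‖x‖ := norm_pos_iff.2 hx
      rw [mul_assoc, ← ENNReal.ofReal_mul (by positivity), ← Real.rpow_add hr]
      simp
    have e2 : ∫⁻ x, ‖expansion S (coeff g) x‖ₑ ^ (b * m) *
        ENNReal.ofReal (‖x‖ ^ (b / 2 * m - b / 2)) ∂vol =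
        ∫⁻ x, (‖expansion S (coeff g) x‖ₑ ^ b * ENNReal.ofReal (‖x‖ ^ (b / 2))) ^ m *
          ENNReal.ofReal (‖x‖ ^ (-(b / 2))) ∂vol := by
      refine lintegral_congr_ae ?_
      filter_upwards [ae_ne_zero] with x hx
      have hr : 0 < ‖x‖ := norm_pos_iff.2 hx
      rw [mul_pow, mul_assoc, ← ENNReal.ofReal_pow (by positivity),
        ← ENNReal.ofReal_mul (by positivity), ← Real.rpow_mul_natCast hr.le, ← Real.rpow_add hr,
        ENNReal.rpow_mul, ENNReal.rpow_natCast]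
      rfl
    rw [e1, e2]
    exact h1
  refine (lintegral_mono hhold).trans ?_
  rw [lintegral_const_mul' _ _ (ENNReal.pow_ne_top hMtop), lintegral_lintegral_swap
    ((hmeas.enorm.pow_const _).mul (by fun_prop)).aemeasurable]
  have hin : ∫⁻ x, ∫⁻ g, ‖expansion S (coeff g) x‖ₑ ^ (b * m) *
      ENNReal.ofReal (‖x‖ ^ (b / 2 * m - b / 2)) ∂gaussianSeq ∂vol ≤
      ENNReal.ofReal (2 * (c * (m : ℝ) ^ (b / 4)) ^ m) * M := by
    rw [hM, ← lintegral_const_mul' _ _ ENNReal.ofReal_ne_top]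
    refine lintegral_mono_ae ?_
    filter_upwards [ae_ne_zero] with x hx
    have hr : 0 < ‖x‖ := norm_pos_iff.2 hx
    rw [lintegral_mul_const' _ _ ENNReal.ofReal_ne_top]
    refine (mul_le_mul_left (hmom x hx) _).trans (le_of_eq ?_)
    rw [← ENNReal.ofReal_mul (by positivity), ← ENNReal.ofReal_mul (by positivity), mul_assoc,
      ← Real.rpow_add hr]
    congr 3
    ring
  refine (mul_le_mul_right hin _).trans ?_
  have e1 : M ^ (m - 1) * (ENNReal.ofReal (2 * (c * (m : ℝ) ^ (b / 4)) ^ m) * M) =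
      M ^ m * ENNReal.ofReal (2 * (c * (m : ℝ) ^ (b / 4)) ^ m) := by
    obtain ⟨k, rfl⟩ : ∃ k, m = k + 1 := ⟨m - 1, by omega⟩
    simp only [add_tsub_cancel_right, pow_succ]
    ring
  have e2 : (m : ℝ≥0∞) ^ (b / 4) = ENNReal.ofReal ((m : ℝ) ^ (b / 4)) := by
    rw [← ENNReal.ofReal_natCast, ENNReal.ofReal_rpow_of_pos hm0]
  have e3 : (M * ENNReal.ofReal (2 * c) * ENNReal.ofReal ((m : ℝ) ^ (b / 4))) ^ m =
      M ^ m * ENNReal.ofReal ((2 * (c * (m : ℝ) ^ (b / 4))) ^ m) := by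
    rw [mul_assoc, mul_pow, ← ENNReal.ofReal_mul (by positivity), mul_assoc,
      ENNReal.ofReal_pow (by positivity)]
  rw [e1, e2, e3]
  refine mul_le_mul_right (ENNReal.ofReal_le_ofReal ?_) _
  rw [mul_pow 2]
  refine mul_le_mul_of_nonneg_right ?_ (by positivity)
  exact le_self_pow₀ one_le_two (by omega)

/-- The partial sum `φ_N` of the random series in `L²`. -/
def partialSum (N : ℕ) (g : ℕ → ℂ) : L2 := ∑ n ∈ Finset.range N, coeff g n • e n

theorem partialSum_coe (N : ℕ) (g : ℕ → ℂ) :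
    partialSum N g =ᵐ[vol] expansion (Finset.range N) (coeff g) := sum_smul_e_coe _ _

theorem norm_sq_partialSum (N : ℕ) (g : ℕ → ℂ) :
    ‖partialSum N g‖ ^ 2 = ∑ n ∈ Finset.range N, ‖coeff g n‖ ^ 2 := norm_sq_sum_smul_e _ _

theorem measurable_coeff (n : ℕ) : Measurable fun g => coeff g n := by
  unfold coeff; fun_prop

theorem continuous_partialSum (N : ℕ) : Continuous (partialSum N) := by
  unfold partialSum coeff
  fun_prop

theorem measurableSet_norm_partialSum_lt (N : ℕ) (R : ℝ) :
    MeasurableSet {g | ‖partialSum N g‖ < R} :=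
  (isOpen_lt (continuous_partialSum N).norm continuous_const).measurableSet

/-- The part of the series of frequencies up to `√m` is controlled by the `L²` norm. -/
theorem exists_low_le {b : ℝ} (hb2 : 2 ≤ b) (hb4 : b < 4) (R : ℝ) : ∃ K : ℝ≥0∞, K ≠ ⊤ ∧
    ∀ (N m : ℕ) (a : ℕ → ℂ), 1 ≤ m → ∑ n ∈ Finset.range N, ‖a n‖ ^ 2 ≤ R ^ 2 →
      ∫⁻ x, ‖expansion ((Finset.range N).filter (fun n => z n ≤ √m)) a x‖ₑ ^ b ∂vol ≤
        K * (m : ℝ≥0∞) ^ (b / 4) := by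
  obtain ⟨C, hC, hE⟩ := exists_eFun_sq_le
  obtain ⟨C', hC', hT⟩ := exists_card_z_le
  set A := √(R ^ 2 * (C * C')) with hA
  refine ⟨ENNReal.ofReal (A ^ (b - 2) * R ^ 2), ENNReal.ofReal_ne_top, fun N m a hm ha => ?_⟩
  have hm1 : (1 : ℝ) ≤ m := by exact_mod_cast hm
  have hm0 : (0 : ℝ) < m := by linarith
  set S := (Finset.range N).filter (fun n => z n ≤ √m) with hS
  have haS : ∑ n ∈ S, ‖a n‖ ^ 2 ≤ R ^ 2 :=
    (Finset.sum_le_sum_of_subset_of_nonneg (Finset.filter_subset _ _)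
      fun n _ _ => sq_nonneg _).trans ha
  -- Cauchy–Schwarz: at most `C' √m` zeros lie below `√m`, and each contributes `eₙ² ≤ C √m`.
  have hsup : ∀ x, ‖expansion S a x‖ ≤ A * √m := by
    intro x
    have h1 : ‖expansion S a x‖ ≤ ∑ n ∈ S, ‖a n‖ * |eFun n x| := by
      refine (norm_sum_le _ _).trans (le_of_eq (Finset.sum_congr rfl fun n _ => ?_))
      rw [norm_mul, Complex.norm_real, Real.norm_eq_abs]
    have h2 : ∑ n ∈ S, |eFun n x| ^ 2 ≤ C * C' * m := by
      calc ∑ n ∈ S, |eFun n x| ^ 2 ≤ ∑ n ∈ S, C * √m := by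
            refine Finset.sum_le_sum fun n hn => ?_
            rw [sq_abs]
            refine (hE n x).1.trans ?_
            rw [hS, Finset.mem_filter] at hn
            exact mul_le_mul_of_nonneg_left hn.2 (by linarith)
        _ = S.card * (C * √m) := by rw [Finset.sum_const, nsmul_eq_mul]
        _ ≤ (C' * √m) * (C * √m) :=
            mul_le_mul_of_nonneg_right (hT N _ (Real.sqrt_nonneg _)) (by positivity)
        _ = C * C' * (√m * √m) := by ring
        _ = _ := by rw [Real.mul_self_sqrt hm0.le]
    rw [hA, ← Real.sqrt_mul (by positivity)]
    refine h1.trans (Real.le_sqrt_of_sq_le ?_)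
    refine (Finset.sum_mul_sq_le_sq_mul_sq S _ _).trans ?_
    rw [mul_assoc]
    exact mul_le_mul haS h2 (Finset.sum_nonneg fun n _ => sq_nonneg _) (sq_nonneg _)
  have hpt : ∀ x, ‖expansion S a x‖ₑ ^ b ≤
      ENNReal.ofReal ((A * √m) ^ (b - 2)) * ‖expansion S a x‖ₑ ^ (2 : ℝ) := by
    intro x
    have : b = (b - 2) + 2 := by ring
    nth_rewrite 1 [this]
    rw [ENNReal.rpow_add_of_nonneg _ _ (by linarith) zero_le_two]
    refine mul_le_mul_left ?_ _
    rw [← ofReal_norm, ENNReal.ofReal_rpow_of_nonneg (norm_nonneg _) (by linarith)]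
    exact ENNReal.ofReal_le_ofReal (Real.rpow_le_rpow (norm_nonneg _) (hsup x) (by linarith))
  refine (lintegral_mono hpt).trans ?_
  rw [lintegral_const_mul' _ _ ENNReal.ofReal_ne_top, lintegral_expansion_sq,
    ← ENNReal.ofReal_natCast, ENNReal.ofReal_rpow_of_pos hm0, ← ENNReal.ofReal_mul (by positivity),
    ← ENNReal.ofReal_mul (by positivity)]
  refine ENNReal.ofReal_le_ofReal ?_
  rw [Real.mul_rpow (by positivity) (by positivity)]
  -- The exponents compare as `(b - 2)/2 ≤ b/4`, which is `b ≤ 4`.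
  have h3 : √(m : ℝ) ^ (b - 2) ≤ (m : ℝ) ^ (b / 4) := by
    rw [Real.sqrt_eq_rpow, ← Real.rpow_mul hm0.le]
    exact Real.rpow_le_rpow_of_exponent_le hm1 (by linarith)
  calc A ^ (b - 2) * √m ^ (b - 2) * ∑ n ∈ S, ‖a n‖ ^ 2
      ≤ A ^ (b - 2) * (m : ℝ) ^ (b / 4) * R ^ 2 :=
        mul_le_mul (mul_le_mul_of_nonneg_left h3 (by positivity)) haS
          (Finset.sum_nonneg fun n _ => sq_nonneg _) (by positivity)
    _ = _ := by ring

theorem expansion_filter_add (S : Finset ℕ) (p : ℕ → Prop) [DecidablePred p] (a : ℕ → ℂ)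
    (x : EuclideanSpace ℝ (Fin 2)) :
    expansion (S.filter p) a x + expansion (S.filter (fun n => ¬ p n)) a x = expansion S a x :=
  Finset.sum_filter_add_sum_filter_not _ _ _

/-- Moments of `∫ |φ_N|^b` on balls of `L²`. -/
theorem exists_moment_le {b : ℝ} (hb2 : 2 ≤ b) (hb4 : b < 4) (R : ℝ) : ∃ K : ℝ≥0∞, K ≠ ⊤ ∧
    ∀ N m : ℕ, 1 ≤ m → ∫⁻ g in {g | ‖partialSum N g‖ < R},
      (∫⁻ x, ‖partialSum N g x‖ₑ ^ b ∂vol) ^ m ∂gaussianSeq ≤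
        (K * (m : ℝ≥0∞) ^ (b / 4)) ^ m := by
  obtain ⟨K₁, hK₁, h1⟩ := exists_low_le hb2 hb4 R
  obtain ⟨K₂, hK₂, h2⟩ := exists_high_moment_le hb2 hb4
  have hb1 : 1 ≤ b := by linarith
  have h2b : (2 : ℝ≥0∞) ^ (b - 1) ≠ ⊤ := ENNReal.rpow_ne_top_of_nonneg (by linarith) (by simp)
  refine ⟨2 ^ (b - 1) * (2 * (K₁ + K₂)), ENNReal.mul_ne_top h2b
    (ENNReal.mul_ne_top (by simp) (ENNReal.add_ne_top.2 ⟨hK₁, hK₂⟩)), fun N m hm => ?_⟩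
  have hmR : (1 : ℝ) ≤ m := by exact_mod_cast hm
  set p : ℕ → Prop := fun n => z n ≤ √m with hp
  set H : (ℕ → ℂ) → ℝ≥0∞ := fun g =>
    ∫⁻ x, ‖expansion ((Finset.range N).filter (fun n => ¬ z n ≤ √m)) (coeff g) x‖ₑ ^ b ∂vol with hH
  set T : ℝ≥0∞ := (m : ℝ≥0∞) ^ (b / 4) with hT
  have hHm : Measurable H :=
    ((measurable_expansion_coeff _).enorm.pow_const b).lintegral_prod_right'
  have hpt : ∀ g ∈ {g | ‖partialSum N g‖ < R}, (∫⁻ x, ‖partialSum N g x‖ₑ ^ b ∂vol) ^ m ≤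
      (2 ^ (b - 1)) ^ m * (2 ^ (m - 1) * ((K₁ * T) ^ m + H g ^ m)) := by
    intro g hg
    have hg2 : ∑ n ∈ Finset.range N, ‖coeff g n‖ ^ 2 ≤ R ^ 2 := by
      rw [← norm_sq_partialSum]
      exact pow_le_pow_left₀ (norm_nonneg _) (le_of_lt hg) 2
    have e1 : ∫⁻ x, ‖partialSum N g x‖ₑ ^ b ∂vol =
        ∫⁻ x, ‖expansion (Finset.range N) (coeff g) x‖ₑ ^ b ∂vol := by
      refine lintegral_congr_ae ?_
      filter_upwards [partialSum_coe N g] with x hx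
      rw [hx]
    have e2 : ∫⁻ x, ‖expansion (Finset.range N) (coeff g) x‖ₑ ^ b ∂vol ≤
        2 ^ (b - 1) * (K₁ * T + H g) := by
      calc ∫⁻ x, ‖expansion (Finset.range N) (coeff g) x‖ₑ ^ b ∂vol
          ≤ ∫⁻ x, 2 ^ (b - 1) * (‖expansion ((Finset.range N).filter fun n => z n ≤ √m)
              (coeff g) x‖ₑ ^ b + ‖expansion ((Finset.range N).filter fun n => ¬ z n ≤ √m)
              (coeff g) x‖ₑ ^ b) ∂vol := by
            refine lintegral_mono fun x => ?_
            rw [← expansion_filter_add (Finset.range N) (fun n => z n ≤ √m)]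
            exact (ENNReal.rpow_le_rpow (enorm_add_le _ _) (by linarith)).trans
              (ENNReal.rpow_add_le_mul_rpow_add_rpow _ _ hb1)
        _ ≤ _ := by
            rw [lintegral_const_mul' _ _ h2b, lintegral_add_left
              ((continuous_expansion _ _).measurable.enorm.pow_const b)]
            exact mul_le_mul_right (add_le_add (h1 N m _ hm hg2) le_rfl) _
    have e3 : (K₁ * T + H g) ^ m ≤ 2 ^ (m - 1) * ((K₁ * T) ^ m + H g ^ m) := by
      have := ENNReal.rpow_add_le_mul_rpow_add_rpow (K₁ * T) (H g) hmR
      simp only [ENNReal.rpow_natCast] at this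
      have h' : (m : ℝ) - 1 = ((m - 1 : ℕ) : ℝ) := by rw [Nat.cast_sub hm]; simp
      rwa [h', ENNReal.rpow_natCast] at this
    rw [e1]
    refine (pow_le_pow_left' e2 m).trans ?_
    rw [mul_pow]
    exact mul_le_mul_right e3 _
  refine (setLIntegral_mono' (measurableSet_norm_partialSum_lt N R) hpt).trans ?_
  refine (setLIntegral_le_lintegral _ _).trans ?_
  rw [lintegral_const_mul' _ _ (ENNReal.pow_ne_top h2b),
    lintegral_const_mul' _ _ (ENNReal.pow_ne_top (by simp)),
    lintegral_add_left measurable_const, lintegral_const, measure_univ, mul_one]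
  have hsum : (K₁ * T) ^ m + (K₂ * T) ^ m ≤ 2 * ((K₁ + K₂) * T) ^ m := by
    rw [two_mul]
    refine add_le_add (pow_le_pow_left' ?_ m) (pow_le_pow_left' ?_ m)
    · exact mul_le_mul_left le_self_add _
    · exact mul_le_mul_left le_add_self _
  calc (2 ^ (b - 1)) ^ m * (2 ^ (m - 1) * ((K₁ * T) ^ m + ∫⁻ g, H g ^ m ∂gaussianSeq))
      ≤ (2 ^ (b - 1)) ^ m * (2 ^ (m - 1) * (2 * ((K₁ + K₂) * T) ^ m)) := by
        refine mul_le_mul_right (mul_le_mul_right ?_ _) _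
        exact (add_le_add le_rfl (h2 N m hm)).trans hsum
    _ = (2 ^ (b - 1) * (2 * (K₁ + K₂)) * T) ^ m := by
        obtain ⟨k, rfl⟩ : ∃ k, m = k + 1 := ⟨m - 1, by omega⟩
        simp only [add_tsub_cancel_right, mul_pow]
        ring

/-- The resulting exponential series converges. -/
theorem tsum_exp_moment_lt_top {b : ℝ} (hb4 : b < 4) {K : ℝ≥0∞} (hK : K ≠ ⊤) :
    ∑' m : ℕ, ((m.factorial : ℝ≥0∞)⁻¹ * (K * (m : ℝ≥0∞) ^ (b / 4)) ^ m) ≠ ⊤ := by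
  lift K to NNReal using hK
  have hterm : ∀ m : ℕ, ((m.factorial : ℝ≥0∞)⁻¹ * ((K : ℝ≥0∞) * (m : ℝ≥0∞) ^ (b / 4)) ^ m) =
      ENNReal.ofReal ((m.factorial : ℝ)⁻¹ * ((K : ℝ) * (m : ℝ) ^ (b / 4)) ^ m) := by
    intro m
    rcases Nat.eq_zero_or_pos m with rfl | hm
    · simp
    · have hm0 : (0 : ℝ) < m := by exact_mod_cast hm
      rw [ENNReal.ofReal_mul (by positivity), ENNReal.ofReal_pow (by positivity),
        ENNReal.ofReal_mul (by positivity), ENNReal.ofReal_coe_nnreal,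
        ← ENNReal.ofReal_rpow_of_pos hm0, ENNReal.ofReal_natCast,
        ENNReal.ofReal_inv_of_pos (by positivity), ENNReal.ofReal_natCast]
  simp only [hterm]
  refine Summable.tsum_ofReal_ne_top ?_
  -- the base of the `m`-th power tends to zero
  have hlim : Tendsto (fun m : ℕ => Real.exp 1 * K * (m : ℝ) ^ (-(1 - b / 4))) atTop (𝓝 0) := by
    have := ((tendsto_rpow_neg_atTop (y := 1 - b / 4) (by linarith)).comp
      tendsto_natCast_atTop_atTop).const_mul (Real.exp 1 * K)
    simpa using this
  have hev : ∀ᶠ m : ℕ in atTop, Real.exp 1 * K * (m : ℝ) ^ (-(1 - b / 4)) ≤ 1 / 2 :=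
    hlim.eventually_le_const (by norm_num)
  refine Summable.of_norm_bounded_eventually_nat
    (g := fun m : ℕ => ((1 : ℝ) / 2) ^ m) summable_geometric_two ?_
  filter_upwards [hev, eventually_ge_atTop 1] with m hm hm1
  have hm0 : (0 : ℝ) < m := by exact_mod_cast hm1
  rw [Real.norm_of_nonneg (by positivity)]
  -- The `m`-th term of the series of `exp m` is at most `exp m`, so `m! ≥ (m/e)^m`.
  have hfac : ((m : ℝ) / Real.exp 1) ^ m ≤ m.factorial := by
    have := Real.pow_div_factorial_le_exp (m : ℝ) hm0.le m
    rw [div_le_iff₀ (by positivity)] at this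
    rw [div_pow, ← Real.exp_nat_mul, mul_one, div_le_iff₀ (Real.exp_pos _)]
    linarith
  calc (m.factorial : ℝ)⁻¹ * ((K : ℝ) * (m : ℝ) ^ (b / 4)) ^ m
      ≤ (((m : ℝ) / Real.exp 1) ^ m)⁻¹ * ((K : ℝ) * (m : ℝ) ^ (b / 4)) ^ m := by
        refine mul_le_mul_of_nonneg_right (inv_anti₀ (by positivity) hfac) (by positivity)
    _ = (Real.exp 1 * K * (m : ℝ) ^ (-(1 - b / 4))) ^ m := by
        rw [← inv_pow, ← mul_pow]
        congr 1
        rw [neg_sub, Real.rpow_sub hm0, Real.rpow_one]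
        field_simp
    _ ≤ _ := pow_le_pow_left₀ (by positivity) hm m

/-! ### Integral functionals on `L²` -/

/-- `L²` carries its Borel sigma algebra. -/
instance : MeasurableSpace L2 := borel L2

instance : BorelSpace L2 := ⟨rfl⟩

theorem exists_subseq_tendsto_ae {u : ℕ → L2} {v : L2} (h : Tendsto u atTop (𝓝 v)) :
    ∃ ns : ℕ → ℕ, StrictMono ns ∧ ∀ᵐ x ∂vol, Tendsto (fun k => u (ns k) x) atTop (𝓝 (v x)) :=
  (tendstoInMeasure_of_tendsto_Lp h).exists_seq_tendsto_ae

/-- Fatou's lemma along an almost everywhere convergent subsequence; sequential closedness of the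
sublevel sets suffices in a metric space. -/
theorem lowerSemicontinuous_lintegral_comp {h : ℂ → ℝ≥0∞} (hh : Continuous h) :
    LowerSemicontinuous fun u : L2 => ∫⁻ x, h (u x) ∂vol := by
  rw [lowerSemicontinuous_iff_isClosed_preimage]
  intro y
  refine IsSeqClosed.isClosed fun u v hu hv => ?_
  obtain ⟨ns, -, hns⟩ := exists_subseq_tendsto_ae hv
  have h1 : ∫⁻ x, h (v x) ∂vol ≤ ∫⁻ x, liminf (fun k => h (u (ns k) x)) atTop ∂vol := by
    refine lintegral_mono_ae ?_
    filter_upwards [hns] with x hx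
    exact (((hh.tendsto _).comp hx).liminf_eq).ge
  refine h1.trans ((lintegral_liminf_le' fun k => ?_).trans ?_)
  · exact hh.measurable.comp_aemeasurable (Lp.aestronglyMeasurable _).aemeasurable
  · exact liminf_le_of_le (by isBoundedDefault) fun b hb => by
      obtain ⟨k, hk⟩ := hb.exists
      exact hk.trans (hu (ns k))

/-- Every subsequence has a further one converging almost everywhere, to which dominated convergence
applies. -/
theorem continuous_integral_comp_of_bounded {f : ℂ → ℝ} (hf : Continuous f) {L : ℝ}
    (hL : ∀ w, |f w| ≤ L) : Continuous fun u : L2 => ∫ x, f (u x) ∂vol := by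
  rw [continuous_iff_seqContinuous]
  intro u v hu
  refine tendsto_of_subseq_tendsto fun ns hns => ?_
  obtain ⟨ms, -, hms⟩ := exists_subseq_tendsto_ae (hu.comp hns)
  refine ⟨ms, tendsto_integral_of_dominated_convergence (fun _ => L) (fun k => ?_)
    (integrable_const _) (fun k => Eventually.of_forall fun x => hL _) ?_⟩
  · exact hf.comp_aestronglyMeasurable (Lp.aestronglyMeasurable _)
  · filter_upwards [hms] with x hx
    exact (hf.tendsto _).comp hx

/-- The functional `u ↦ ∫ |u|^b`. -/
def moment (b : ℝ) (u : L2) : ℝ≥0∞ := ∫⁻ x, ‖u x‖ₑ ^ b ∂vol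

theorem lowerSemicontinuous_moment {b : ℝ} : LowerSemicontinuous (moment b) :=
  lowerSemicontinuous_lintegral_comp
    (h := fun w => ‖w‖ₑ ^ b) (ENNReal.continuous_rpow_const.comp continuous_enorm)

/-- The ball has to be open here: the indicator of an open set is lower semicontinuous. -/
theorem lowerSemicontinuous_indicator_moment_pow {b R : ℝ} (m : ℕ) :
    LowerSemicontinuous ({u : L2 | ‖u‖ < R}.indicator fun u => moment b u ^ m) := by
  have h : LowerSemicontinuous fun u : L2 => moment b u ^ m :=
    (ENNReal.continuous_pow m).comp_lowerSemicontinuous lowerSemicontinuous_moment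
      fun a b hab => pow_le_pow_left' hab m
  rw [lowerSemicontinuous_iff_isOpen_preimage] at h ⊢
  intro y
  have : ({u : L2 | ‖u‖ < R}.indicator fun u => moment b u ^ m) ⁻¹' Set.Ioi y =
      {u : L2 | ‖u‖ < R} ∩ (fun u : L2 => moment b u ^ m) ⁻¹' Set.Ioi y := by
    ext u
    by_cases hu : ‖u‖ < R <;> simp [Set.indicator, hu]
  rw [this]
  exact (isOpen_lt continuous_norm continuous_const).inter (h y)

/-- Fatou's lemma. It carries bounds uniform in `N` for the partial sums over to the full random
series. -/
theorem lintegral_le_of_tendsto {Ω : Type*} [MeasurableSpace Ω] {P : Measure Ω} {F : L2 → ℝ≥0∞}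
    (hF : LowerSemicontinuous F) {ψ : ℕ → Ω → L2} {ψ' : Ω → L2} (hψ : ∀ N, Measurable (ψ N))
    (hlim : ∀ᵐ g ∂P, Tendsto (fun N => ψ N g) atTop (𝓝 (ψ' g))) {c : ℝ≥0∞}
    (hc : ∀ N, ∫⁻ g, F (ψ N g) ∂P ≤ c) : ∫⁻ g, F (ψ' g) ∂P ≤ c := by
  have h1 : ∫⁻ g, F (ψ' g) ∂P ≤ ∫⁻ g, liminf (fun N => F (ψ N g)) atTop ∂P := by
    refine lintegral_mono_ae ?_
    filter_upwards [hlim] with g hg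
    exact (hF.le_liminf (ψ' g)).trans (liminf_le_liminf_of_le hg)
  refine h1.trans ((lintegral_liminf_le fun N => hF.measurable.comp (hψ N)).trans ?_)
  exact liminf_le_of_le (by isBoundedDefault) fun b hb => by
    obtain ⟨k, hk⟩ := hb.exists
    exact hk.trans (hc k)

/-! ### The exponential series -/

/-- The exponential series in `[0, ∞]`. -/
def expSeries (y : ℝ≥0∞) : ℝ≥0∞ := ∑' m : ℕ, (m.factorial : ℝ≥0∞)⁻¹ * y ^ m

theorem ofReal_exp_eq_expSeries {t : ℝ} (ht : 0 ≤ t) :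
    ENNReal.ofReal (Real.exp t) = expSeries (ENNReal.ofReal t) := by
  unfold expSeries
  have h := NormedSpace.expSeries_div_hasSum_exp (𝔸 := ℝ) t
  rw [← Real.exp_eq_exp_ℝ] at h
  rw [← h.tsum_eq, ENNReal.ofReal_tsum_of_nonneg (fun m => by positivity) h.summable]
  refine tsum_congr fun m => ?_
  rw [div_eq_inv_mul, ENNReal.ofReal_mul (by positivity), ENNReal.ofReal_pow ht,
    ENNReal.ofReal_inv_of_pos (by positivity), ENNReal.ofReal_natCast]

/-- The value `y = ∞` is allowed; there the linear term already makes the series infinite. -/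
theorem ofReal_exp_le {t a : ℝ} {y : ℝ≥0∞} (h : ENNReal.ofReal t ≤ ENNReal.ofReal a + y) :
    ENNReal.ofReal (Real.exp t) ≤ ENNReal.ofReal (Real.exp |a|) * expSeries y := by
  by_cases hy : y = ⊤
  · have : expSeries y = ⊤ := by
      refine top_le_iff.1 (le_trans ?_ (ENNReal.le_tsum 1))
      simp [hy]
    rw [this, ENNReal.mul_top]
    · exact le_top
    · simpa using Real.exp_pos _
  · lift y to NNReal using hy
    rw [← ENNReal.ofReal_coe_nnreal (p := y), ← ofReal_exp_eq_expSeries y.coe_nonneg,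
      ← ENNReal.ofReal_mul (Real.exp_pos _).le, ← Real.exp_add]
    refine ENNReal.ofReal_le_ofReal (Real.exp_le_exp.2 ?_)
    have h2 : ENNReal.ofReal t ≤ ENNReal.ofReal (|a| + y) := by
      rw [ENNReal.ofReal_add (abs_nonneg _) y.coe_nonneg, ENNReal.ofReal_coe_nnreal]
      exact h.trans (add_le_add (ENNReal.ofReal_le_ofReal (le_abs_self a)) le_rfl)
    exact (ENNReal.ofReal_le_ofReal_iff (by positivity)).1 h2

/-- All terms are nonnegative, so the expectation passes inside the series. The term `m = 0`,
outside the hypothesis, is at most `1` under a probability measure. -/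
theorem lintegral_expSeries_le {Ω : Type*} [MeasurableSpace Ω] {P : Measure Ω}
    [IsProbabilityMeasure P] {ψ : Ω → L2} (hψ : AEMeasurable ψ P) {b R : ℝ} {K : ℝ≥0∞}
    (h : ∀ m : ℕ, 1 ≤ m → ∫⁻ g, {u : L2 | ‖u‖ < R}.indicator (fun u => moment b u ^ m) (ψ g) ∂P ≤
      (K * (m : ℝ≥0∞) ^ (b / 4)) ^ m) (A : ℝ≥0∞) :
    ∫⁻ g, {u : L2 | ‖u‖ < R}.indicator (fun u => expSeries (A * moment b u)) (ψ g) ∂P ≤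
      ∑' m : ℕ, ((m.factorial : ℝ≥0∞)⁻¹ * (A * K * (m : ℝ≥0∞) ^ (b / 4)) ^ m) := by
  have hpt : ∀ u : L2, {u : L2 | ‖u‖ < R}.indicator (fun u => expSeries (A * moment b u)) u =
      ∑' m : ℕ, (m.factorial : ℝ≥0∞)⁻¹ * A ^ m *
        {u : L2 | ‖u‖ < R}.indicator (fun u => moment b u ^ m) u := by
    intro u
    by_cases hu : ‖u‖ < R
    · simp [Set.indicator, hu, expSeries, mul_pow, mul_assoc]
    · simp [Set.indicator, hu]
  simp only [hpt]
  have hmeas : ∀ m : ℕ, AEMeasurable (fun g =>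
      {u : L2 | ‖u‖ < R}.indicator (fun u => moment b u ^ m) (ψ g)) P := fun m =>
    (lowerSemicontinuous_indicator_moment_pow m).measurable.comp_aemeasurable hψ
  rw [lintegral_tsum fun m => (hmeas m).const_mul _]
  refine ENNReal.tsum_le_tsum fun m => ?_
  rw [lintegral_const_mul'' _ (hmeas m), mul_assoc]
  refine mul_le_mul_right ?_ _
  rw [mul_assoc A, mul_pow]
  refine mul_le_mul_right ?_ _
  rcases Nat.eq_zero_or_pos m with rfl | hm
  · simp only [pow_zero]
    refine (lintegral_mono (g := fun _ => 1) fun g => ?_).trans (by simp)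
    exact Set.indicator_le_self' (fun _ _ => zero_le_one) _
  · exact h m hm

/-! ### The Gibbs density -/

/-- The truncation of a potential at the levels `± L`. -/
def truncate (V : ℂ → ℝ) (L : ℝ) (w : ℂ) : ℝ := max (-L) (min (V w) L)

theorem continuous_truncate {V : ℂ → ℝ} (hV : Continuous V) (L : ℝ) :
    Continuous (truncate V L) := by
  unfold truncate; fun_prop

theorem abs_truncate_le (V : ℂ → ℝ) {L : ℝ} (hL : 0 ≤ L) (w : ℂ) : |truncate V L w| ≤ L :=
  abs_le.2 ⟨le_max_left _ _, max_le (by linarith) (min_le_right _ _)⟩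

theorem abs_truncate_le_abs (V : ℂ → ℝ) {L : ℝ} (hL : 0 ≤ L) (w : ℂ) :
    |truncate V L w| ≤ |V w| := by
  unfold truncate
  rcases le_total (V w) L with h1 | h1
  · rw [min_eq_left h1]
    rcases le_total (-L) (V w) with h2 | h2
    · rw [max_eq_right h2]
    · rw [max_eq_left h2, abs_neg, abs_of_nonneg hL, abs_of_nonpos (by linarith)]; linarith
  · rw [min_eq_right h1, max_eq_right (by linarith), abs_of_nonneg hL, abs_of_nonneg (by linarith)]
    exact h1

/-- Truncation keeps a lower bound of the potential with the same constants for every `L`, so the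
exponential moments stay uniform in `L`. -/
theorem neg_truncate_le {V : ℂ → ℝ} {L : ℝ} (hL : 0 ≤ L) {w : ℂ} {B : ℝ} (hB : 0 ≤ B)
    (h : -V w ≤ B) : -truncate V L w ≤ B := by
  unfold truncate
  rcases le_total (V w) L with h1 | h1
  · have := le_max_right (-L) (V w)
    rw [min_eq_left h1]; linarith
  · rw [min_eq_right h1, max_eq_right (by linarith)]; linarith

/-- Where the truncation acts, `|V| ≥ L` and the error is at most `|V|`, so a second power of `V`
pays for the factor `L`. -/
theorem mul_abs_sub_truncate_le (V : ℂ → ℝ) {L : ℝ} (hL : 0 ≤ L) (w : ℂ) :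
    L * |V w - truncate V L w| ≤ V w ^ 2 := by
  unfold truncate
  rcases le_total (V w) L with h1 | h1
  · rw [min_eq_left h1]
    rcases le_total (-L) (V w) with h2 | h2
    · rw [max_eq_right h2, sub_self, abs_zero, mul_zero]; positivity
    · rw [max_eq_left h2, abs_of_nonpos (by linarith)]; nlinarith
  · rw [min_eq_right h1, max_eq_right (by linarith), abs_of_nonneg (by linarith)]; nlinarith

theorem tendsto_truncate (V : ℂ → ℝ) (w : ℂ) :
    Tendsto (fun k : ℕ => truncate V k w) atTop (𝓝 (V w)) := by
  refine tendsto_const_nhds.congr' ?_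
  filter_upwards [eventually_ge_atTop ⌈|V w|⌉₊] with k hk
  have h : |V w| ≤ k := (Nat.le_ceil _).trans (by exact_mod_cast hk)
  have := abs_le.1 h
  unfold truncate
  rw [min_eq_left this.2, max_eq_right this.1]

theorem integrable_truncate {V : ℂ → ℝ} (hV : Continuous V) {L : ℝ} (hL : 0 ≤ L) (u : L2) :
    Integrable (fun x => truncate V L (u x)) vol :=
  Integrable.of_bound ((continuous_truncate hV L).comp_aestronglyMeasurable
    (Lp.aestronglyMeasurable u)) L (Eventually.of_forall fun _ => abs_truncate_le V hL _)

theorem gibbsDensity_nonneg (V : ℂ → ℝ) {χ : ℝ → ℝ} (hχ : ∀ x, 0 ≤ χ x) (u : L2) :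
    0 ≤ gibbsDensity V χ u := mul_nonneg (hχ _) (Real.exp_pos _).le

theorem continuous_gibbsDensity_truncate {V : ℂ → ℝ} (hV : Continuous V) {χ : ℝ → ℝ}
    (hχ : Continuous χ) {L : ℝ} (hL : 0 ≤ L) : Continuous (gibbsDensity (truncate V L) χ) := by
  have := continuous_integral_comp_of_bounded (continuous_truncate hV L) (abs_truncate_le V hL)
  unfold gibbsDensity
  fun_prop

/-- The integral is zero by convention where `V(u)` is not integrable. Elsewhere it is the limit of
the truncated integrals, so these are multiplied by the indicator of the measurable set of
integrability. -/
theorem measurable_integral_comp {V : ℂ → ℝ} (hV : Continuous V) :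
    Measurable fun u : L2 => ∫ x, V (u x) ∂vol := by
  have hD : MeasurableSet {u : L2 | ∫⁻ x, ‖V (u x)‖ₑ ∂vol < ⊤} :=
    measurableSet_lt (lowerSemicontinuous_lintegral_comp
      (h := fun w => ‖V w‖ₑ) (continuous_enorm.comp hV)).measurable measurable_const
  refine measurable_of_tendsto_metrizable (f := fun (k : ℕ) =>
    {u : L2 | ∫⁻ x, ‖V (u x)‖ₑ ∂vol < ⊤}.indicator fun u : L2 => ∫ x, truncate V k (u x) ∂vol)
    (fun k => (continuous_integral_comp_of_bounded (continuous_truncate hV k)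
      (abs_truncate_le V k.cast_nonneg)).measurable.indicator hD) ?_
  rw [tendsto_pi_nhds]
  intro u
  have hm : AEStronglyMeasurable (fun x => V (u x)) vol :=
    hV.comp_aestronglyMeasurable (Lp.aestronglyMeasurable u)
  by_cases hu : ∫⁻ x, ‖V (u x)‖ₑ ∂vol < ⊤
  · simp only [Set.indicator, Set.mem_ofPred_eq, hu, if_true]
    refine tendsto_integral_of_dominated_convergence (fun x => |V (u x)|) (fun k => ?_) ?_
      (fun k => Eventually.of_forall fun x => ?_) (Eventually.of_forall fun x => ?_)
    · exact (continuous_truncate hV k).comp_aestronglyMeasurable (Lp.aestronglyMeasurable u)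
    · exact Integrable.abs ⟨hm, hu⟩
    · exact abs_truncate_le_abs V k.cast_nonneg _
    · exact tendsto_truncate V _
  · simp only [Set.indicator, Set.mem_ofPred_eq, hu, if_false]
    rw [integral_undef (fun h => hu h.2)]
    exact tendsto_const_nhds

theorem measurable_gibbsDensity {V : ℂ → ℝ} (hV : Continuous V) {χ : ℝ → ℝ} (hχ : Continuous χ) :
    Measurable (gibbsDensity V χ) := by
  have := measurable_integral_comp hV
  unfold gibbsDensity
  fun_prop

/-- Valid without integrability, the integral then being zero; the bounds of the density below
therefore hold for every `u`. -/
theorem ofReal_integral_le_lintegral {α : Type*} [MeasurableSpace α] (ν : Measure α) (f : α → ℝ) :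
    ENNReal.ofReal (∫ x, f x ∂ν) ≤ ∫⁻ x, ENNReal.ofReal (f x) ∂ν := by
  by_cases hf : Integrable f ν
  · rw [integral_eq_lintegral_pos_part_sub_lintegral_neg_part hf]
    exact (ENNReal.ofReal_le_ofReal (sub_le_self _ ENNReal.toReal_nonneg)).trans
      ENNReal.ofReal_toReal_le
  · simp [integral_undef hf]

theorem ofReal_neg_integral_le {V : ℂ → ℝ} {C b : ℝ} (hC : 0 ≤ C) (hb : 0 ≤ b)
    (h : ∀ w, -V w ≤ C * (1 + ‖w‖ ^ b)) (u : L2) :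
    ENNReal.ofReal (-∫ x, V (u x) ∂vol) ≤
      ENNReal.ofReal (C * vol.real Set.univ) + ENNReal.ofReal C * moment b u := by
  rw [← integral_neg]
  refine (ofReal_integral_le_lintegral _ _).trans ?_
  calc ∫⁻ x, ENNReal.ofReal (-V (u x)) ∂vol
      ≤ ∫⁻ x, (ENNReal.ofReal C + ENNReal.ofReal C * ‖u x‖ₑ ^ b) ∂vol := by
        refine lintegral_mono fun x => ?_
        rw [← ofReal_norm, ENNReal.ofReal_rpow_of_nonneg (norm_nonneg _) hb,
          ← ENNReal.ofReal_mul hC, ← ENNReal.ofReal_add hC (by positivity)]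
        exact ENNReal.ofReal_le_ofReal ((h _).trans (by rw [mul_add, mul_one]))
    _ = _ := by
        rw [lintegral_add_left measurable_const, lintegral_const,
          lintegral_const_mul' _ _ ENNReal.ofReal_ne_top, ENNReal.ofReal_mul hC, measureReal_def,
          ENNReal.ofReal_toReal (measure_ne_top _ _)]
        rfl

/-- The cutoff confines `u` to the ball of radius `R`, and there the exponential is traded for a
power series in the moment, which can be integrated term by term. -/
theorem ofReal_gibbsDensity_rpow_le {V : ℂ → ℝ} {χ : ℝ → ℝ} {C b p R X : ℝ} (hC : 0 ≤ C)
    (hb : 0 ≤ b) (hp : 0 < p) (h : ∀ w, -V w ≤ C * (1 + ‖w‖ ^ b)) (hχ : ∀ x, 0 ≤ χ x)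
    (hX : ∀ x, χ x ≤ X) (hR : ∀ x, R ≤ x → χ x = 0) (u : L2) :
    ENNReal.ofReal (gibbsDensity V χ u ^ p) ≤
      ENNReal.ofReal (X ^ p) * ENNReal.ofReal (Real.exp |p * (C * vol.real Set.univ)|) *
        {u : L2 | ‖u‖ < R}.indicator (fun u => expSeries (ENNReal.ofReal (p * C) * moment b u)) u := by
  by_cases hu : ‖u‖ < R
  · simp only [Set.indicator, Set.mem_ofPred_eq, hu, if_true]
    unfold gibbsDensity
    rw [Real.mul_rpow (hχ _) (Real.exp_pos _).le, ENNReal.ofReal_mul (Real.rpow_nonneg (hχ _) _),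
      mul_assoc, ← Real.exp_mul]
    refine mul_le_mul' (ENNReal.ofReal_le_ofReal (Real.rpow_le_rpow (hχ _) (hX _) hp.le)) ?_
    refine ofReal_exp_le ?_
    rw [mul_comm _ p, ENNReal.ofReal_mul hp.le, ENNReal.ofReal_mul hp.le, ENNReal.ofReal_mul hp.le,
      mul_assoc, ← mul_add]
    exact mul_le_mul_right (ofReal_neg_integral_le hC hb h u) _
  · have : gibbsDensity V χ u = 0 := by
      unfold gibbsDensity
      rw [hR _ (not_lt.1 hu), zero_mul]
    rw [this, Real.zero_rpow hp.ne']
    simp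

/-- Uniform moments of the Gibbs density, given the moment bounds for `∫ |ψ|^b`. -/
theorem exists_lintegral_gibbsDensity_rpow_le {C b p R X : ℝ} {K : ℝ≥0∞} (hC : 0 ≤ C)
    (hb : 0 ≤ b) (hb4 : b < 4) (hp : 0 < p) (hK : K ≠ ⊤) : ∃ D : ℝ≥0∞, D ≠ ⊤ ∧
    ∀ (V : ℂ → ℝ) (χ : ℝ → ℝ), (∀ w, -V w ≤ C * (1 + ‖w‖ ^ b)) → (∀ x, 0 ≤ χ x) →
    (∀ x, χ x ≤ X) → (∀ x, R ≤ x → χ x = 0) → ∀ ψ : (ℕ → ℂ) → L2, AEMeasurable ψ gaussianSeq →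
    (∀ m : ℕ, 1 ≤ m → ∫⁻ g, {u : L2 | ‖u‖ < R}.indicator (fun u => moment b u ^ m) (ψ g)
      ∂gaussianSeq ≤ (K * (m : ℝ≥0∞) ^ (b / 4)) ^ m) →
    ∫⁻ g, ENNReal.ofReal (gibbsDensity V χ (ψ g) ^ p) ∂gaussianSeq ≤ D := by
  -- The bound `D` depends on the potential through `C` and `b` alone, so that it serves `V` and all
  -- its truncations at once.
  have hA : ENNReal.ofReal (p * C) * K ≠ ⊤ := ENNReal.mul_ne_top ENNReal.ofReal_ne_top hK
  refine ⟨_, ENNReal.mul_ne_top (ENNReal.mul_ne_top (ENNReal.ofReal_ne_top (r := X ^ p))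
    (ENNReal.ofReal_ne_top (r := Real.exp |p * (C * vol.real Set.univ)|)))
    (tsum_exp_moment_lt_top hb4 hA), fun V χ hV hχ hX hR ψ hψ h => ?_⟩
  refine (lintegral_mono fun g =>
    ofReal_gibbsDensity_rpow_le hC hb hp hV hχ hX hR (ψ g)).trans ?_
  rw [lintegral_const_mul' _ _ (ENNReal.mul_ne_top ENNReal.ofReal_ne_top ENNReal.ofReal_ne_top)]
  exact mul_le_mul_right (lintegral_expSeries_le hψ h _) _

theorem abs_exp_sub_exp_le (s t : ℝ) :
    |Real.exp s - Real.exp t| ≤ (Real.exp s + Real.exp t) * |s - t| := by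
  have key : ∀ a b : ℝ, a ≤ b → Real.exp b - Real.exp a ≤ (Real.exp b + Real.exp a) * (b - a) := by
    intro a b hab
    have h1 : Real.exp a = Real.exp b * Real.exp (a - b) := by rw [← Real.exp_add]; congr 1; ring
    have h2 := Real.add_one_le_exp (a - b)
    have := Real.exp_pos a
    have := Real.exp_pos b
    nlinarith
  rcases le_total s t with h | h
  · rw [abs_sub_comm, abs_sub_comm s, abs_of_nonneg (by linarith [Real.exp_le_exp.2 h]),
      abs_of_nonneg (by linarith), add_comm]
    exact key _ _ h
  · rw [abs_of_nonneg (by linarith [Real.exp_le_exp.2 h]), abs_of_nonneg (by linarith)]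
    exact key _ _ h

/-- The exponents differ by at most `I / L` with `I = ∫ V(u)²`, so the densities `A`, `B` differ by
at most `(A + B) I / L ≤ (A² + B² + I²) / L`. Cauchy–Schwarz bounds `I²` by the fourth power of `V`.
-/
theorem ofReal_gibbsDensity_sub_le {V : ℂ → ℝ} (hV : Continuous V) {χ : ℝ → ℝ}
    (hχ : ∀ x, 0 ≤ χ x) {L : ℝ} (hL : 0 < L) (u : L2) :
    ENNReal.ofReal |gibbsDensity V χ u - gibbsDensity (truncate V L) χ u| ≤
      ENNReal.ofReal L⁻¹ * (ENNReal.ofReal (gibbsDensity V χ u ^ (2 : ℝ)) +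
        ENNReal.ofReal (gibbsDensity (truncate V L) χ u ^ (2 : ℝ)) +
        vol Set.univ * ∫⁻ x, ‖V (u x)‖ₑ ^ (4 : ℕ) ∂vol) := by
  have hm : AEStronglyMeasurable (fun x => V (u x)) vol :=
    hV.comp_aestronglyMeasurable (Lp.aestronglyMeasurable u)
  have hCS : (∫⁻ x, ‖V (u x)‖ₑ ^ 2 ∂vol) ^ 2 ≤
      vol Set.univ * ∫⁻ x, ‖V (u x)‖ₑ ^ (4 : ℕ) ∂vol := by
    have := lintegral_mul_pow_le vol (h := fun x => ‖V (u x)‖ₑ ^ 2) (W := fun _ => 1)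
      (hm.enorm.pow_const 2) aemeasurable_const one_le_two
    simpa [← pow_mul] using this
  -- If `I` is infinite, so is the right hand side.
  by_cases h2 : ∫⁻ x, ‖V (u x)‖ₑ ^ 2 ∂vol = ⊤
  · rw [h2] at hCS
    have : vol Set.univ * ∫⁻ x, ‖V (u x)‖ₑ ^ (4 : ℕ) ∂vol = ⊤ := top_le_iff.1 (by simpa using hCS)
    rw [this, add_top, ENNReal.mul_top]
    · exact le_top
    · simpa using hL
  have hsq : Integrable (fun x => V (u x) ^ 2) vol := by
    refine ⟨hm.pow 2, ?_⟩
    simpa [HasFiniteIntegral, enorm_pow] using lt_top_iff_ne_top.2 h2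
  have hint : Integrable (fun x => V (u x)) vol :=
    ((memLp_two_iff_integrable_sq hm).2 hsq).integrable one_le_two
  set s := -∫ x, V (u x) ∂vol with hs
  set t := -∫ x, truncate V L (u x) ∂vol with ht
  have hst : L * |s - t| ≤ ∫ x, V (u x) ^ 2 ∂vol := by
    have e : s - t = -∫ x, (V (u x) - truncate V L (u x)) ∂vol := by
      rw [integral_sub hint (integrable_truncate hV hL.le u)]; ring
    rw [e, abs_neg]
    calc L * |∫ x, (V (u x) - truncate V L (u x)) ∂vol|
        ≤ L * ∫ x, |V (u x) - truncate V L (u x)| ∂vol :=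
          mul_le_mul_of_nonneg_left abs_integral_le_integral_abs hL.le
      _ = ∫ x, L * |V (u x) - truncate V L (u x)| ∂vol := (integral_const_mul _ _).symm
      _ ≤ _ := integral_mono ((hint.sub (integrable_truncate hV hL.le u)).abs.const_mul L) hsq
          fun x => mul_abs_sub_truncate_le V hL.le _
  have hI : ENNReal.ofReal ((∫ x, V (u x) ^ 2 ∂vol) ^ 2) = (∫⁻ x, ‖V (u x)‖ₑ ^ 2 ∂vol) ^ 2 := by
    rw [ENNReal.ofReal_pow (integral_nonneg fun x => sq_nonneg _),
      ofReal_integral_eq_lintegral_ofReal hsq (Eventually.of_forall fun x => sq_nonneg _)]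
    congr 2
    ext x
    rw [← ofReal_norm, ← ENNReal.ofReal_pow (norm_nonneg _), Real.norm_eq_abs, sq_abs]
  have hreal : |gibbsDensity V χ u - gibbsDensity (truncate V L) χ u| ≤
      L⁻¹ * (gibbsDensity V χ u ^ (2 : ℝ) + gibbsDensity (truncate V L) χ u ^ (2 : ℝ) +
        (∫ x, V (u x) ^ 2 ∂vol) ^ 2) := by
    have e1 : gibbsDensity V χ u = χ ‖u‖ * Real.exp s := rfl
    have e2 : gibbsDensity (truncate V L) χ u = χ ‖u‖ * Real.exp t := rfl
    set A := gibbsDensity V χ u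
    set B := gibbsDensity (truncate V L) χ u
    have hA : 0 ≤ A := gibbsDensity_nonneg V hχ u
    have hB : 0 ≤ B := gibbsDensity_nonneg _ hχ u
    have h3 : |A - B| ≤ (A + B) * |s - t| := by
      rw [e1, e2, ← mul_sub, abs_mul, abs_of_nonneg (hχ _), ← mul_add, mul_assoc]
      exact mul_le_mul_of_nonneg_left (abs_exp_sub_exp_le s t) (hχ _)
    rw [Real.rpow_two, Real.rpow_two, inv_mul_eq_div, le_div_iff₀ hL]
    have h4 : |A - B| * L ≤ (A + B) * ∫ x, V (u x) ^ 2 ∂vol :=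
      calc |A - B| * L ≤ (A + B) * |s - t| * L := mul_le_mul_of_nonneg_right h3 hL.le
        _ = (A + B) * (L * |s - t|) := by ring
        _ ≤ _ := mul_le_mul_of_nonneg_left hst (by linarith)
    nlinarith [sq_nonneg (A - ∫ x, V (u x) ^ 2 ∂vol), sq_nonneg (B - ∫ x, V (u x) ^ 2 ∂vol)]
  refine (ENNReal.ofReal_le_ofReal hreal).trans ?_
  have h5 := Real.rpow_nonneg (gibbsDensity_nonneg V hχ u) 2
  have h6 := Real.rpow_nonneg (gibbsDensity_nonneg (truncate V L) hχ u) 2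
  rw [ENNReal.ofReal_mul (by positivity), ENNReal.ofReal_add (add_nonneg h5 h6) (by positivity),
    ENNReal.ofReal_add h5 h6, hI]
  gcongr

/-- The truncation error of the Gibbs density is `O(1 / L)` in `L¹`, uniformly for random
functions with common moment bounds. -/
theorem exists_lintegral_gibbsDensity_sub_truncate_le {V : ℂ → ℝ} (hV : Continuous V) {C c b R X : ℝ}
    {χ : ℝ → ℝ} (hχc : Continuous χ) (hC : 0 ≤ C) (hb : 0 ≤ b) (hb4 : b < 4)
    (hlow : ∀ w, -V w ≤ C * (1 + ‖w‖ ^ b))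
    (hgrow : ∀ w, ‖V w‖ₑ ^ (4 : ℕ) ≤ ENNReal.ofReal c * (1 + ‖w‖ₑ ^ (24 : ℝ)))
    (hχ : ∀ x, 0 ≤ χ x) (hX : ∀ x, χ x ≤ X) (hR : ∀ x, R ≤ x → χ x = 0) {K B : ℝ≥0∞}
    (hK : K ≠ ⊤) (hB : B ≠ ⊤) : ∃ D : ℝ≥0∞, D ≠ ⊤ ∧ ∀ ψ : (ℕ → ℂ) → L2,
    AEMeasurable ψ gaussianSeq →
    (∀ m : ℕ, 1 ≤ m → ∫⁻ g, {u : L2 | ‖u‖ < R}.indicator (fun u => moment b u ^ m) (ψ g)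
      ∂gaussianSeq ≤ (K * (m : ℝ≥0∞) ^ (b / 4)) ^ m) →
    ∫⁻ g, moment 24 (ψ g) ∂gaussianSeq ≤ B → ∀ L : ℝ, 0 < L →
    ∫⁻ g, ENNReal.ofReal |gibbsDensity V χ (ψ g) - gibbsDensity (truncate V L) χ (ψ g)|
      ∂gaussianSeq ≤ ENNReal.ofReal L⁻¹ * D := by
  obtain ⟨E, hE, h⟩ := exists_lintegral_gibbsDensity_rpow_le (R := R) (X := X) hC hb hb4 two_pos hK
  refine ⟨E + E + vol Set.univ * (ENNReal.ofReal c * (vol Set.univ + B)), ?_,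
    fun ψ hψ hm h24 L hL => ?_⟩
  · have := measure_ne_top vol Set.univ
    finiteness
  refine (lintegral_mono fun g => ofReal_gibbsDensity_sub_le hV hχ hL (ψ g)).trans ?_
  rw [lintegral_const_mul' _ _ ENNReal.ofReal_ne_top]
  refine mul_le_mul_right ?_ _
  have h4 : ∀ u : L2, ∫⁻ x, ‖V (u x)‖ₑ ^ (4 : ℕ) ∂vol ≤
      ENNReal.ofReal c * (vol Set.univ + moment 24 u) := by
    intro u
    refine (lintegral_mono fun x => hgrow (u x)).trans (le_of_eq ?_)
    rw [lintegral_const_mul' _ _ ENNReal.ofReal_ne_top, lintegral_add_left measurable_const,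
      lintegral_const, one_mul]
    rfl
  have hmV : AEMeasurable (fun g => vol Set.univ * ∫⁻ x, ‖V (ψ g x)‖ₑ ^ (4 : ℕ) ∂vol)
      gaussianSeq :=
    (((lowerSemicontinuous_lintegral_comp (h := fun w => ‖V w‖ₑ ^ (4 : ℕ))
      ((ENNReal.continuous_pow 4).comp (continuous_enorm.comp hV))).measurable).comp_aemeasurable
        hψ).const_mul _
  rw [lintegral_add_right' _ hmV]
  refine add_le_add ?_ ?_
  · have hlowT : ∀ w, -truncate V L w ≤ C * (1 + ‖w‖ ^ b) := fun w =>
      neg_truncate_le hL.le (by positivity) (hlow w)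
    have hmg : AEMeasurable (fun g => ENNReal.ofReal (gibbsDensity V χ (ψ g) ^ (2 : ℝ)))
        gaussianSeq :=
      (((measurable_gibbsDensity hV hχc).comp_aemeasurable hψ).pow_const _).ennreal_ofReal
    rw [lintegral_add_left' hmg]
    exact add_le_add (h V χ hlow hχ hX hR ψ hψ hm) (h _ χ hlowT hχ hX hR ψ hψ hm)
  · rw [lintegral_const_mul' _ _ (measure_ne_top _ _)]
    refine mul_le_mul_right ((lintegral_mono fun g => h4 (ψ g)).trans ?_) _
    rw [lintegral_const_mul' _ _ ENNReal.ofReal_ne_top, lintegral_add_left measurable_const,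
      lintegral_const, (measure_univ : gaussianSeq Set.univ = 1), mul_one]
    exact mul_le_mul_right (add_le_add le_rfl h24) _

/-- If random functions `ψ N` with common moment bounds converge almost surely in `L²`, then their
Gibbs densities converge in `L¹`. -/
theorem tendsto_lintegral_gibbsDensity_sub {V : ℂ → ℝ} (hV : Continuous V) {C c b R X : ℝ}
    {χ : ℝ → ℝ} (hχc : Continuous χ) (hC : 0 ≤ C) (hb : 0 ≤ b) (hb4 : b < 4)
    (hlow : ∀ w, -V w ≤ C * (1 + ‖w‖ ^ b))
    (hgrow : ∀ w, ‖V w‖ₑ ^ (4 : ℕ) ≤ ENNReal.ofReal c * (1 + ‖w‖ₑ ^ (24 : ℝ)))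
    (hχ : ∀ x, 0 ≤ χ x) (hX : ∀ x, χ x ≤ X) (hR : ∀ x, R ≤ x → χ x = 0) {K B : ℝ≥0∞}
    (hK : K ≠ ⊤) (hB : B ≠ ⊤) {ψ : ℕ → (ℕ → ℂ) → L2} {ψ' : (ℕ → ℂ) → L2}
    (hψ : ∀ N, Measurable (ψ N)) (hψ' : AEMeasurable ψ' gaussianSeq)
    (hlim : ∀ᵐ g ∂gaussianSeq, Tendsto (fun N => ψ N g) atTop (𝓝 (ψ' g)))
    (hm : ∀ N m : ℕ, 1 ≤ m → ∫⁻ g, {u : L2 | ‖u‖ < R}.indicator (fun u => moment b u ^ m) (ψ N g)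
      ∂gaussianSeq ≤ (K * (m : ℝ≥0∞) ^ (b / 4)) ^ m)
    (h24 : ∀ N, ∫⁻ g, moment 24 (ψ N g) ∂gaussianSeq ≤ B) :
    Tendsto (fun N => ∫⁻ g, ENNReal.ofReal |gibbsDensity V χ (ψ N g) - gibbsDensity V χ (ψ' g)|
      ∂gaussianSeq) atTop (𝓝 0) := by
  obtain ⟨D, hD, hDb⟩ := exists_lintegral_gibbsDensity_sub_truncate_le hV hχc hC hb hb4 hlow hgrow hχ hX
    hR hK hB
  have hm' : ∀ m : ℕ, 1 ≤ m → ∫⁻ g, {u : L2 | ‖u‖ < R}.indicator (fun u => moment b u ^ m) (ψ' g)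
      ∂gaussianSeq ≤ (K * (m : ℝ≥0∞) ^ (b / 4)) ^ m := fun m h1 =>
    lintegral_le_of_tendsto (lowerSemicontinuous_indicator_moment_pow m) hψ hlim
      fun N => hm N m h1
  have h24' : ∫⁻ g, moment 24 (ψ' g) ∂gaussianSeq ≤ B :=
    lintegral_le_of_tendsto lowerSemicontinuous_moment hψ hlim h24
  have hX0 : 0 ≤ X := (hχ 0).trans (hX 0)
  rw [ENNReal.tendsto_atTop_zero]
  intro ε hε
  -- The level `L` is fixed before `N`: the truncation errors at `ψ N` and at the limit are bounded
  -- by the same `D / L`, and dominated convergence is needed for this one level.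
  obtain ⟨L, hL, hLε⟩ : ∃ L : ℝ, 0 < L ∧ ENNReal.ofReal L⁻¹ * D + ENNReal.ofReal L⁻¹ * D ≤ ε / 2 := by
    have h0 : Tendsto (fun L : ℝ => ENNReal.ofReal L⁻¹ * D + ENNReal.ofReal L⁻¹ * D) atTop (𝓝 0) := by
      have h1 : Tendsto (fun L : ℝ => ENNReal.ofReal L⁻¹) atTop (𝓝 0) := by
        simpa using (ENNReal.tendsto_ofReal (tendsto_inv_atTop_zero (𝕜 := ℝ)))
      have h2 := ENNReal.Tendsto.mul_const h1 (Or.inr hD)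
      rw [zero_mul] at h2
      simpa using h2.add h2
    exact ((eventually_gt_atTop 0).and
      (h0.eventually_le_const (ENNReal.half_pos hε.ne'))).exists
  set Φ := gibbsDensity (truncate V L) χ with hΦ
  have hΦc : Continuous Φ := continuous_gibbsDensity_truncate hV hχc hL.le
  have hΦb : ∀ u, |Φ u| ≤ X * Real.exp (L * vol.real Set.univ) := by
    intro u
    rw [abs_of_nonneg (gibbsDensity_nonneg _ hχ u)]
    refine mul_le_mul (hX _) (Real.exp_le_exp.2 ?_) (Real.exp_pos _).le hX0
    refine (neg_le_abs _).trans ?_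
    have := norm_integral_le_of_norm_le_const (μ := vol) (f := fun x => truncate V L (u x)) (C := L)
      (Eventually.of_forall fun x => abs_truncate_le V hL.le _)
    simpa using this
  have hdct : Tendsto (fun N => ∫⁻ g, ENNReal.ofReal |Φ (ψ N g) - Φ (ψ' g)| ∂gaussianSeq) atTop
      (𝓝 0) := by
    have := tendsto_lintegral_of_dominated_convergence' (μ := gaussianSeq)
      (F := fun N g => ENNReal.ofReal |Φ (ψ N g) - Φ (ψ' g)|) (f := fun _ => 0)
      (fun _ => ENNReal.ofReal (2 * (X * Real.exp (L * vol.real Set.univ)))) (fun N => ?_)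
      (fun N => Eventually.of_forall fun g => ENNReal.ofReal_le_ofReal ?_)
      (by rw [lintegral_const]; finiteness) ?_
    · simpa using this
    · have h1 := (hΦc.measurable.comp (hψ N)).aemeasurable (μ := gaussianSeq)
      have h2 := hΦc.measurable.comp_aemeasurable hψ'
      exact (measurable_norm.comp_aemeasurable (h1.sub h2)).ennreal_ofReal
    · have := hΦb (ψ N g)
      have := hΦb (ψ' g)
      exact (abs_sub _ _).trans (by linarith)
    · filter_upwards [hlim] with g hg
      have h1 := (((hΦc.tendsto _).comp hg).sub_const (Φ (ψ' g))).abs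
      simpa using ENNReal.tendsto_ofReal h1
  obtain ⟨N₀, hN₀⟩ := ENNReal.tendsto_atTop_zero.1 hdct (ε / 2) (ENNReal.half_pos hε.ne')
  refine ⟨N₀, fun N hN => ?_⟩
  have hGm := measurable_gibbsDensity hV hχc
  have hpt : ∀ g, ENNReal.ofReal |gibbsDensity V χ (ψ N g) - gibbsDensity V χ (ψ' g)| ≤
      (ENNReal.ofReal |gibbsDensity V χ (ψ N g) - Φ (ψ N g)| +
        ENNReal.ofReal |gibbsDensity V χ (ψ' g) - Φ (ψ' g)|) +
        ENNReal.ofReal |Φ (ψ N g) - Φ (ψ' g)| := by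
    intro g
    rw [← ENNReal.ofReal_add (abs_nonneg _) (abs_nonneg _),
      ← ENNReal.ofReal_add (by positivity) (abs_nonneg _)]
    refine ENNReal.ofReal_le_ofReal ?_
    set p := gibbsDensity V χ (ψ N g)
    set q := gibbsDensity V χ (ψ' g)
    have e : p - q = (p - Φ (ψ N g)) - (q - Φ (ψ' g)) + (Φ (ψ N g) - Φ (ψ' g)) := by ring
    rw [e]
    exact (abs_add_le _ _).trans (add_le_add (abs_sub _ _) le_rfl)
  refine (lintegral_mono hpt).trans ?_
  have m1 : Measurable fun g => ENNReal.ofReal |gibbsDensity V χ (ψ N g) - Φ (ψ N g)| :=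
    (measurable_norm.comp ((hGm.comp (hψ N)).sub (hΦc.measurable.comp (hψ N)))).ennreal_ofReal
  have m2 : AEMeasurable (fun g => ENNReal.ofReal |gibbsDensity V χ (ψ' g) - Φ (ψ' g)|)
      gaussianSeq :=
    (measurable_norm.comp_aemeasurable ((hGm.comp_aemeasurable hψ').sub
      (hΦc.measurable.comp_aemeasurable hψ'))).ennreal_ofReal
  have m12 : AEMeasurable (fun g => ENNReal.ofReal |gibbsDensity V χ (ψ N g) - Φ (ψ N g)| +
      ENNReal.ofReal |gibbsDensity V χ (ψ' g) - Φ (ψ' g)|) gaussianSeq := m1.aemeasurable.add m2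
  rw [lintegral_add_left' m12, lintegral_add_left m1]
  calc _ ≤ (ENNReal.ofReal L⁻¹ * D + ENNReal.ofReal L⁻¹ * D) + ε / 2 :=
        add_le_add (add_le_add (hDb _ (hψ N).aemeasurable (hm N) (h24 N) L hL)
          (hDb _ hψ' hm' h24' L hL)) (hN₀ N hN)
    _ ≤ ε / 2 + ε / 2 := add_le_add hLε le_rfl
    _ = ε := ENNReal.add_halves ε

/-! ### Membership in the radial Sobolev spaces -/

theorem inner_e_tsum {a : ℕ → ℂ} (h : Summable fun n => a n • e n) (n : ℕ) :
    inner ℂ (e n) (∑' k, a k • e k) = a n := by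
  have h1 := (innerSL ℂ (e n)).hasSum h.hasSum
  have h2 : ∀ k, innerSL ℂ (e n) (a k • e k) = if k = n then a n else 0 := by
    intro k
    rw [innerSL_apply_apply, inner_smul_right, orthonormal_iff_ite.1 orthonormal_e n k]
    by_cases hk : k = n
    · subst hk; simp
    · simp [hk, Ne.symm hk]
  simp only [h2] at h1
  exact h1.unique (hasSum_ite_eq n (a n))

theorem summable_smul_e {a : ℕ → ℂ} (h : Summable fun n => ‖a n‖ ^ 2) :
    Summable fun n => a n • e n := by
  have := (orthonormal_e.orthogonalFamily).summable_iff_norm_sq_summable a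
  simpa using this.2 h

theorem one_le_z_rpow {σ : ℝ} (hσ : 0 ≤ σ) (n : ℕ) : 1 ≤ z n ^ σ :=
  Real.one_le_rpow (one_lt_z n).le hσ

theorem norm_le_norm_z_rpow_mul {σ : ℝ} (hσ : 0 ≤ σ) (n : ℕ) (w : ℂ) :
    ‖w‖ ≤ ‖((z n ^ σ : ℝ) : ℂ) * w‖ := by
  rw [norm_mul, Complex.norm_real, Real.norm_of_nonneg (by linarith [one_le_z_rpow hσ n])]
  exact le_mul_of_one_le_left (norm_nonneg _) (one_le_z_rpow hσ n)

theorem memlp_two_iff {f : ℕ → ℂ} : Memℓp f 2 ↔ Summable fun n => ‖f n‖ ^ 2 := by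
  rw [memℓp_gen_iff (by simp)]
  simp

theorem tsum_mem_hRad {σ : ℝ} (hσ : 0 ≤ σ) {a : ℕ → ℂ}
    (h : Summable fun n => ‖((z n ^ σ : ℝ) : ℂ) * a n‖ ^ 2) :
    Summable (fun n => a n • e n) ∧ ∑' n, a n • e n ∈ hRad σ := by
  have hs : Summable fun n => a n • e n := summable_smul_e <|
    Summable.of_nonneg_of_le (fun n => sq_nonneg _)
      (fun n => pow_le_pow_left₀ (norm_nonneg _) (norm_le_norm_z_rpow_mul hσ n _) 2) h
  refine ⟨hs, ?_, ?_⟩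
  · simp only [inner_e_tsum hs]
    exact hs.hasSum
  · simp only [inner_e_tsum hs]
    exact memlp_two_iff.2 h

/-- Membership in `hRad s` supplies the expansion of `u`, and summability of the weighted
coefficients is all that remains. -/
theorem mem_hRad_of_le {s σ : ℝ} (hσ : 0 ≤ σ) {u : L2} (hu : u ∈ hRad s)
    (h : Summable fun n => ‖((z n ^ σ : ℝ) : ℂ) * inner ℂ (e n) u‖ ^ 2) : u ∈ hRad σ := by
  have := (tsum_mem_hRad hσ h).2
  rwa [hu.1.tsum_eq] at this

theorem e_mem_hRad (σ : ℝ) (n : ℕ) : e n ∈ hRad σ := by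
  have hin : ∀ k, inner ℂ (e k) (e n) = if k = n then (1 : ℂ) else 0 :=
    fun k => orthonormal_iff_ite.1 orthonormal_e k n
  refine ⟨?_, ?_⟩
  · have : (fun k => inner ℂ (e k) (e n) • e k) = fun k => if k = n then e n else 0 := by
      ext1 k
      by_cases hk : k = n
      · subst hk; rw [hin]; simp
      · rw [hin]; simp [hk]
    rw [this]
    exact hasSum_ite_eq n (e n)
  · rw [memlp_two_iff]
    refine summable_of_ne_finset_zero (s := {n}) fun k hk => ?_
    rw [hin]
    simp [Finset.mem_singleton.not.1 hk]

namespace HRad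

variable {σ : ℝ}

/-- `HRad.toL2` as a linear map. -/
def toL2Lin (σ : ℝ) : HRad σ →ₗ[ℂ] L2 := (hRad σ).subtype

theorem toL2Lin_apply (u : HRad σ) : toL2Lin σ u = u.toL2 := rfl

theorem toL2_injective : Function.Injective (toL2 (σ := σ)) := Subtype.val_injective

/-- An element of `L²` satisfying the condition, as an element of `H^σ_rad`. -/
def mk (u : L2) (h : u ∈ hRad σ) : HRad σ := ⟨u, h⟩

theorem toL2_mk (u : L2) (h : u ∈ hRad σ) : (mk u h).toL2 = u := rfl

/-- The finite sum `∑_{n < N} cₙ eₙ` in `H^σ_rad`. -/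
def finSum (σ : ℝ) (N : ℕ) (c : ℕ → ℂ) : HRad σ :=
  ∑ n ∈ Finset.range N, c n • mk (e n) (e_mem_hRad σ n)

theorem toL2_finSum (N : ℕ) (c : ℕ → ℂ) :
    (finSum σ N c).toL2 = ∑ n ∈ Finset.range N, c n • e n := by
  rw [← toL2Lin_apply]
  unfold finSum
  rw [map_sum]
  refine Finset.sum_congr rfl fun n _ => ?_
  rw [map_smul, toL2Lin_apply, toL2_mk]

theorem continuous_finSum {X : Type*} [TopologicalSpace X] {N : ℕ} {c : X → ℕ → ℂ}
    (hc : ∀ n, Continuous fun x => c x n) : Continuous fun x => finSum σ N (c x) := by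
  unfold finSum
  exact continuous_finsetSum _ fun n _ => (hc n).smul continuous_const

theorem weightedCoeff_e (n : ℕ) :
    weightedCoeff σ (mk (e n) (e_mem_hRad σ n)) = lp.single 2 n ((z n ^ σ : ℝ) : ℂ) := by
  ext k
  change ((z k ^ σ : ℝ) : ℂ) * inner ℂ (e k) (e n) = _
  rw [orthonormal_iff_ite.1 orthonormal_e k n, lp.coeFn_single]
  by_cases hk : k = n
  · subst hk; simp
  · simp [hk]

theorem isInducing_weightedCoeff : IsInducing (weightedCoeff σ) := ⟨rfl⟩

/-- The topology is induced from `ℓ²` by the weighted coefficients, and there truncated sequences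
converge to the full one. -/
theorem tendsto_finSum (u : HRad σ) :
    Tendsto (fun N => finSum σ N fun n => inner ℂ (e n) u.toL2) atTop (𝓝 u) := by
  rw [isInducing_weightedCoeff.tendsto_nhds_iff]
  have h := (lp.hasSum_single ENNReal.ofNat_ne_top (weightedCoeff σ u)).tendsto_sum_nat
  refine h.congr fun N => ?_
  simp only [Function.comp_apply, finSum, map_sum, map_smul, weightedCoeff_e]
  refine Finset.sum_congr rfl fun n _ => ?_
  rw [← lp.single_smul]
  congr 1
  change ((z n ^ σ : ℝ) : ℂ) * inner ℂ (e n) u.toL2 = inner ℂ (e n) u.toL2 * ((z n ^ σ : ℝ) : ℂ)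
  ring

theorem norm_toL2_le (hσ : 0 ≤ σ) (u : HRad σ) : ‖u.toL2‖ ≤ ‖u‖ := by
  have hlim := (u.2.1.tendsto_sum_nat).norm
  refine le_of_tendsto hlim (Eventually.of_forall fun N => ?_)
  refine (pow_le_pow_iff_left₀ (norm_nonneg _) (norm_nonneg _) two_ne_zero).1 ?_
  have h := lp.sum_rpow_le_norm_rpow (by simp) (weightedCoeff σ u) (Finset.range N)
  simp only [ENNReal.toReal_ofNat, Real.rpow_two] at h
  calc ‖∑ n ∈ Finset.range N, (inner ℂ (e n) u.toL2 : ℂ) • e n‖ ^ 2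
      = ∑ n ∈ Finset.range N, ‖(inner ℂ (e n) u.toL2 : ℂ)‖ ^ 2 := norm_sq_sum_smul_e _ _
    _ ≤ ∑ n ∈ Finset.range N, ‖weightedCoeff σ u n‖ ^ 2 :=
        Finset.sum_le_sum fun n _ =>
          pow_le_pow_left₀ (norm_nonneg _) (norm_le_norm_z_rpow_mul hσ n _) 2
    _ ≤ ‖weightedCoeff σ u‖ ^ 2 := h

theorem continuous_toL2 (hσ : 0 ≤ σ) : Continuous (toL2 (σ := σ)) :=
  AddMonoidHomClass.continuous_of_bound (toL2Lin σ) 1 fun u => by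
    rw [one_mul]; exact norm_toL2_le hσ u

theorem continuous_inner_toL2 (hσ : 0 ≤ σ) (n : ℕ) :
    Continuous fun u : HRad σ => inner ℂ (e n) u.toL2 :=
  continuous_const.inner (continuous_toL2 hσ)

open Classical in
/-- An element of `H^s_rad`, seen as an element of `H^σ_rad` if it is one (and `0` otherwise). -/
def lift (s σ : ℝ) (u : HRad s) : HRad σ := if h : u.toL2 ∈ hRad σ then mk u.toL2 h else 0

theorem toL2_lift {s : ℝ} {u : HRad s} (h : u.toL2 ∈ hRad σ) :
    (lift s σ u).toL2 = u.toL2 := by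
  unfold lift
  rw [dif_pos h, toL2_mk]

/-- The coefficients are continuous on `H^s_rad`, and membership is finiteness of a series of
measurable functions of them. -/
theorem measurableSet_mem_hRad {s : ℝ} (hs : 0 ≤ s) (hσ : 0 ≤ σ) :
    MeasurableSet {u : HRad s | u.toL2 ∈ hRad σ} := by
  have : {u : HRad s | u.toL2 ∈ hRad σ} =
      {u : HRad s | ∑' n, ‖((z n ^ σ : ℝ) : ℂ) * inner ℂ (e n) u.toL2‖ₑ ^ 2 < ⊤} := by
    ext u
    have hiff : (∑' n, ‖((z n ^ σ : ℝ) : ℂ) * inner ℂ (e n) u.toL2‖ₑ ^ 2 < ⊤) ↔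
        Summable fun n => ‖((z n ^ σ : ℝ) : ℂ) * inner ℂ (e n) u.toL2‖ ^ 2 := by
      have e1 : ∀ n, ‖((z n ^ σ : ℝ) : ℂ) * inner ℂ (e n) u.toL2‖ₑ ^ 2 =
          ((‖((z n ^ σ : ℝ) : ℂ) * inner ℂ (e n) u.toL2‖₊ ^ 2 : NNReal) : ℝ≥0∞) := fun n => by
        simp [enorm_eq_nnnorm]
      simp only [e1]
      rw [lt_top_iff_ne_top, ENNReal.tsum_coe_ne_top_iff_summable, ← NNReal.summable_coe]
      simp
    rw [Set.mem_ofPred_eq, Set.mem_ofPred_eq, hiff]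
    exact ⟨fun h => memlp_two_iff.1 h.2, fun h => mem_hRad_of_le hσ u.2 h⟩
  rw [this]
  refine measurableSet_lt (Measurable.tsum fun n => ?_) measurable_const
  exact ((continuous_const.mul (continuous_inner_toL2 hs n)).measurable.enorm).pow_const 2

/-- A pointwise limit in `H^σ_rad` of finite sums, each continuous on `H^s_rad`, restricted to a
measurable set. -/
theorem measurable_lift {s : ℝ} (hs : 0 ≤ s) (hσ : 0 ≤ σ) : Measurable (lift s σ) := by
  have hD := measurableSet_mem_hRad (σ := σ) hs hσ
  refine measurable_of_tendsto_metrizable (f := fun N =>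
    {u : HRad s | u.toL2 ∈ hRad σ}.indicator fun u => finSum σ N fun n => inner ℂ (e n) u.toL2)
    (fun N => (continuous_finSum (continuous_inner_toL2 hs)).measurable.indicator hD) ?_
  rw [tendsto_pi_nhds]
  intro u
  by_cases hu : u.toL2 ∈ hRad σ
  · simp only [Set.indicator, Set.mem_ofPred_eq, hu, if_true]
    have := tendsto_finSum (lift s σ u)
    rwa [toL2_lift hu] at this
  · simp only [Set.indicator, Set.mem_ofPred_eq, hu, if_false, lift]
    exact tendsto_const_nhds

end HRad

theorem inHs_eq {s σ : ℝ} (A : Set (HRad σ)) :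
    inHs s A = {u : HRad s | u.toL2 ∈ hRad σ} ∩ HRad.lift s σ ⁻¹' A := by
  ext u
  constructor
  · rintro ⟨v, hv, hvu⟩
    have hu : u.toL2 ∈ hRad σ := hvu ▸ v.2
    refine ⟨hu, ?_⟩
    have : HRad.lift s σ u = v := HRad.toL2_injective ((HRad.toL2_lift hu).trans hvu.symm)
    rwa [Set.mem_preimage, this]
  · rintro ⟨hu, hA⟩
    exact ⟨_, hA, HRad.toL2_lift hu⟩

theorem measurableSet_inHs {s σ : ℝ} (hs : 0 ≤ s) (hσ : 0 ≤ σ) {A : Set (HRad σ)}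
    (hA : MeasurableSet A) : MeasurableSet (inHs s A) := by
  rw [inHs_eq]
  exact (HRad.measurableSet_mem_hRad hs hσ).inter (HRad.measurable_lift hs hσ hA)

theorem sum_inner_smul_e_of_mem_EN {N : ℕ} {u : L2} (hu : u ∈ EN N) :
    ∑ n ∈ Finset.range N, (inner ℂ (e n) u : ℂ) • e n = u := by
  unfold EN at hu
  induction hu using Submodule.span_induction with
  | mem x hx =>
    obtain ⟨k, hk, rfl⟩ := hx
    have : ∀ n, (inner ℂ (e n) (e k) : ℂ) • e n = if n = k then e k else 0 := by
      intro n
      rw [orthonormal_iff_ite.1 orthonormal_e n k]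
      by_cases h : n = k
      · subst h; simp
      · simp [h]
    simp only [this]
    rw [Finset.sum_ite_eq' (Finset.range N) k, if_pos (Finset.mem_range.2 hk)]
  | zero => simp
  | add x y _ _ hx hy =>
    simp only [inner_add_right, add_smul, Finset.sum_add_distrib]
    rw [hx, hy]
  | smul c x _ hx =>
    simp only [inner_smul_right, mul_smul]
    rw [← Finset.smul_sum, hx]

/-- An element of `E_N` is a finite sum of its coefficients, which embeds it continuously in
`H^σ_rad`; this makes the intersection measurable. -/
theorem interEN_eq {N : ℕ} {σ : ℝ} (A : Set (HRad σ)) :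
    interEN N A = (fun u : EN N => HRad.finSum σ N fun n => inner ℂ (e n) (u : L2)) ⁻¹' A := by
  ext u
  have hu : (HRad.finSum σ N fun n => inner ℂ (e n) (u : L2)).toL2 = u := by
    rw [HRad.toL2_finSum, sum_inner_smul_e_of_mem_EN u.2]
  constructor
  · rintro ⟨v, hv, hvu⟩
    rw [Set.mem_preimage, HRad.toL2_injective (hu.trans hvu.symm)]
    exact hv
  · exact fun h => ⟨_, h, hu⟩

theorem measurableSet_interEN {N : ℕ} {σ : ℝ} {A : Set (HRad σ)} (hA : MeasurableSet A) :
    MeasurableSet (interEN N A) := by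
  rw [interEN_eq]
  exact (HRad.continuous_finSum fun n =>
    continuous_const.inner continuous_subtype_val).measurable hA

/-! ### Almost sure convergence of the random series -/

theorem lintegral_enorm_gaussian_sq_le (n : ℕ) : ∫⁻ g : ℕ → ℂ, ‖g n‖ₑ ^ (2 : ℝ) ∂gaussianSeq ≤
    ENNReal.ofReal (2 * Real.exp 2 * (2 * 1) ^ ((2 : ℝ) / 2)) := by
  have := lintegral_norm_rpow_gaussian {n} (fun _ => 1) (q := 2) (v := 1) two_pos one_pos (by simp)
  simpa using this

/-- The expected sum is a multiple of `∑ zₙ^{2σ-2}`, finite because `2σ - 2 < -1`. -/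
theorem ae_summable_coeff {σ : ℝ} (hσ : σ < 1 / 2) :
    ∀ᵐ g ∂gaussianSeq, Summable fun n => ‖((z n ^ σ : ℝ) : ℂ) * coeff g n‖ ^ 2 := by
  have hterm : ∀ (g : ℕ → ℂ) n, ‖((z n ^ σ : ℝ) : ℂ) * coeff g n‖ₑ ^ 2 =
      ENNReal.ofReal (z n ^ (2 * σ - 2)) * ‖g n‖ₑ ^ (2 : ℝ) := by
    intro g n
    have hz := z_pos n
    rw [ENNReal.rpow_two, ← ofReal_norm, ← ofReal_norm, ← ENNReal.ofReal_pow (norm_nonneg _),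
      ← ENNReal.ofReal_pow (norm_nonneg _), ← ENNReal.ofReal_mul (by positivity)]
    congr 1
    unfold coeff
    rw [norm_mul, norm_div, Complex.norm_real, Complex.norm_real, Real.norm_of_nonneg hz.le,
      Real.norm_of_nonneg (by positivity), Real.rpow_sub hz, Real.rpow_two, mul_comm 2 σ,
      Real.rpow_mul hz.le, Real.rpow_two]
    field_simp
  have hfin : ∫⁻ g, ∑' n, ‖((z n ^ σ : ℝ) : ℂ) * coeff g n‖ₑ ^ 2 ∂gaussianSeq ≠ ⊤ := by
    simp only [hterm]
    rw [lintegral_tsum fun n =>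
      (((measurable_pi_apply n).enorm.pow_const _).const_mul _).aemeasurable]
    set c := ENNReal.ofReal (2 * Real.exp 2 * (2 * 1) ^ ((2 : ℝ) / 2)) with hc
    refine ne_top_of_le_ne_top (b := ∑' n, ENNReal.ofReal (z n ^ (2 * σ - 2)) * c) ?_
      (ENNReal.tsum_le_tsum fun n => ?_)
    · rw [ENNReal.tsum_mul_right]
      exact ENNReal.mul_ne_top (summable_z_rpow (by linarith)).tsum_ofReal_ne_top
        ENNReal.ofReal_ne_top
    · rw [lintegral_const_mul' _ _ ENNReal.ofReal_ne_top]
      exact mul_le_mul_right (lintegral_enorm_gaussian_sq_le n) _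
  have hmeas : AEMeasurable (fun g => ∑' n, ‖((z n ^ σ : ℝ) : ℂ) * coeff g n‖ₑ ^ 2)
      gaussianSeq := by
    refine (Measurable.tsum fun n => ?_).aemeasurable
    exact (((measurable_coeff n).const_mul _).enorm).pow_const 2
  filter_upwards [ae_lt_top' hmeas hfin] with g hg
  have e1 : ∀ n, ‖((z n ^ σ : ℝ) : ℂ) * coeff g n‖ₑ ^ 2 =
      ((‖((z n ^ σ : ℝ) : ℂ) * coeff g n‖₊ ^ 2 : NNReal) : ℝ≥0∞) := fun n => by
    simp [enorm_eq_nnnorm]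
  simp only [e1] at hg
  rw [lt_top_iff_ne_top, ENNReal.tsum_coe_ne_top_iff_summable, ← NNReal.summable_coe] at hg
  simpa using hg

/-- The sum `φ` of the random series in `L²`. -/
def fullSum (g : ℕ → ℂ) : L2 := ∑' n, coeff g n • e n

theorem ae_fullSum {σ : ℝ} (hσ0 : 0 ≤ σ) (hσ : σ < 1 / 2) : ∀ᵐ g ∂gaussianSeq,
    (Summable fun n => coeff g n • e n) ∧ fullSum g ∈ hRad σ := by
  filter_upwards [ae_summable_coeff hσ] with g hg
  exact tsum_mem_hRad hσ0 hg

theorem ae_tendsto_partialSum :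
    ∀ᵐ g ∂gaussianSeq, Tendsto (fun N => partialSum N g) atTop (𝓝 (fullSum g)) := by
  filter_upwards [ae_fullSum le_rfl (by norm_num)] with g hg
  exact hg.1.hasSum.tendsto_sum_nat

theorem aemeasurable_fullSum : AEMeasurable fullSum gaussianSeq :=
  aemeasurable_of_tendsto_metrizable_ae atTop
    (fun N => (continuous_partialSum N).measurable.aemeasurable) ae_tendsto_partialSum

theorem toL2_phi {s : ℝ} {g : ℕ → ℂ}
    (h : (Summable fun n => coeff g n • e n) ∧ fullSum g ∈ hRad s) :
    (phi s g).toL2 = fullSum g := by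
  have h' : Summable (fun n => (g n / (z n : ℂ)) • e n) ∧
      ∑' n, (g n / (z n : ℂ)) • e n ∈ hRad s := h
  have hphi : phi s g = HRad.mk (fullSum g) h.2 := dif_pos h'
  rw [hphi, HRad.toL2_mk]

theorem tendsto_finSum_coeff {σ : ℝ} {g : ℕ → ℂ} (hs : Summable fun n => coeff g n • e n)
    {u : HRad σ} (hu : u.toL2 = fullSum g) :
    Tendsto (fun N => HRad.finSum σ N (coeff g)) atTop (𝓝 u) := by
  have h := HRad.tendsto_finSum u
  have hin : ∀ n, inner ℂ (e n) u.toL2 = coeff g n := fun n => by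
    rw [hu]; exact inner_e_tsum hs n
  simpa only [hin] using h

theorem continuous_coeff (n : ℕ) : Continuous fun g : ℕ → ℂ => coeff g n := by
  unfold coeff; fun_prop

/-- Almost surely `phi` is the limit of its partial sums in `H^s_rad`. Without this the push-forward
defining `mu` would be zero by convention. -/
theorem aemeasurable_phi {s : ℝ} (hs0 : 0 ≤ s) (hs : s < 1 / 2) :
    AEMeasurable (phi s) gaussianSeq := by
  refine aemeasurable_of_tendsto_metrizable_ae atTop
    (f := fun N g => HRad.finSum s N (coeff g))
    (fun N => (HRad.continuous_finSum continuous_coeff).measurable.aemeasurable) ?_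
  filter_upwards [ae_fullSum hs0 hs] with g hg
  exact tendsto_finSum_coeff hg.1 (toL2_phi hg)

/-! ### The measures as integrals over the Gaussian sequence -/

theorem continuous_phiN (N : ℕ) : Continuous (phiN N) :=
  (continuous_partialSum N).subtype_mk _

/-- Almost surely the series lies in `H^σ_rad`, so membership in `inHs s A` is the event that its
lift lies in `A`. This puts the limit on the probability space that carries all the `φ_N`. -/
theorem rho_inHs {V : ℂ → ℝ} (hV : Continuous V) {χ : ℝ → ℝ} (hχ : Continuous χ) {s σ : ℝ}
    (hs0 : 0 ≤ s) (hs : s < 1 / 2) (hσ0 : 0 ≤ σ) (hσ : σ < 1 / 2) {A : Set (HRad σ)}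
    (hA : MeasurableSet A) : rho V χ s (inHs s A) =
      ∫⁻ g, ((fun g => HRad.lift s σ (phi s g)) ⁻¹' A).indicator
        (fun g => ENNReal.ofReal (gibbsDensity V χ (fullSum g))) g ∂gaussianSeq := by
  have hm := measurableSet_inHs (s := s) hs0 hσ0 hA
  have hΦ : Measurable fun u : HRad s => ENNReal.ofReal (gibbsDensity V χ u.toL2) :=
    ((measurable_gibbsDensity hV hχ).comp (HRad.continuous_toL2 hs0).measurable).ennreal_ofReal
  unfold rho mu
  rw [withDensity_apply _ hm, ← lintegral_indicator hm,
    lintegral_map' (hΦ.indicator hm).aemeasurable (aemeasurable_phi hs0 hs)]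
  refine lintegral_congr_ae ?_
  filter_upwards [ae_fullSum hs0 hs, ae_fullSum hσ0 hσ] with g hg hgσ
  have h1 := toL2_phi hg
  have hiff : phi s g ∈ inHs s A ↔ HRad.lift s σ (phi s g) ∈ A := by
    rw [inHs_eq]
    refine ⟨fun h => h.2, fun h => ⟨?_, h⟩⟩
    rw [Set.mem_ofPred_eq, h1]
    exact hgσ.2
  by_cases h : HRad.lift s σ (phi s g) ∈ A
  · simp [Set.indicator, hiff, h, h1]
  · simp [Set.indicator, hiff, h]

theorem rhoN_interEN {V : ℂ → ℝ} (hV : Continuous V) {χ : ℝ → ℝ} (hχ : Continuous χ) {σ : ℝ}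
    (N : ℕ) {A : Set (HRad σ)} (hA : MeasurableSet A) : rhoN V χ N (interEN N A) =
      ∫⁻ g, ((fun g => HRad.finSum σ N (coeff g)) ⁻¹' A).indicator
        (fun g => ENNReal.ofReal (gibbsDensity V χ (partialSum N g))) g ∂gaussianSeq := by
  have hm := measurableSet_interEN (N := N) hA
  have hΦ : Measurable fun u : EN N => ENNReal.ofReal (gibbsDensity V χ (u : L2)) :=
    ((measurable_gibbsDensity hV hχ).comp
      (continuous_subtype_val (p := fun u => u ∈ EN N)).measurable).ennreal_ofReal
  unfold rhoN muN
  rw [withDensity_apply _ hm, ← lintegral_indicator hm,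
    lintegral_map (hΦ.indicator hm) (continuous_phiN N).measurable]
  refine lintegral_congr fun g => ?_
  have hiff : phiN N g ∈ interEN N A ↔ HRad.finSum σ N (coeff g) ∈ A := by
    have he : (HRad.finSum σ N (coeff g)).toL2 = (phiN N g : L2) := HRad.toL2_finSum N _
    constructor
    · rintro ⟨v, hv, hvg⟩
      rwa [HRad.toL2_injective (he.trans hvg.symm)]
    · exact fun h => ⟨_, h, he⟩
  by_cases h : HRad.finSum σ N (coeff g) ∈ A
  · simp only [Set.indicator, hiff, h, Set.mem_preimage, if_true]
    rfl
  · simp [Set.indicator, hiff, h]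

/-! ### Portmanteau inequalities -/

theorem indicator_ofReal_le {Ω : Type*} (S : Set Ω) (a b : Ω → ℝ) (x : Ω) :
    S.indicator (fun x => ENNReal.ofReal (a x)) x ≤
      S.indicator (fun x => ENNReal.ofReal (b x)) x + ENNReal.ofReal |b x - a x| := by
  by_cases hx : x ∈ S
  · simp only [Set.indicator, hx, if_true]
    refine (ENNReal.ofReal_le_ofReal ?_).trans ENNReal.ofReal_add_le
    linarith [neg_abs_le (b x - a x)]
  · simp [Set.indicator, hx]

section Portmanteau

variable {Ω X : Type*} [MeasurableSpace Ω] [TopologicalSpace X] [MeasurableSpace X]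
  [OpensMeasurableSpace X] {P : Measure Ω} {w : ℕ → Ω → X} {w' : Ω → X} {f : ℕ → Ω → ℝ} {f' : Ω → ℝ}

/-- If `w'` lies in `U`, so do all late `w N`. Fatou's lemma applies with the density frozen at
`f'`, and changing it to `f N` costs the `L¹` distance. -/
theorem lintegral_indicator_le_liminf_of_isOpen (hw : ∀ N, Measurable (w N))
    (hlim : ∀ᵐ x ∂P, Tendsto (fun N => w N x) atTop (𝓝 (w' x)))
    (hf : ∀ N, Measurable (f N)) (hf' : AEMeasurable f' P)
    (hff : Tendsto (fun N => ∫⁻ x, ENNReal.ofReal |f N x - f' x| ∂P) atTop (𝓝 0))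
    {U : Set X} (hU : IsOpen U) :
    ∫⁻ x, (w' ⁻¹' U).indicator (fun x => ENNReal.ofReal (f' x)) x ∂P ≤
      liminf (fun N => ∫⁻ x, (w N ⁻¹' U).indicator (fun x => ENNReal.ofReal (f N x)) x ∂P)
        atTop := by
  calc ∫⁻ x, (w' ⁻¹' U).indicator (fun x => ENNReal.ofReal (f' x)) x ∂P
      ≤ ∫⁻ x, liminf (fun N => (w N ⁻¹' U).indicator (fun x => ENNReal.ofReal (f' x)) x) atTop ∂P := by
        refine lintegral_mono_ae ?_
        filter_upwards [hlim] with x hx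
        by_cases hxU : w' x ∈ U
        · refine le_liminf_of_le (by isBoundedDefault) ?_
          filter_upwards [hx (hU.mem_nhds hxU)] with N hN
          rw [Set.indicator_of_mem (show x ∈ w' ⁻¹' U from hxU),
            Set.indicator_of_mem (show x ∈ w N ⁻¹' U from hN)]
        · simp [Set.indicator, hxU]
    _ ≤ liminf (fun N => ∫⁻ x, (w N ⁻¹' U).indicator (fun x => ENNReal.ofReal (f' x)) x ∂P) atTop :=
        lintegral_liminf_le' fun N => hf'.ennreal_ofReal.indicator (hw N hU.measurableSet)
    _ ≤ liminf (fun N => ∫⁻ x, (w N ⁻¹' U).indicator (fun x => ENNReal.ofReal (f N x)) x ∂P +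
          ∫⁻ x, ENNReal.ofReal |f N x - f' x| ∂P) atTop := by
        refine liminf_le_liminf (Eventually.of_forall fun N => ?_)
        rw [← lintegral_add_left ((hf N).ennreal_ofReal.indicator (hw N hU.measurableSet))]
        exact lintegral_mono fun x => indicator_ofReal_le _ _ _ x
    _ = _ := ENNReal.liminf_add_of_right_tendsto_zero hff _

/-- The same argument with the reverse Fatou lemma, for which the frozen density, integrable by
`hfin`, is the dominating function. -/
theorem limsup_lintegral_indicator_le_of_isClosed (hw : ∀ N, Measurable (w N))
    (hlim : ∀ᵐ x ∂P, Tendsto (fun N => w N x) atTop (𝓝 (w' x)))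
    (hf' : AEMeasurable f' P) (hfin : ∫⁻ x, ENNReal.ofReal (f' x) ∂P ≠ ⊤)
    (hff : Tendsto (fun N => ∫⁻ x, ENNReal.ofReal |f N x - f' x| ∂P) atTop (𝓝 0))
    {F : Set X} (hF : IsClosed F) :
    limsup (fun N => ∫⁻ x, (w N ⁻¹' F).indicator (fun x => ENNReal.ofReal (f N x)) x ∂P) atTop ≤
      ∫⁻ x, (w' ⁻¹' F).indicator (fun x => ENNReal.ofReal (f' x)) x ∂P := by
  have hmk := hf'.ae_eq_mk
  set k := hf'.mk f' with hk
  have hkm : Measurable k := hf'.measurable_mk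
  have hcongr : ∀ S : Set Ω, ∫⁻ x, S.indicator (fun x => ENNReal.ofReal (f' x)) x ∂P =
      ∫⁻ x, S.indicator (fun x => ENNReal.ofReal (k x)) x ∂P := by
    intro S
    refine lintegral_congr_ae ?_
    filter_upwards [hmk] with x hx
    simp only [Set.indicator, hx]
  have hfin' : ∫⁻ x, ENNReal.ofReal (k x) ∂P ≠ ⊤ := by
    have := hcongr Set.univ
    simp only [Set.indicator_univ] at this
    rwa [← this]
  calc limsup (fun N => ∫⁻ x, (w N ⁻¹' F).indicator (fun x => ENNReal.ofReal (f N x)) x ∂P) atTop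
      ≤ limsup (fun N => ∫⁻ x, (w N ⁻¹' F).indicator (fun x => ENNReal.ofReal (k x)) x ∂P +
          ∫⁻ x, ENNReal.ofReal |f N x - f' x| ∂P) atTop := by
        refine limsup_le_limsup (Eventually.of_forall fun N => ?_)
        dsimp only
        rw [← lintegral_add_left (hkm.ennreal_ofReal.indicator (hw N hF.measurableSet))]
        refine lintegral_mono_ae ?_
        filter_upwards [hmk] with x hx
        rw [abs_sub_comm, hx]
        exact indicator_ofReal_le _ _ _ x
    _ = limsup (fun N => ∫⁻ x, (w N ⁻¹' F).indicator (fun x => ENNReal.ofReal (k x)) x ∂P) atTop :=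
        ENNReal.limsup_add_of_right_tendsto_zero hff _
    _ ≤ ∫⁻ x, limsup (fun N => (w N ⁻¹' F).indicator (fun x => ENNReal.ofReal (k x)) x) atTop ∂P :=
        limsup_lintegral_le (fun x => ENNReal.ofReal (k x))
          (fun N => hkm.ennreal_ofReal.indicator (hw N hF.measurableSet))
          (fun N => Eventually.of_forall fun x => Set.indicator_le_self' (fun _ _ => zero_le) x)
          hfin'
    _ ≤ ∫⁻ x, (w' ⁻¹' F).indicator (fun x => ENNReal.ofReal (k x)) x ∂P := by
        refine lintegral_mono_ae ?_
        filter_upwards [hlim] with x hx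
        by_cases hxF : w' x ∈ F
        · refine limsup_le_of_le (by isBoundedDefault) (Eventually.of_forall fun N => ?_)
          simp only [Set.indicator, Set.mem_preimage, hxF, if_true]
          split_ifs <;> simp
        · refine limsup_le_of_le (by isBoundedDefault) ?_
          filter_upwards [hx (hF.isOpen_compl.mem_nhds hxF)] with N hN
          rw [Set.indicator_of_notMem (show x ∉ w N ⁻¹' F from hN)]
          exact zero_le
    _ = _ := (hcongr _).symm

end Portmanteau

/-! ### The moment bounds in terms of `L²` functionals -/

theorem exists_indicator_moment_partialSum_le {b : ℝ} (hb2 : 2 ≤ b) (hb4 : b < 4) (R : ℝ) :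
    ∃ K : ℝ≥0∞, K ≠ ⊤ ∧ ∀ N m : ℕ, 1 ≤ m →
      ∫⁻ g, {u : L2 | ‖u‖ < R}.indicator (fun u => moment b u ^ m) (partialSum N g) ∂gaussianSeq ≤
        (K * (m : ℝ≥0∞) ^ (b / 4)) ^ m := by
  obtain ⟨K, hK, h⟩ := exists_moment_le hb2 hb4 R
  refine ⟨K, hK, fun N m hm => (le_of_eq ?_).trans (h N m hm)⟩
  rw [← lintegral_indicator (measurableSet_norm_partialSum_lt N R)]
  rfl

theorem exists_moment_partialSum_le : ∃ B : ℝ≥0∞, B ≠ ⊤ ∧ ∀ N,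
    ∫⁻ g, moment 24 (partialSum N g) ∂gaussianSeq ≤ B := by
  obtain ⟨B, hB, h⟩ := exists_lintegral_expansion_rpow_le (q := 24) (by norm_num)
  refine ⟨B, hB, fun N => (le_of_eq ?_).trans (h N)⟩
  refine lintegral_congr fun g => lintegral_congr_ae ?_
  filter_upwards [partialSum_coe N g] with x hx
  rw [hx]

/-! ### Bounds for the potential and the cutoff -/

theorem one_add_rpow_le {x b : ℝ} (hx : 0 ≤ x) (hb : 0 ≤ b) :
    (1 + x) ^ b ≤ 2 ^ b * (1 + x ^ b) := by
  have hxb : 0 ≤ x ^ b := Real.rpow_nonneg hx b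
  rcases le_total x 1 with h | h
  · calc (1 + x) ^ b ≤ 2 ^ b := Real.rpow_le_rpow (by linarith) (by linarith) hb
      _ ≤ _ := le_mul_of_one_le_right (by positivity) (by linarith)
  · calc (1 + x) ^ b ≤ (2 * x) ^ b := Real.rpow_le_rpow (by linarith) (by linarith) hb
      _ = 2 ^ b * x ^ b := Real.mul_rpow zero_le_two hx
      _ ≤ _ := mul_le_mul_of_nonneg_left (by linarith) (by positivity)

/-- The exponent `24` is `4 · 6`: the potential grows at most like the sixth power, and the
truncation error involves its fourth power. -/
theorem enorm_pow_four_le {V : ℂ → ℝ} {C a : ℝ} (ha : a ≤ 6)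
    (h : ∀ w, |V w| ≤ C * (1 + ‖w‖) ^ a) (w : ℂ) :
    ‖V w‖ₑ ^ (4 : ℕ) ≤ ENNReal.ofReal (|C| ^ 4 * 2 ^ (24 : ℝ)) * (1 + ‖w‖ₑ ^ (24 : ℝ)) := by
  have h1 : |V w| ≤ |C| * (1 + ‖w‖) ^ 6 := by
    calc |V w| ≤ C * (1 + ‖w‖) ^ a := h w
      _ ≤ |C| * (1 + ‖w‖) ^ a := mul_le_mul_of_nonneg_right (le_abs_self C) (by positivity)
      _ ≤ |C| * (1 + ‖w‖) ^ (6 : ℝ) := mul_le_mul_of_nonneg_left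
          (Real.rpow_le_rpow_of_exponent_le (by linarith [norm_nonneg w]) ha) (abs_nonneg C)
      _ = _ := by norm_cast
  have h2 : |V w| ^ 4 ≤ |C| ^ 4 * 2 ^ (24 : ℝ) * (1 + ‖w‖ ^ (24 : ℝ)) := by
    calc |V w| ^ 4 ≤ (|C| * (1 + ‖w‖) ^ 6) ^ 4 := pow_le_pow_left₀ (abs_nonneg _) h1 4
      _ = |C| ^ 4 * (1 + ‖w‖) ^ (24 : ℝ) := by
          rw [mul_pow, ← pow_mul]; norm_cast
      _ ≤ |C| ^ 4 * (2 ^ (24 : ℝ) * (1 + ‖w‖ ^ (24 : ℝ))) := mul_le_mul_of_nonneg_left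
          (one_add_rpow_le (norm_nonneg w) (by norm_num)) (by positivity)
      _ = _ := by ring
  rw [← ofReal_norm, ← ofReal_norm, Real.norm_eq_abs, ← ENNReal.ofReal_pow (abs_nonneg _),
    ENNReal.ofReal_rpow_of_nonneg (norm_nonneg _) (by norm_num), ← ENNReal.ofReal_one,
    ← ENNReal.ofReal_add zero_le_one (by positivity), ← ENNReal.ofReal_mul (by positivity)]
  exact ENNReal.ofReal_le_ofReal h2

theorem exists_cutoff_bounds {χ : ℝ → ℝ} (hχ : Continuous χ) (hs : HasCompactSupport χ) :
    ∃ X R : ℝ, (∀ x, χ x ≤ X) ∧ ∀ x, R ≤ x → χ x = 0 := by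
  obtain ⟨X, hX⟩ := hs.exists_bound_of_continuous hχ
  obtain ⟨R, hR⟩ := hs.isCompact.bddAbove
  refine ⟨X, R + 1, fun x => (le_abs_self _).trans (hX x), fun x hx => ?_⟩
  by_contra hne
  have := hR (subset_tsupport χ hne)
  linarith

theorem integrable_comp_of_moment {V : ℂ → ℝ} (hV : Continuous V) {c : ℝ}
    (hgrow : ∀ w, ‖V w‖ₑ ^ (4 : ℕ) ≤ ENNReal.ofReal c * (1 + ‖w‖ₑ ^ (24 : ℝ))) {u : L2}
    (hu : moment 24 u < ⊤) : Integrable (fun x => V (u x)) vol := by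
  refine ⟨hV.comp_aestronglyMeasurable (Lp.aestronglyMeasurable u), ?_⟩
  have hpt : ∀ w, ‖V w‖ₑ ≤ 1 + ENNReal.ofReal c * (1 + ‖w‖ₑ ^ (24 : ℝ)) := by
    intro w
    rcases le_total ‖V w‖ₑ 1 with h | h
    · exact h.trans le_self_add
    · exact (le_self_pow₀ h (by norm_num)).trans ((hgrow w).trans le_add_self)
  refine (lintegral_mono fun x => hpt (u x)).trans_lt ?_
  rw [lintegral_add_left measurable_const, lintegral_const_mul' _ _ ENNReal.ofReal_ne_top,
    lintegral_add_left measurable_const, lintegral_const]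
  have h1 : ∫⁻ x, ‖u x‖ₑ ^ (24 : ℝ) ∂vol ≠ ⊤ := hu.ne
  have h2 := measure_ne_top vol Set.univ
  exact lt_top_iff_ne_top.2 (by finiteness)

end GibbsDisc

end

/-! ### The theorem -/

open GibbsDisc in
theorem theorem2
    (V : ℂ → ℝ) (hV : ContDiff ℝ ∞ V)
    (G : ℝ → ℝ) (hG : ContDiff ℝ ∞ G) (hVG : ∀ w : ℂ, V w = G (‖w‖ ^ 2))
    (α : ℝ) (hα₀ : 0 < α) (hα₄ : α < 4)
    (hgrowth : ∀ k₁ k₂ : ℕ, ∃ C : ℝ, 0 < C ∧ ∀ w : ℂ,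
      ‖GibbsDisc.dZ^[k₁] (GibbsDisc.dZbar^[k₂] (fun v : ℂ => (V v : ℂ))) w‖ ≤
        C * (1 + ‖w‖) ^ (2 + α - (k₁ : ℝ) - (k₂ : ℝ)))
    (β : ℝ) (hβ₂ : 2 ≤ β) (hβ₄ : β < 4)
    (hdefocusing : ∃ C : ℝ, 0 < C ∧ ∀ w : ℂ, -C * (1 + ‖w‖) ^ β ≤ V w)
    (χ : ℝ → ℝ) (hχ : Continuous χ) (hχ_supp : HasCompactSupport χ) (hχ_nonneg : ∀ x, 0 ≤ χ x)
    (s : ℝ) (hs : max (1 / 3) (max (1 - 2 / α) (1 - 2 / β)) < s) (hs' : s < 1 / 2) :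
    (∀ᵐ u ∂(GibbsDisc.mu s), Integrable (fun x => V (u.toL2 x)) GibbsDisc.vol) ∧
    (∀ p : ℝ≥0∞, 1 ≤ p → p ≠ ⊤ →
      MemLp (fun u : GibbsDisc.HRad s => GibbsDisc.gibbsDensity V χ u.toL2) p (GibbsDisc.mu s)) ∧
    (∀ σ : ℝ, s ≤ σ → σ < 1 / 2 →
      (∀ U : Set (GibbsDisc.HRad σ), IsOpen U →
        MeasurableSet (GibbsDisc.inHs s U) ∧
        GibbsDisc.rho V χ s (GibbsDisc.inHs s U) ≤
          liminf (fun N : ℕ => GibbsDisc.rhoN V χ N (GibbsDisc.interEN N U)) atTop) ∧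
      (∀ F : Set (GibbsDisc.HRad σ), IsClosed F →
        MeasurableSet (GibbsDisc.inHs s F) ∧
        limsup (fun N : ℕ => GibbsDisc.rhoN V χ N (GibbsDisc.interEN N F)) atTop ≤
          GibbsDisc.rho V χ s (GibbsDisc.inHs s F))) := by
  have hs0 : 0 ≤ s := by linarith [(le_max_left _ _).trans_lt hs]
  have hVc : Continuous V := hV.continuous
  -- The case of no derivatives is the polynomial growth of `V`, of order `2 + α < 6`.
  obtain ⟨C₁, -, hC₁⟩ := hgrowth 0 0
  have hgrow := enorm_pow_four_le (V := V) (C := C₁) (a := 2 + α) (by linarith) fun w => by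
    simpa using hC₁ w
  obtain ⟨C₂, hC₂0, hC₂⟩ := hdefocusing
  have hC : 0 ≤ C₂ * 2 ^ β := by positivity
  have hb : 0 ≤ β := by linarith
  have hlow : ∀ w, -V w ≤ C₂ * 2 ^ β * (1 + ‖w‖ ^ β) := fun w => by
    have h1 := hC₂ w
    have h2 := mul_le_mul_of_nonneg_left (one_add_rpow_le (norm_nonneg w) hb) hC₂0.le
    linarith
  obtain ⟨X, R, hX, hR⟩ := exists_cutoff_bounds hχ hχ_supp
  obtain ⟨K, hK, hm⟩ := exists_indicator_moment_partialSum_le hβ₂ hβ₄ R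
  obtain ⟨B, hB, h24⟩ := exists_moment_partialSum_le
  have hψ : ∀ N, Measurable (partialSum N) := fun N => (continuous_partialSum N).measurable
  have hconv := tendsto_lintegral_gibbsDensity_sub hVc hχ hC hb hβ₄ hlow hgrow hχ_nonneg hX hR hK hB
    hψ aemeasurable_fullSum ae_tendsto_partialSum hm h24
  have hmfull : ∀ m : ℕ, 1 ≤ m → ∫⁻ g, {u : L2 | ‖u‖ < R}.indicator (fun u => GibbsDisc.moment β u ^ m)
      (fullSum g) ∂gaussianSeq ≤ (K * (m : ℝ≥0∞) ^ (β / 4)) ^ m := fun m h1 =>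
    lintegral_le_of_tendsto (lowerSemicontinuous_indicator_moment_pow m) hψ ae_tendsto_partialSum
      fun N => hm N m h1
  have h24full : ∫⁻ g, GibbsDisc.moment 24 (fullSum g) ∂gaussianSeq ≤ B :=
    lintegral_le_of_tendsto lowerSemicontinuous_moment hψ ae_tendsto_partialSum h24
  have hrpow : ∀ p : ℝ, 0 < p →
      ∫⁻ g, ENNReal.ofReal (gibbsDensity V χ (fullSum g) ^ p) ∂gaussianSeq < ⊤ := fun p hp => by
    obtain ⟨D, hD, h⟩ :=
      exists_lintegral_gibbsDensity_rpow_le (R := R) (X := X) hC hb hβ₄ hp hK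
    exact (h V χ hlow hχ_nonneg hX hR _ aemeasurable_fullSum hmfull).trans_lt
      (lt_top_iff_ne_top.2 hD)
  have hphi := aemeasurable_phi hs0 hs'
  have htoL2 : Measurable (HRad.toL2 (σ := s)) := (HRad.continuous_toL2 hs0).measurable
  have hdens := measurable_gibbsDensity hVc hχ
  refine ⟨?_, fun p hp1 hp => ?_, fun σ hsσ hσ => ?_⟩
  · have hset : MeasurableSet {u : HRad s | GibbsDisc.moment 24 u.toL2 < ⊤} :=
      measurableSet_lt (lowerSemicontinuous_moment.measurable.comp htoL2) measurable_const
    have hae : ∀ᵐ u : HRad s ∂(mu s), GibbsDisc.moment 24 u.toL2 < ⊤ := by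
      unfold mu
      rw [ae_map_iff hphi hset]
      filter_upwards [ae_fullSum hs0 hs', ae_lt_top'
        (lowerSemicontinuous_moment.measurable.comp_aemeasurable aemeasurable_fullSum)
        (ne_top_of_le_ne_top hB h24full)] with g hg hg2
      rw [toL2_phi hg]
      exact hg2
    filter_upwards [hae] with u hu
    exact integrable_comp_of_moment hVc hgrow hu
  · have hp0 : p ≠ 0 := (zero_lt_one.trans_le hp1).ne'
    unfold mu
    refine (memLp_map_measure_iff (g := fun u : HRad s => gibbsDensity V χ u.toL2)
      (hdens.comp htoL2).aestronglyMeasurable hphi).2 ?_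
    refine ⟨((hdens.comp htoL2).comp_aemeasurable hphi).aestronglyMeasurable, ?_⟩
    rw [eLpNorm_lt_top_iff_lintegral_rpow_enorm_lt_top hp0 hp]
    refine lt_of_eq_of_lt (lintegral_congr_ae ?_) (hrpow p.toReal (ENNReal.toReal_pos hp0 hp))
    filter_upwards [ae_fullSum hs0 hs'] with g hg
    rw [Function.comp_apply, toL2_phi hg, Real.enorm_of_nonneg (gibbsDensity_nonneg V hχ_nonneg _),
      ENNReal.ofReal_rpow_of_nonneg (gibbsDensity_nonneg V hχ_nonneg _) ENNReal.toReal_nonneg]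
  · have hσ0 : 0 ≤ σ := hs0.trans hsσ
    have hw : ∀ N, Measurable fun g => HRad.finSum σ N (coeff g) := fun N =>
      (HRad.continuous_finSum continuous_coeff).measurable
    -- Both sides live in `H^σ_rad`, so that open and closed sets for its finer topology can be
    -- tested.
    have hlim : ∀ᵐ g ∂gaussianSeq, Tendsto (fun N => HRad.finSum σ N (coeff g)) atTop
        (𝓝 (HRad.lift s σ (phi s g))) := by
      filter_upwards [ae_fullSum hs0 hs', ae_fullSum hσ0 hσ] with g hg hgσ
      have h1 := toL2_phi hg
      refine tendsto_finSum_coeff hg.1 ?_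
      rw [HRad.toL2_lift (h1 ▸ hgσ.2), h1]
    refine ⟨fun U hU => ⟨measurableSet_inHs hs0 hσ0 hU.measurableSet, ?_⟩,
      fun F hF => ⟨measurableSet_inHs hs0 hσ0 hF.measurableSet, ?_⟩⟩
    · rw [rho_inHs hVc hχ hs0 hs' hσ0 hσ hU.measurableSet]
      simp only [rhoN_interEN hVc hχ _ hU.measurableSet]
      exact lintegral_indicator_le_liminf_of_isOpen hw hlim (fun N => hdens.comp (hψ N))
        (hdens.comp_aemeasurable aemeasurable_fullSum) hconv hU
    · rw [rho_inHs hVc hχ hs0 hs' hσ0 hσ hF.measurableSet]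
      simp only [rhoN_interEN hVc hχ _ hF.measurableSet]
      refine limsup_lintegral_indicator_le_of_isClosed hw hlim
        (hdens.comp_aemeasurable aemeasurable_fullSum) ?_ hconv hF
      -- The case `p = 1` is the integrability of the limit density required by the reverse Fatou
      -- lemma.
      simpa using (hrpow 1 one_pos).ne
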